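/- For $x=(x^1,x^2)$ and $y=(y^1,y^2)$ in $\mathbb{R}^2$ with $x^1\ne y^1$ and $x^2\ne y^2$ put $$D(x,y)=\Big(\frac{|x^1-y^1|}{|x^2-y^2|}+\frac{|x^2-y^2|}{|x^1-y^1|}\Big)^{-1}.$$ Let $\theta_1\in(0,1]$ and $A\ge 0$. A function $K(x,y)$, complex-valued and defined for $x^1\neq y^1$, $x^2\neq y^2$, is called a CZX kernel with exponents $\theta_1$ and $\theta_2=1$ and constant $A$ if $$|K(x,y)|\le A\,\frac{1}{|x^1-y^1|}\,\frac{1}{|x^2-y^2|}\,D(x,y),$$ $$|K(x,y)-K((w^1,x^2),y)|\le A\,\frac{|x^1-w^1|^{\theta_1}}{|x^1-y^1|^{1+\theta_1}}\,\frac{1}{|x^2-y^2|}\,D(x,y)\quad\text{whenever } |x^1-w^1|\le\tfrac12|x^1-y^1|,$$ and the three symmetric estimates hold, in which $x^2$, $y^1$ or $y^2$ is the variable that is changed. A bounded linear operator $T$ on $L^2(\mathbb{R}^2)$ (complex-valued functions) has the kernel $K$ if $$\int_{\mathbb{R}^2} (Tf)(x)\,g(x)\,dx=\iint K(x,y)f(y)g(x)\,dy\,dx$$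 for all finite linear combinations $f,g$ of indicators of cubes (axes-parallel squares) with $\{f\ne0\}\cap\{g\neq0\}=\varnothing$. A collection $\mathscr S$ of cubes is $\epsilon$-sparse if there are pairwise disjoint measurable sets $E(S)\subset S$, $S\in\mathscr S$, with $|E(S)|\ge\epsilon|S|$. Write $\langle f\rangle_{S,p}=\big(\frac1{|S|}\int_S|f|^p\big)^{1/p}$ and $p'=p/(p-1)$. **Theorem.** There is an absolute constant $\epsilon>0$ with the following property. Let $T$ be a bounded linear operator on $L^2(\mathbb{R}^2)$ that has a CZX kernel with exponents $\theta_1\in(0,1]$ and $\theta_2=1$. Then $T$ extends from $L^1(\mathbb{R}^2)\cap L^2(\mathbb{R}^2)$ to a linear operator, still denoted by $T$, that is bounded from $L^1(\mathbb{R}^2)$ to $L^{1,\infty}(\mathbb{R}^2)$, and for every $p\in(1,\infty)$ and every compactly supported $f\in L^p(\mathbb{R}^2)$ there is an $\epsilon$-sparse collection $\mathscr S$ of cubes such that $$|Tf|\le C\,p'\sum_{S\in\mathscr S}\langle f\rangle_{S,p}\,1_S\qquad\text{almost everywhere.}$$ Here $C$ depends only on $\theta_1$, on the kernel constant $A$ and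 on an upper bound for the norm of $T$ on $L^2(\mathbb{R}^2)$; in particular it does not depend on $p$ or $f$. -/

import Mathlib

open MeasureTheory
open scoped ENNReal

namespace CZX

/-- The plane `ℝ² = ℝ × ℝ`; `volume` is two-dimensional Lebesgue measure. -/
abbrev Plane : Type := ℝ × ℝ

/-- A cube of `ℝ²`: an axes-parallel square with positive side length. -/
structure Cube where
  corner : Plane
  side : ℝ
  side_pos : 0 < side

/-- The points of a cube (half-open, so that adjacent cubes are disjoint). -/
def Cube.toSet (Q : Cube) : Set Plane :=
  Set.Ico Q.corner.1 (Q.corner.1 + Q.side) ×ˢ Set.Ico Q.corner.2 (Q.corner.2 + Q.side)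

/-- The decay factor `D_θ(x, y)`, used where `x¹ ≠ y¹` and `x² ≠ y²`. -/
noncomputable def decay (θ : ℝ) (x y : Plane) : ℝ :=
  (|x.1 - y.1| / |x.2 - y.2| + |x.2 - y.2| / |x.1 - y.1|) ^ (-θ)

/-- `K` is a CZX kernel with exponents `θ₁, θ₂` and constant `A`. Only the values `K x y` with
`x¹ ≠ y¹` and `x² ≠ y²` matter. -/
structure IsCZXKernel (θ₁ θ₂ A : ℝ) (K : Plane → Plane → ℂ) : Prop where
  size : ∀ x y : Plane, x.1 ≠ y.1 → x.2 ≠ y.2 →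
    ‖K x y‖ ≤ A * (1 / |x.1 - y.1|) * (1 / |x.2 - y.2|) * decay θ₂ x y
  holder_x1 : ∀ (x y : Plane) (w : ℝ), x.1 ≠ y.1 → x.2 ≠ y.2 →
    |x.1 - w| ≤ |x.1 - y.1| / 2 →
    ‖K x y - K (w, x.2) y‖ ≤
      A * (|x.1 - w| ^ θ₁ / |x.1 - y.1| ^ (1 + θ₁)) * (1 / |x.2 - y.2|) * decay θ₂ x y
  holder_x2 : ∀ (x y : Plane) (w : ℝ), x.1 ≠ y.1 → x.2 ≠ y.2 →
    |x.2 - w| ≤ |x.2 - y.2| / 2 →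
    ‖K x y - K (x.1, w) y‖ ≤
      A * (1 / |x.1 - y.1|) * (|x.2 - w| ^ θ₁ / |x.2 - y.2| ^ (1 + θ₁)) * decay θ₂ x y
  holder_y1 : ∀ (x y : Plane) (w : ℝ), x.1 ≠ y.1 → x.2 ≠ y.2 →
    |y.1 - w| ≤ |x.1 - y.1| / 2 →
    ‖K x y - K x (w, y.2)‖ ≤
      A * (|y.1 - w| ^ θ₁ / |x.1 - y.1| ^ (1 + θ₁)) * (1 / |x.2 - y.2|) * decay θ₂ x y
  holder_y2 : ∀ (x y : Plane) (w : ℝ), x.1 ≠ y.1 → x.2 ≠ y.2 →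
    |y.2 - w| ≤ |x.2 - y.2| / 2 →
    ‖K x y - K x (y.1, w)‖ ≤
      A * (1 / |x.1 - y.1|) * (|y.2 - w| ^ θ₁ / |x.2 - y.2| ^ (1 + θ₁)) * decay θ₂ x y

/-- Finite complex linear combinations of indicators of cubes. -/
noncomputable def cubeStep : Submodule ℂ (Plane → ℂ) :=
  Submodule.span ℂ (Set.range fun Q : Cube => Q.toSet.indicator fun _ => (1 : ℂ))

theorem memLp_cubeStep {f : Plane → ℂ} (hf : f ∈ cubeStep) : MemLp f 2 (volume : Measure Plane) := by
  unfold cubeStep at hf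
  induction hf using Submodule.span_induction with
  | mem f hf =>
    obtain ⟨Q, rfl⟩ := hf
    refine memLp_indicator_const 2 (measurableSet_Ico.prod measurableSet_Ico) 1 (Or.inr ?_)
    change volume (Set.Ico _ _ ×ˢ Set.Ico _ _) ≠ ∞
    rw [Measure.volume_eq_prod, Measure.prod_prod, Real.volume_Ico, Real.volume_Ico]
    exact ENNReal.mul_ne_top ENNReal.ofReal_ne_top ENNReal.ofReal_ne_top
  | zero => exact MemLp.zero
  | add f g _ _ hf hg => exact hf.add hg
  | smul c f _ hf => exact hf.const_smul c

/-- `T` is associated with the kernel `K`: the bilinear pairing `⟨Tf, g⟩ = ∫ (Tf) g` equals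
`∬ K(x, y) f(y) g(x) dy dx` for finite linear combinations `f, g` of indicators of cubes with
`{f ≠ 0} ∩ {g ≠ 0} = ∅`. -/
def HasKernel (T : Lp ℂ 2 (volume : Measure Plane) →L[ℂ] Lp ℂ 2 (volume : Measure Plane))
    (K : Plane → Plane → ℂ) : Prop :=
  ∀ (f g : Plane → ℂ) (hf : f ∈ cubeStep), g ∈ cubeStep →
    {x | f x ≠ 0} ∩ {x | g x ≠ 0} = ∅ →
    ∫ x, T ((memLp_cubeStep hf).toLp f) x * g x = ∫ x, ∫ y, K x y * f y * g x

/-- `T₁` is the extension of `T` to a bounded linear operator from `L¹` to `L^{1,∞}`: it is of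
weak type `(1,1)` and agrees with `T` on `L¹ ∩ L²` (hence is unique, by density). -/
structure IsWeakExtension
    (T : Lp ℂ 2 (volume : Measure Plane) →L[ℂ] Lp ℂ 2 (volume : Measure Plane))
    (T₁ : Lp ℂ 1 (volume : Measure Plane) →ₗ[ℂ] (Plane →ₘ[(volume : Measure Plane)] ℂ)) :
    Prop where
  weak_type : ∃ B : ℝ, ∀ (f : Lp ℂ 1 (volume : Measure Plane)) (t : ℝ), 0 < t →
    volume {x | t < ‖T₁ f x‖} ≤ ENNReal.ofReal (B * ‖f‖ / t)
  agrees : ∀ (f : Plane → ℂ) (h₁ : MemLp f 1 (volume : Measure Plane))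
    (h₂ : MemLp f 2 (volume : Measure Plane)),
    T₁ (h₁.toLp f) =ᵐ[volume] T (h₂.toLp f)

/-- A collection of cubes is `ε`-sparse if there are pairwise disjoint (measurable) subsets
`E(S) ⊆ S` with `|E(S)| ≥ ε |S|`. -/
def IsSparse (ε : ℝ) (𝒮 : Set Cube) : Prop :=
  ∃ E : Cube → Set Plane,
    (∀ S ∈ 𝒮, MeasurableSet (E S) ∧ E S ⊆ S.toSet ∧
      ENNReal.ofReal ε * volume S.toSet ≤ volume (E S)) ∧
    𝒮.PairwiseDisjoint E

/-- `⟨f⟩_{S,p} = (|S|⁻¹ ∫_S |f|^p)^{1/p}`. -/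
noncomputable def pAverage (f : Plane → ℂ) (p : ℝ) (S : Cube) : ℝ≥0∞ :=
  ((volume S.toSet)⁻¹ * ∫⁻ x in S.toSet, ‖f x‖ₑ ^ p) ^ (1 / p)

theorem memLp_one_of_hasCompactSupport {f : Plane → ℂ} {p : ℝ} (hp : 1 ≤ p)
    (hf : MemLp f (ENNReal.ofReal p) (volume : Measure Plane)) (hc : HasCompactSupport f) :
    MemLp f 1 (volume : Measure Plane) :=
  hf.mono_exponent_of_measure_support_ne_top (s := tsupport f)
    (fun _ hx => image_eq_zero_of_notMem_tsupport hx)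
    hc.isCompact.measure_lt_top.ne (by simpa using hp)

/-- Pointwise `L^p`-sparse domination with constants `C` and `ε`, for an operator that is defined
on `L¹` and so on all compactly supported functions in `L^p`. The right-hand side is a sum in
`[0, ∞]`. -/
def PointwiseSparseDomination
    (T₁ : Lp ℂ 1 (volume : Measure Plane) →ₗ[ℂ] (Plane →ₘ[(volume : Measure Plane)] ℂ))
    (p : ℝ) (hp : 1 ≤ p) (C ε : ℝ) : Prop :=
  ∀ (f : Plane → ℂ) (hf : MemLp f (ENNReal.ofReal p) (volume : Measure Plane))
    (hc : HasCompactSupport f),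
    ∃ 𝒮 : Set Cube, IsSparse ε 𝒮 ∧
      ∀ᵐ x : Plane, ‖T₁ ((memLp_one_of_hasCompactSupport hp hf hc).toLp f) x‖ₑ ≤
        ENNReal.ofReal C *
          ∑' S : 𝒮, (S : Cube).toSet.indicator (fun _ => pAverage f p S) x

end CZX

/-! For θ₂ = 1 the size factor equals 1/(|x¹-y¹|² + |x²-y²|²), so the kernel has the size of a
classical Calderón–Zygmund kernel. Its smoothness is weaker: moving x¹ by h gains only
(h/|x¹-y¹|)^θ, measured against the coordinate gap and not against |x-y|, so nothing is gained when
y lies in a strip of width about ℓ along a coordinate line through x. Such a strip fills only a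
fraction ℓ/r of a square of radius r. With q = p' and d = θ/2, the L^q average of the gain factor
over the shell at distance 2^k ℓ is therefore O(2^{-kd/q}), and summing over k costs q/d. This is a
Hörmander condition in L^{p'} whose constant is linear in p' (`IsRegularKernel.hormander`); it is
the source of the factor p' in the theorem.

The case p = 2 of this condition, applied to the transposed kernel and integrated against the
constant 1, gives the weak type (1,1) through a Calderón–Zygmund decomposition
(`HasKernel.weak_type`). Truncation and Borel–Cantelli then give the extension to L¹
(`IsWeakType.exists_extension`).

The sparse bound is a stopping-time argument. Given a cube Q and a = ⟨f⟩_{3Q,p}, let E be the part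
of Q where T(f 1_{3Q}) or the L^p maximal function of f 1_{3Q} is much larger than a. The stopping
cubes P of 1_E cover E up to a null set, fill at most half of Q, and each has at most half of its
measure in E. On P the difference T(f 1_{3Q}) - T(f 1_{3P}) is the kernel integral of f over 3Q∖3P;
by the Hörmander condition it oscillates on P by O(p'a), and at a suitable point of P it is O(a). So
T(f 1_{3Q}) is O(p'a) off the cubes P, and on P it is at most O(p'a) + |T(f 1_{3P})|
(`IsCZExtension.exists_children`). Iteration gives a sparse tree of cubes
(`ae_le_tsum_descendants`). Away from the support of f the size of the kernel suffices, with
concentric cubes of side growing by factors of 3. -/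

namespace CZX

open Metric Filter Topology

/-! ### Cubes and the maximal theorem. -/

section

namespace Cube

/-- The centre of a cube. -/
noncomputable def center (Q : Cube) : Plane := (Q.corner.1 + Q.side / 2, Q.corner.2 + Q.side / 2)

/-- The cube with centre `c` and side `2 r`. -/
def ofCenter (c : Plane) (r : ℝ) (hr : 0 < r) : Cube := ⟨(c.1 - r, c.2 - r), 2 * r, by linarith⟩

/-- The concentric cube with three times the side. -/
def triple (Q : Cube) : Cube :=
  ⟨(Q.corner.1 - Q.side, Q.corner.2 - Q.side), 3 * Q.side, by linarith [Q.side_pos]⟩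

theorem mem_toSet {Q : Cube} {x : Plane} :
    x ∈ Q.toSet ↔ (Q.corner.1 ≤ x.1 ∧ x.1 < Q.corner.1 + Q.side) ∧
      (Q.corner.2 ≤ x.2 ∧ x.2 < Q.corner.2 + Q.side) := Iff.rfl

theorem measurableSet_toSet (Q : Cube) : MeasurableSet Q.toSet :=
  measurableSet_Ico.prod measurableSet_Ico

theorem toSet_subset_closedBall (Q : Cube) : Q.toSet ⊆ closedBall Q.center (Q.side / 2) := by
  intro x hx
  obtain ⟨⟨h1, h2⟩, h3, h4⟩ := mem_toSet.1 hx
  rw [mem_closedBall, Prod.dist_eq, Real.dist_eq, Real.dist_eq, center]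
  exact max_le (abs_le.2 ⟨by simp only; linarith, by simp only; linarith⟩)
    (abs_le.2 ⟨by simp only; linarith, by simp only; linarith⟩)

theorem ball_subset_toSet (Q : Cube) : ball Q.center (Q.side / 2) ⊆ Q.toSet := by
  intro x hx
  rw [mem_ball, Prod.dist_eq, Real.dist_eq, Real.dist_eq, center, max_lt_iff, abs_lt, abs_lt] at hx
  obtain ⟨⟨h1, h2⟩, h3, h4⟩ := hx
  simp only at h1 h2 h3 h4
  exact mem_toSet.2 ⟨⟨by linarith, by linarith⟩, by linarith, by linarith⟩

theorem le_dist_center {Q : Cube} {x : Plane} (hx : x ∉ Q.toSet) :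
    Q.side / 2 ≤ dist x Q.center := by
  by_contra! h
  exact hx (Q.ball_subset_toSet h)

theorem closedBall_eq_prod (Q : Cube) : closedBall Q.center (Q.side / 2) =
    Set.Icc Q.corner.1 (Q.corner.1 + Q.side) ×ˢ Set.Icc Q.corner.2 (Q.corner.2 + Q.side) := by
  rw [center, ← closedBall_prod_same, Real.closedBall_eq_Icc, Real.closedBall_eq_Icc]
  congr 2 <;> ring

theorem toSet_ae_eq (Q : Cube) :
    Q.toSet =ᵐ[(volume : Measure Plane)] closedBall Q.center (Q.side / 2) := by
  rw [closedBall_eq_prod, Measure.volume_eq_prod]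
  exact Measure.set_prod_ae_eq Ico_ae_eq_Icc Ico_ae_eq_Icc

end Cube

theorem volume_closedBall (c : Plane) {r : ℝ} (hr : 0 ≤ r) :
    volume (closedBall c r) = ENNReal.ofReal ((2 * r) ^ 2) := by
  obtain ⟨a, b⟩ := c
  rw [← closedBall_prod_same, Measure.volume_eq_prod, Measure.prod_prod, Real.volume_closedBall,
    Real.volume_closedBall, ← ENNReal.ofReal_mul (by linarith), sq]

namespace Cube

theorem volume_toSet (Q : Cube) : volume Q.toSet = ENNReal.ofReal (Q.side ^ 2) := by
  rw [measure_congr Q.toSet_ae_eq, volume_closedBall _ (by linarith [Q.side_pos])]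
  congr 2; ring

theorem volume_pos (Q : Cube) : 0 < volume Q.toSet := by
  rw [volume_toSet]; exact ENNReal.ofReal_pos.2 (pow_pos Q.side_pos 2)

theorem volume_ne_zero (Q : Cube) : volume Q.toSet ≠ 0 := Q.volume_pos.ne'

theorem volume_ne_top (Q : Cube) : volume Q.toSet ≠ ∞ := by
  rw [volume_toSet]; exact ENNReal.ofReal_ne_top

theorem center_ofCenter (c : Plane) (r : ℝ) (hr : 0 < r) : (ofCenter c r hr).center = c := by
  ext <;> simp [ofCenter, center]

theorem side_ofCenter (c : Plane) (r : ℝ) (hr : 0 < r) : (ofCenter c r hr).side = 2 * r := rfl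

theorem center_triple (Q : Cube) : Q.triple.center = Q.center := by
  ext <;> simp only [triple, center] <;> ring

theorem side_triple (Q : Cube) : Q.triple.side = 3 * Q.side := rfl

theorem subset_triple (Q : Cube) : Q.toSet ⊆ Q.triple.toSet := by
  intro x hx
  obtain ⟨⟨h1, h2⟩, h3, h4⟩ := mem_toSet.1 hx
  have := Q.side_pos
  refine mem_toSet.2 ⟨⟨?_, ?_⟩, ?_, ?_⟩ <;> simp only [triple] <;> linarith

theorem volume_triple (Q : Cube) : volume Q.triple.toSet = 9 * volume Q.toSet := by
  rw [volume_toSet, volume_toSet, side_triple, mul_pow, ENNReal.ofReal_mul (by norm_num)]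
  congr 1; norm_num

theorem triple_injective : Function.Injective triple := by
  rintro ⟨⟨a, b⟩, s, hs⟩ ⟨⟨a', b'⟩, s', hs'⟩ h
  simp only [triple, mk.injEq, Prod.mk.injEq] at h
  obtain ⟨⟨h1, h2⟩, h3⟩ := h
  have h3 : s = s' := by linarith
  subst h3
  have : a = a' := by linarith
  have : b = b' := by linarith
  subst_vars; rfl

theorem dist_center_le {Q : Cube} {x : Plane} (hx : x ∈ Q.toSet) :
    dist x Q.center ≤ Q.side / 2 := Q.toSet_subset_closedBall hx

theorem le_dist_center_of_notMem_triple {Q : Cube} {x : Plane} (hx : x ∉ Q.triple.toSet) :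
    3 * Q.side / 2 ≤ dist x Q.center := by
  have := le_dist_center hx
  rwa [center_triple, side_triple] at this

theorem side_le_dist {Q : Cube} {x y : Plane} (hx : x ∈ Q.toSet) (hy : y ∉ Q.triple.toSet) :
    Q.side ≤ dist x y := by
  have h1 := dist_center_le hx
  have h2 := le_dist_center_of_notMem_triple hy
  have h3 := dist_triangle_left y Q.center x
  linarith

theorem triple_subset_triple {P Q : Cube} (h : P.toSet ⊆ Q.toSet) (hs : P.side ≤ Q.side) :
    P.triple.toSet ⊆ Q.triple.toSet := by
  intro x hx
  obtain ⟨⟨h1, h2⟩, h3, h4⟩ := mem_toSet.1 hx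
  have hP := P.side_pos
  have hc : P.corner ∈ P.toSet := mem_toSet.2 ⟨⟨le_rfl, by linarith⟩, le_rfl, by linarith⟩
  obtain ⟨⟨a1, a2⟩, a3, a4⟩ := mem_toSet.1 (h hc)
  have key : ∀ u v s t : ℝ, 0 < s →
      (∀ z, u ≤ z → z < u + s → v ≤ z ∧ z < v + t) → u + s ≤ v + t := by
    intro u v s t hs hz
    by_contra! hlt
    have := (hz (max u (v + t)) (le_max_left _ _) (max_lt (by linarith) hlt)).2
    exact absurd this (not_lt.2 (le_max_right _ _))
  have b1 : P.corner.1 + P.side ≤ Q.corner.1 + Q.side := key _ _ _ _ hP fun z hz hz' =>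
    (mem_toSet.1 (h (show ((z, P.corner.2) : Plane) ∈ P.toSet from
      mem_toSet.2 ⟨⟨hz, hz'⟩, le_rfl, by linarith⟩))).1
  have b2 : P.corner.2 + P.side ≤ Q.corner.2 + Q.side := key _ _ _ _ hP fun z hz hz' =>
    (mem_toSet.1 (h (show ((P.corner.1, z) : Plane) ∈ P.toSet from
      mem_toSet.2 ⟨⟨le_rfl, by linarith⟩, hz, hz'⟩))).2
  simp only [triple] at h1 h2 h3 h4
  refine mem_toSet.2 ⟨⟨?_, ?_⟩, ?_, ?_⟩ <;> simp only [triple] <;> linarith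

theorem side_le_of_subset {P Q : Cube} (h : P.toSet ⊆ Q.toSet) : P.side ≤ Q.side := by
  have := measure_mono (μ := (volume : Measure Plane)) h
  rw [volume_toSet, volume_toSet, ENNReal.ofReal_le_ofReal_iff (sq_nonneg _)] at this
  exact (sq_le_sq₀ P.side_pos.le Q.side_pos.le).1 this

end Cube

/-- The maximal theorem: outside a set of controlled measure all averages of `w` are at most
`lam`. -/
theorem exists_maximal_set (w : Plane → ℝ≥0∞) (hw : ∫⁻ x, w x ≠ ∞) {lam : ℝ≥0∞} (hl : lam ≠ 0)
    (hl' : lam ≠ ∞) :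
    ∃ O : Set Plane, MeasurableSet O ∧ lam * volume O ≤ 25 * ∫⁻ x, w x ∧
      ∀ x ∉ O, ∀ (c : Plane) (r : ℝ), 0 < r → x ∈ closedBall c r →
        ∫⁻ y in closedBall c r, w y ≤ lam * volume (closedBall c r) := by
  set t : Set (Plane × ℝ) := {b | 0 < b.2 ∧
    lam * volume (closedBall b.1 b.2) < ∫⁻ y in closedBall b.1 b.2, w y} with ht
  -- A square whose average exceeds `lam` has area at most `lam⁻¹ * ∫ w`; Vitali's covering theorem
  -- needs this bound on the radii.
  have hR : ∀ a ∈ t, a.2 ≤ (lam⁻¹ * ∫⁻ x, w x).toReal + 1 := by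
    rintro ⟨c, r⟩ ⟨h0, h1⟩
    by_contra! hlt
    simp only at h0 h1 hlt
    have h2 : lam * volume (closedBall c r) < ∫⁻ x, w x := h1.trans_le (setLIntegral_le_lintegral _ _)
    have h3 : volume (closedBall c r) ≤ lam⁻¹ * ∫⁻ x, w x := by
      rw [← ENNReal.div_eq_inv_mul, ENNReal.le_div_iff_mul_le (Or.inl hl) (Or.inl hl'), mul_comm]
      exact h2.le
    rw [volume_closedBall _ h0.le, ENNReal.ofReal_le_iff_le_toReal
      (ENNReal.mul_ne_top (ENNReal.inv_ne_top.2 hl) hw)] at h3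
    have : (0 : ℝ) ≤ (lam⁻¹ * ∫⁻ x, w x).toReal := ENNReal.toReal_nonneg
    nlinarith
  -- Enlarging radii by 5 multiplies areas by 25, the constant of the statement.
  obtain ⟨u, hut, hd, hcov⟩ := Vitali.exists_disjoint_subfamily_covering_enlargement_closedBall t
    (fun b => b.1) (fun b => b.2) _ hR 5 (by norm_num)
  have hcount : u.Countable := hd.countable_of_nonempty_interior fun b hb =>
    ⟨b.1, ball_subset_interior_closedBall (mem_ball_self (hut hb).1)⟩
  set O₀ : Set Plane := ⋃ b ∈ t, closedBall b.1 b.2 with hO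
  refine ⟨toMeasurable volume O₀, measurableSet_toMeasurable _ _, ?_, ?_⟩
  · rw [measure_toMeasurable]
    have h1 : O₀ ⊆ ⋃ b ∈ u, closedBall b.1 (5 * b.2) := by
      intro x hx
      obtain ⟨a, ha, hxa⟩ := Set.mem_iUnion₂.1 hx
      obtain ⟨b, hb, hab⟩ := hcov a ha
      exact Set.mem_iUnion₂.2 ⟨b, hb, hab hxa⟩
    have := hcount.to_subtype
    calc lam * volume O₀ ≤ lam * ∑' b : u, volume (closedBall b.1.1 (5 * b.1.2)) := by
          gcongr
          exact (measure_mono h1).trans (measure_biUnion_le _ hcount _)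
      _ = ∑' b : u, 25 * (lam * volume (closedBall b.1.1 b.1.2)) := by
          rw [← ENNReal.tsum_mul_left]
          congr 1; ext b
          have h0 := (hut b.2).1
          rw [volume_closedBall _ h0.le, volume_closedBall _ (by linarith),
            show (2 * (5 * b.1.2)) ^ 2 = 25 * (2 * b.1.2) ^ 2 by ring,
            ENNReal.ofReal_mul (by norm_num), ENNReal.ofReal_ofNat]
          ring
      _ ≤ ∑' b : u, 25 * ∫⁻ y in closedBall b.1.1 b.1.2, w y := by
          gcongr with b
          exact (hut b.2).2.le
      _ = 25 * ∫⁻ y in ⋃ b ∈ u, closedBall b.1 b.2, w y := by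
          rw [ENNReal.tsum_mul_left, lintegral_biUnion hcount (fun _ _ => measurableSet_closedBall) hd]
      _ ≤ 25 * ∫⁻ x, w x := by
          gcongr
          exact Measure.restrict_le_self
  · intro x hx c r hr hxc
    by_contra! hlt
    exact hx (subset_toMeasurable _ _ (Set.mem_iUnion₂.2 ⟨(c, r), ⟨hr, hlt⟩, hxc⟩))

end

/-! ### Dyadic grids and Calderón–Zygmund stopping cubes. -/

section

/-- The coarse index is the integer quotient of the fine one by a power of 2, so grid cubes are
nested. -/
theorem floor_mul_two_pow_eq {s t : ℝ} {m n : ℕ} (hmn : m ≤ n)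
    (h : ⌊s * 2 ^ n⌋ = ⌊t * 2 ^ n⌋) : ⌊s * 2 ^ m⌋ = ⌊t * 2 ^ m⌋ := by
  have key : ∀ r : ℝ, ⌊r * 2 ^ m⌋ = ⌊r * 2 ^ n⌋ / ((2 ^ (n - m) : ℕ) : ℤ) := by
    intro r
    rw [← Int.floor_div_natCast]
    congr 1
    obtain ⟨k, rfl⟩ := Nat.exists_eq_add_of_le hmn
    rw [Nat.add_sub_cancel_left, pow_add]
    push_cast
    field_simp
  rw [key, key, h]

/-- The cube of side `L / 2 ^ n` containing `x` in the dyadic grid with origin `o` and unit `L`. -/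
noncomputable def gridCube (o : Plane) (L : ℝ) (hL : 0 < L) (n : ℕ) (x : Plane) : Cube where
  corner := (o.1 + L / 2 ^ n * ⌊(x.1 - o.1) / L * 2 ^ n⌋, o.2 + L / 2 ^ n * ⌊(x.2 - o.2) / L * 2 ^ n⌋)
  side := L / 2 ^ n
  side_pos := by positivity

section Grid

variable {o : Plane} {L : ℝ} {hL : 0 < L}

theorem mem_interval_iff_floor (o L : ℝ) (hL : 0 < L) (n : ℕ) (k : ℤ) (y : ℝ) :
    (o + L / 2 ^ n * k ≤ y ∧ y < o + L / 2 ^ n * k + L / 2 ^ n) ↔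
      ⌊(y - o) / L * 2 ^ n⌋ = k := by
  have hp : (0 : ℝ) < 2 ^ n := by positivity
  rw [Int.floor_eq_iff]
  have e : (y - o) / L * 2 ^ n = (y - o) / (L / 2 ^ n) := by field_simp
  have hs : 0 < L / 2 ^ n := by positivity
  rw [e, le_div_iff₀ hs, div_lt_iff₀ hs]
  constructor
  · rintro ⟨h1, h2⟩; constructor <;> nlinarith
  · rintro ⟨h1, h2⟩; constructor <;> nlinarith

theorem mem_gridCube {n : ℕ} {x y : Plane} : y ∈ (gridCube o L hL n x).toSet ↔
    ⌊(y.1 - o.1) / L * 2 ^ n⌋ = ⌊(x.1 - o.1) / L * 2 ^ n⌋ ∧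
      ⌊(y.2 - o.2) / L * 2 ^ n⌋ = ⌊(x.2 - o.2) / L * 2 ^ n⌋ := by
  rw [Cube.mem_toSet]
  exact and_congr (mem_interval_iff_floor _ _ hL n _ _) (mem_interval_iff_floor _ _ hL n _ _)

theorem mem_gridCube_self (n : ℕ) (x : Plane) : x ∈ (gridCube o L hL n x).toSet :=
  mem_gridCube.2 ⟨rfl, rfl⟩

theorem gridCube_eq {n : ℕ} {x y : Plane} (h : y ∈ (gridCube o L hL n x).toSet) :
    gridCube o L hL n y = gridCube o L hL n x := by
  obtain ⟨h1, h2⟩ := mem_gridCube.1 h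
  simp only [gridCube, h1, h2]

theorem gridCube_mono {m n : ℕ} (hmn : m ≤ n) {x : Plane} :
    (gridCube o L hL n x).toSet ⊆ (gridCube o L hL m x).toSet := by
  intro y hy
  obtain ⟨h1, h2⟩ := mem_gridCube.1 hy
  exact mem_gridCube.2 ⟨floor_mul_two_pow_eq hmn h1, floor_mul_two_pow_eq hmn h2⟩

theorem gridCube_zero (Q : Cube) {x : Plane} (hx : x ∈ Q.toSet) :
    gridCube Q.corner Q.side Q.side_pos 0 x = Q := by
  obtain ⟨h1, h2⟩ := Cube.mem_toSet.1 hx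
  have e1 := (mem_interval_iff_floor Q.corner.1 Q.side Q.side_pos 0 0 x.1).1 (by simpa using h1)
  have e2 := (mem_interval_iff_floor Q.corner.2 Q.side Q.side_pos 0 0 x.2).1 (by simpa using h2)
  simp only [gridCube, e1, e2]
  obtain ⟨⟨a, b⟩, s, hs⟩ := Q
  simp

end Grid

/-- The Calderón–Zygmund stopping cubes of `w` at height `lam` in a dyadic grid. -/
theorem exists_stopping_cubes (o : Plane) (L : ℝ) (hL : 0 < L) (w : Plane → ℝ≥0∞)
    (hwm : AEMeasurable w volume) (hw : ∫⁻ x, w x ≠ ∞) {lam : ℝ≥0∞}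
    (hwL : ∫⁻ x, w x ≤ lam * ENNReal.ofReal (L ^ 2)) :
    ∃ 𝒟 : Set Cube, 𝒟.Countable ∧ 𝒟.PairwiseDisjoint Cube.toSet ∧
      (∀ P ∈ 𝒟, lam * volume P.toSet ≤ ∫⁻ x in P.toSet, w x) ∧
      (∀ P ∈ 𝒟, ∫⁻ x in P.toSet, w x ≤ 4 * lam * volume P.toSet) ∧
      (∀ᵐ x, x ∉ ⋃ P ∈ 𝒟, P.toSet → w x ≤ lam) ∧
      (∀ P ∈ 𝒟, ∃ x, P.toSet ⊆ (gridCube o L hL 0 x).toSet) := by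
  classical
  set bad : Cube → Prop := fun Q => lam * volume Q.toSet < ∫⁻ x in Q.toSet, w x with hbad
  set D := gridCube o L hL with hD
  -- The total mass is at most `lam` times the area of a top cube. So each selected cube has an
  -- unselected parent, whose area is four times larger; hence the factor 4 in the upper bound.
  have h0 : ∀ x, ¬ bad (D 0 x) := by
    intro x
    simp only [hbad, not_lt]
    refine (setLIntegral_le_lintegral _ _).trans (hwL.trans_eq ?_)
    rw [Cube.volume_toSet]
    simp [hD, gridCube]
  set 𝒟 : Set Cube := {P | ∃ n x, P = D n x ∧ bad (D n x) ∧ ∀ m < n, ¬ bad (D m x)} with h𝒟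
  have hdisj : 𝒟.PairwiseDisjoint Cube.toSet := by
    -- If two selected cubes meet, the coarser contains the finer, which would then have a bad
    -- ancestor unless the two coincide.
    have key : ∀ n x m y, n ≤ m → bad (D n x) → (∀ k < m, ¬ bad (D k y)) →
        ∀ z ∈ (D n x).toSet, z ∈ (D m y).toSet → D n x = D m y := by
      intro n x m y hnm hb hm z hz hz'
      have e1 : D n z = D n x := gridCube_eq hz
      have e2 : D n z = D n y := gridCube_eq (gridCube_mono hnm hz')
      rcases hnm.eq_or_lt with rfl | hlt
      · rw [← e1, e2]
      · exact absurd (by rwa [← e2, e1]) (hm n hlt)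
    rintro P ⟨n, x, rfl, hb, hn⟩ P' ⟨m, y, rfl, hb', hm⟩ hne
    refine Set.disjoint_left.2 fun z hz hz' => hne ?_
    rcases le_total n m with h | h
    · exact key n x m y h hb hm z hz hz'
    · exact (key m y n x h hb' hn z hz' hz).symm
  refine ⟨𝒟, hdisj.countable_of_nonempty_interior fun P _ => ⟨P.center, ?_⟩, hdisj, ?_, ?_, ?_, ?_⟩
  · exact interior_maximal P.ball_subset_toSet isOpen_ball
      (mem_ball_self (by linarith [P.side_pos]))
  · rintro P ⟨n, x, rfl, hb, hn⟩
    exact hb.le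
  · rintro P ⟨n, x, rfl, hb, hn⟩
    obtain _ | n := n
    · exact absurd hb (h0 x)
    · have h1 := not_lt.1 (hn n (Nat.lt_succ_self n))
      refine (lintegral_mono_set (gridCube_mono (Nat.le_succ n))).trans (h1.trans_eq ?_)
      rw [Cube.volume_toSet, Cube.volume_toSet]
      have : (D n x).side ^ 2 = 4 * (D (n + 1) x).side ^ 2 := by
        simp only [hD, gridCube, pow_succ]; field_simp; norm_num
      rw [this, ENNReal.ofReal_mul (by norm_num), ENNReal.ofReal_ofNat]
      ring
  · have hd := VitaliFamily.ae_tendsto_lintegral_div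
      (IsUnifLocDoublingMeasure.vitaliFamily (volume : Measure Plane) 1) hwm hw
    filter_upwards [hd] with x hx hxn
    have hnb : ∀ n, ¬ bad (D n x) := by
      by_contra! hex
      refine hxn (Set.mem_iUnion₂.2 ⟨D (Nat.find hex) x,
        ⟨_, x, rfl, Nat.find_spec hex, fun m hm => Nat.find_min hex hm⟩, mem_gridCube_self _ _⟩)
    -- The grid cubes around `x` are not centred at `x`; the Vitali family with parameter 1 admits
    -- balls whose centre is within one radius of `x`.
    have ht := IsUnifLocDoublingMeasure.tendsto_closedBall_filterAt (volume : Measure Plane)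
      (K := 1) (x := x) (l := atTop) (fun n => (D n x).center) (fun n => (D n x).side / 2) (by
        refine tendsto_nhdsWithin_iff.2 ⟨?_, Eventually.of_forall fun n =>
          half_pos (D n x).side_pos⟩
        have : Tendsto (fun n : ℕ => L / 2 * (1 / 2) ^ n) atTop (𝓝 (L / 2 * 0)) :=
          (tendsto_pow_atTop_nhds_zero_of_lt_one (by norm_num) (by norm_num)).const_mul _
        rw [mul_zero] at this
        refine this.congr fun n => ?_
        simp only [hD, gridCube, one_div, inv_pow]; ring)
      (Eventually.of_forall fun n => by
        rw [one_mul]; exact Cube.toSet_subset_closedBall _ (mem_gridCube_self n x))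
    refine le_of_tendsto (hx.comp ht) (Eventually.of_forall fun n => ?_)
    have h1 := not_lt.1 (hnb n)
    simp only [Function.comp]
    rw [← measure_congr (D n x).toSet_ae_eq, ← setLIntegral_congr (D n x).toSet_ae_eq]
    exact ENNReal.div_le_of_le_mul h1
  · rintro P ⟨n, x, rfl, hb, hn⟩
    exact ⟨x, gridCube_mono (Nat.zero_le n)⟩

end

/-! ### Regular kernels and the Hörmander condition. -/

section

/-- A measurable kernel with the size of a Calderón–Zygmund kernel, which is Hölder continuous
in each coordinate of its first variable, relative to the distance in that coordinate. -/
structure IsRegularKernel (θ A : ℝ) (K : Plane → Plane → ℂ) : Prop where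
  meas : Measurable (Function.uncurry K)
  size : ∀ x y, ‖K x y‖ ≤ A / dist x y ^ 2
  reg_fst : ∀ (x y : Plane) (w : ℝ), |x.1 - w| ≤ |x.1 - y.1| / 2 →
    ‖K x y - K (w, x.2) y‖ ≤ A * (|x.1 - w| / |x.1 - y.1|) ^ θ / dist x y ^ 2
  reg_snd : ∀ (x y : Plane) (w : ℝ), |x.2 - w| ≤ |x.2 - y.2| / 2 →
    ‖K x y - K (x.1, w) y‖ ≤ A * (|x.2 - w| / |x.2 - y.2|) ^ θ / dist x y ^ 2

/-- Each half-line contributes ρ^(1-d)/(1-d), and `d ≤ 1/2` keeps 1/(1-d) below 2. -/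
theorem lintegral_abs_rpow_neg_le {d ρ : ℝ} (hd2 : d ≤ 1 / 2) (hρ : 0 < ρ) :
    ∫⁻ s in Set.Icc (-ρ) ρ, ENNReal.ofReal (|s| ^ (-d)) ≤ ENNReal.ofReal (4 * ρ ^ (1 - d)) := by
  have h1 : ∫⁻ s in Set.Ioc 0 ρ, ENNReal.ofReal (|s| ^ (-d)) ≤ ENNReal.ofReal (2 * ρ ^ (1 - d)) := by
    have hint : IntervalIntegrable (fun s : ℝ => s ^ (-d)) volume 0 ρ :=
      intervalIntegral.intervalIntegrable_rpow' (by linarith)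
    have he : ∫⁻ s in Set.Ioc 0 ρ, ENNReal.ofReal (|s| ^ (-d)) =
        ∫⁻ s in Set.Ioc 0 ρ, ENNReal.ofReal (s ^ (-d)) :=
      setLIntegral_congr_fun measurableSet_Ioc fun s hs => by rw [abs_of_pos hs.1]
    rw [he, ← ofReal_integral_eq_lintegral_ofReal
      ((intervalIntegrable_iff_integrableOn_Ioc_of_le hρ.le).1 hint)
      ((ae_restrict_iff' measurableSet_Ioc).2 (Eventually.of_forall fun s hs =>
        Real.rpow_nonneg hs.1.le _)), ← intervalIntegral.integral_of_le hρ.le,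
      integral_rpow (Or.inl (by linarith)), Real.zero_rpow (by linarith), sub_zero]
    refine ENNReal.ofReal_le_ofReal ?_
    rw [show -d + 1 = 1 - d by ring, div_le_iff₀ (by linarith)]
    have := Real.rpow_nonneg hρ.le (1 - d)
    nlinarith
  have h2 : ∫⁻ s in Set.Ico (-ρ) 0, ENNReal.ofReal (|s| ^ (-d)) =
      ∫⁻ s in Set.Ioc 0 ρ, ENNReal.ofReal (|s| ^ (-d)) := by
    have := (Measure.measurePreserving_neg (volume : Measure ℝ)).setLIntegral_comp_preimage_emb
      (MeasurableEquiv.neg ℝ).measurableEmbedding (fun s => ENNReal.ofReal (|s| ^ (-d)))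
      (Set.Ioc 0 ρ)
    simpa using this
  have hsub : Set.Icc (-ρ) ρ ⊆ (Set.Ico (-ρ) 0 ∪ Set.Ioc 0 ρ) ∪ {0} := by
    intro s hs
    rcases lt_trichotomy s 0 with h | h | h
    · exact Or.inl (Or.inl ⟨hs.1, h⟩)
    · exact Or.inr h
    · exact Or.inl (Or.inr ⟨h, hs.2⟩)
  calc _ ≤ ∫⁻ s in (Set.Ico (-ρ) 0 ∪ Set.Ioc 0 ρ) ∪ {0}, ENNReal.ofReal (|s| ^ (-d)) :=
        lintegral_mono_set hsub
    _ ≤ ((∫⁻ s in Set.Ico (-ρ) 0, ENNReal.ofReal (|s| ^ (-d))) +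
          ∫⁻ s in Set.Ioc 0 ρ, ENNReal.ofReal (|s| ^ (-d))) +
          ∫⁻ s in {0}, ENNReal.ofReal (|s| ^ (-d)) :=
        (lintegral_union_le _ _ _).trans (add_le_add (lintegral_union_le _ _ _) le_rfl)
    _ ≤ (ENNReal.ofReal (2 * ρ ^ (1 - d)) + ENNReal.ofReal (2 * ρ ^ (1 - d))) + 0 := by
        refine add_le_add (add_le_add (h2.trans_le h1) h1) ?_
        rw [setLIntegral_measure_zero _ _ (by simp)]
    _ = _ := by
        rw [add_zero, ← ENNReal.ofReal_add (by positivity) (by positivity)]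
        congr 1; ring

/-- The factor that measures how far the smoothness degenerates near a coordinate axis. -/
noncomputable def axisFactor (d ℓ s : ℝ) : ℝ≥0∞ := ENNReal.ofReal (min 1 ((2 * ℓ / |s|) ^ d))

theorem measurable_axisFactor (d ℓ : ℝ) : Measurable (axisFactor d ℓ) := by
  unfold axisFactor; fun_prop

/-- The factor is at most 1, so its q-th power is at most the factor itself. The average thus decays
like (ℓ/r)^d for every q, and the loss in q appears only when the q-th root is taken. -/
theorem lintegral_axisFactor_le {d ℓ r q t c : ℝ} (hd2 : d ≤ 1 / 2) (hℓ : 0 < ℓ)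
    (hr : 0 < r) (hq : 1 ≤ q) (ht : |t - c| ≤ r) :
    ∫⁻ s in Set.Icc (c - r) (c + r), axisFactor d ℓ (t - s) ^ q ≤
      ENNReal.ofReal (8 * r * (ℓ / r) ^ d) := by
  have h1 : ∀ s, axisFactor d ℓ s ^ q ≤ ENNReal.ofReal ((2 * ℓ) ^ d) * ENNReal.ofReal (|s| ^ (-d)) := by
    intro s
    have ha : axisFactor d ℓ s ≤ 1 := by
      unfold axisFactor; exact ENNReal.ofReal_le_one.2 (min_le_left _ _)
    calc axisFactor d ℓ s ^ q ≤ axisFactor d ℓ s ^ (1 : ℝ) :=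
          ENNReal.rpow_le_rpow_of_exponent_ge ha hq
      _ ≤ ENNReal.ofReal ((2 * ℓ / |s|) ^ d) := by
          rw [ENNReal.rpow_one]; exact ENNReal.ofReal_le_ofReal (min_le_right _ _)
      _ = _ := by
          rw [← ENNReal.ofReal_mul (by positivity), Real.div_rpow (by linarith) (abs_nonneg _),
            Real.rpow_neg (abs_nonneg _), div_eq_mul_inv]
  have h2 : ∫⁻ s in Set.Icc (c - r) (c + r), axisFactor d ℓ (t - s) ^ q ≤
      ∫⁻ s in Set.Icc (-(2 * r)) (2 * r), axisFactor d ℓ s ^ q := by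
    have := (Measure.measurePreserving_sub_left (volume : Measure ℝ) t).setLIntegral_comp_preimage_emb
      (MeasurableEquiv.subLeft t).measurableEmbedding (fun s => axisFactor d ℓ s ^ q)
      (Set.Icc (-(2 * r)) (2 * r))
    rw [← this]
    refine lintegral_mono_set fun s hs => ?_
    obtain ⟨h3, h4⟩ := abs_le.1 ht
    exact ⟨by linarith [hs.2], by linarith [hs.1]⟩
  calc _ ≤ _ := h2
    _ ≤ ∫⁻ s in Set.Icc (-(2 * r)) (2 * r),
          ENNReal.ofReal ((2 * ℓ) ^ d) * ENNReal.ofReal (|s| ^ (-d)) := lintegral_mono fun s => h1 s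
    _ ≤ ENNReal.ofReal ((2 * ℓ) ^ d) * ENNReal.ofReal (4 * (2 * r) ^ (1 - d)) := by
        rw [lintegral_const_mul' _ _ ENNReal.ofReal_ne_top]
        gcongr
        exact lintegral_abs_rpow_neg_le hd2 (by linarith)
    _ = _ := by
        rw [← ENNReal.ofReal_mul (by positivity)]
        congr 1
        rw [Real.rpow_sub (by linarith), Real.rpow_one, Real.mul_rpow two_pos.le hℓ.le,
          Real.mul_rpow two_pos.le hr.le, Real.div_rpow hℓ.le hr.le]
        have : (0 : ℝ) < 2 ^ d := by positivity
        have : (0 : ℝ) < r ^ d := by positivity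
        field_simp
        norm_num

/-- Bernoulli's inequality gives 2^{-s} ≤ 1 - s/2, so the geometric series is at most 2/s. With s =
d/q this is the linear growth in q = p'. -/
theorem tsum_rpow_neg_le {s : ℝ} (hs : 0 < s) (hs1 : s ≤ 1) :
    ∑' k : ℕ, ENNReal.ofReal (((1 / 2 : ℝ) ^ k) ^ s) ≤ ENNReal.ofReal (2 / s) := by
  have hb : (1 / 2 : ℝ) ^ s ≤ 1 - s / 2 := by
    have := _root_.rpow_one_add_le_one_add_mul_self (s := -1 / 2) (by norm_num) hs.le hs1
    norm_num at this ⊢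
    linarith
  have h0 : (0 : ℝ) ≤ (1 / 2 : ℝ) ^ s := by positivity
  have he : ∀ k : ℕ, ENNReal.ofReal (((1 / 2 : ℝ) ^ k) ^ s) = ENNReal.ofReal ((1 / 2 : ℝ) ^ s) ^ k := by
    intro k
    rw [← ENNReal.ofReal_pow h0, ← Real.rpow_natCast, ← Real.rpow_natCast, ← Real.rpow_mul (by norm_num),
      ← Real.rpow_mul (by norm_num), mul_comm]
  simp_rw [he]
  rw [ENNReal.tsum_geometric, ← ENNReal.ofReal_one, ← ENNReal.ofReal_sub _ h0,
    ← ENNReal.ofReal_inv_of_pos (by linarith)]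
  refine ENNReal.ofReal_le_ofReal ?_
  rw [inv_le_comm₀ (by linarith) (by positivity), inv_div]
  linarith

/-- Sum over dyadic shells around a cube of a quantity with quadratic decay. -/
theorem lintegral_compl_triple_le (P : Cube) {d p a : ℝ} (hd : 0 < d) (hd1 : d ≤ 1) (hp : 1 < p)
    {m h F : Plane → ℝ≥0∞} (hm : Measurable m) (hh : AEMeasurable h volume) {lam : ℝ≥0∞}
    (hml : ∀ k : ℕ, ∫⁻ y in closedBall P.center (3 * P.side * 2 ^ k), m y ^ (p / (p - 1)) ≤
      ENNReal.ofReal (4 * ((1 / 2 : ℝ) ^ k) ^ d) * volume (closedBall P.center (3 * P.side * 2 ^ k)))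
    (hhl : ∀ r, P.side ≤ r → ∫⁻ y in closedBall P.center r, h y ^ p ≤
      lam * volume (closedBall P.center r))
    (hF : ∀ᵐ y, y ∉ P.triple.toSet → F y ≤ ENNReal.ofReal (a / dist y P.center ^ 2) * m y) :
    ∫⁻ y in P.triple.toSetᶜ, F y * h y ≤
      ENNReal.ofReal (128 * a / d * (p / (p - 1))) * lam ^ (1 / p) := by
  have hq : p.HolderConjugate (p / (p - 1)) := Real.HolderConjugate.conjExponent hp
  set q := p / (p - 1) with hqdef
  have hℓ := P.side_pos
  have hq0 : 0 < q := hq.symm.pos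
  have hq1 : 1 < q := hq.symm.lt
  set r : ℕ → ℝ := fun k => 3 * P.side * 2 ^ k with hr
  have hr0 : ∀ k, 0 < r k := fun k => by simp only [hr]; positivity
  set B : ℕ → Set Plane := fun k => closedBall P.center (r k) with hB
  have hv : ∀ k, volume (B k) = ENNReal.ofReal ((2 * r k) ^ 2) := fun k =>
    volume_closedBall _ (hr0 k).le
  -- Outside the tripled cube the distance R to the centre is at least 3ℓ/2. Some k has 2^k ≤
  -- R/(3ℓ/2) < 2^(k+1), so y lies in the ball of radius `r k` and R ≥ `r k`/2, which turns a/R²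
  -- into at most 4a/`r k`².
  have hpt : ∀ᵐ y, y ∈ P.triple.toSetᶜ → F y * h y ≤
      ∑' k, (B k).indicator (fun y => ENNReal.ofReal (4 * a / r k ^ 2) * (m y * h y)) y := by
    filter_upwards [hF] with y hy hyP
    have hR := Cube.le_dist_center_of_notMem_triple hyP
    set R := dist y P.center with hRdef
    have hR0 : 0 < R := by linarith
    obtain ⟨k, hk1, hk2⟩ := exists_nat_pow_near (x := R / (3 * P.side / 2)) (y := 2)
      (by rw [one_le_div₀ (by linarith)]; exact hR) (by norm_num)
    rw [le_div_iff₀ (by linarith)] at hk1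
    rw [div_lt_iff₀ (by linarith), pow_succ] at hk2
    have hyB : y ∈ B k := by
      simp only [hB, hr, mem_closedBall]; rw [← hRdef]; nlinarith
    refine le_trans ?_ (ENNReal.le_tsum k)
    rw [Set.indicator_of_mem hyB, ← mul_assoc]
    refine mul_le_mul_left ((hy hyP).trans ?_) _
    refine mul_le_mul_left ?_ _
    by_cases ha : 0 ≤ a
    · refine ENNReal.ofReal_le_ofReal ?_
      have : r k / 2 ≤ R := by simp only [hr]; nlinarith
      rw [div_le_div_iff₀ (by positivity) (pow_pos (hr0 k) 2)]
      have h3 : r k ^ 2 ≤ 4 * R ^ 2 := by nlinarith [hr0 k]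
      nlinarith
    · rw [ENNReal.ofReal_of_nonpos (div_nonpos_of_nonpos_of_nonneg (by linarith) (sq_nonneg _))]
      exact zero_le
  -- Hölder on one ball, with exponent q on the gain factor and p on `h`. The exponents of the
  -- volume add up to 1, and the decay becomes 2^{-kd/q}.
  have hshell : ∀ k, ∫⁻ y in B k, m y * h y ≤
      ENNReal.ofReal (4 * ((1 / 2 : ℝ) ^ k) ^ (d / q)) * volume (B k) * lam ^ (1 / p) := by
    intro k
    have h1 := ENNReal.lintegral_mul_le_Lp_mul_Lq (volume.restrict (B k)) hq.symm
      hm.aemeasurable hh.restrict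
    simp only [Pi.mul_apply] at h1
    refine h1.trans ?_
    have hk : P.side ≤ r k := by
      simp only [hr]
      have : (1 : ℝ) ≤ 2 ^ k := one_le_pow₀ (by norm_num)
      nlinarith
    calc _ ≤ (ENNReal.ofReal (4 * ((1 / 2 : ℝ) ^ k) ^ d) * volume (B k)) ^ (1 / q) *
          (lam * volume (B k)) ^ (1 / p) := by
          refine mul_le_mul' (ENNReal.rpow_le_rpow (hml k) (by positivity))
            (ENNReal.rpow_le_rpow (hhl _ hk) (by have := hq.pos; positivity))
      _ = ENNReal.ofReal (4 * ((1 / 2 : ℝ) ^ k) ^ d) ^ (1 / q) * lam ^ (1 / p) *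
          (volume (B k) ^ (1 / q) * volume (B k) ^ (1 / p)) := by
          rw [ENNReal.mul_rpow_of_nonneg _ _ (by positivity),
            ENNReal.mul_rpow_of_nonneg _ _ (by have := hq.pos; positivity)]
          ring
      _ = ENNReal.ofReal (4 * ((1 / 2 : ℝ) ^ k) ^ d) ^ (1 / q) * lam ^ (1 / p) * volume (B k) := by
          rw [← ENNReal.rpow_add_of_nonneg _ _ (by positivity) (by have := hq.pos; positivity)]
          have : 1 / q + 1 / p = 1 := by simpa [one_div] using hq.symm.inv_add_inv_eq_one
          rw [this, ENNReal.rpow_one]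
      _ ≤ ENNReal.ofReal (4 * ((1 / 2 : ℝ) ^ k) ^ (d / q)) * lam ^ (1 / p) * volume (B k) := by
          gcongr
          rw [ENNReal.ofReal_rpow_of_nonneg (by positivity) (by positivity)]
          refine ENNReal.ofReal_le_ofReal ?_
          rw [Real.mul_rpow (by norm_num) (by positivity), ← Real.rpow_mul (by positivity),
            mul_one_div]
          gcongr
          refine (Real.rpow_le_rpow_of_exponent_le (by norm_num) ?_).trans_eq (Real.rpow_one 4)
          rw [div_le_one hq0]; exact hq1.le
      _ = _ := by ring
  calc _ ≤ ∫⁻ y in P.triple.toSetᶜ,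
        ∑' k, (B k).indicator (fun y => ENNReal.ofReal (4 * a / r k ^ 2) * (m y * h y)) y :=
        setLIntegral_mono_ae' P.triple.measurableSet_toSet.compl hpt
    _ ≤ ∫⁻ y, ∑' k, (B k).indicator (fun y => ENNReal.ofReal (4 * a / r k ^ 2) * (m y * h y)) y :=
        setLIntegral_le_lintegral _ _
    _ = ∑' k, ∫⁻ y, (B k).indicator (fun y => ENNReal.ofReal (4 * a / r k ^ 2) * (m y * h y)) y :=
        lintegral_tsum fun k => ((hm.aemeasurable.mul hh).const_mul _).indicator
          measurableSet_closedBall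
    _ ≤ ∑' k, ENNReal.ofReal (64 * a) * ENNReal.ofReal (((1 / 2 : ℝ) ^ k) ^ (d / q)) *
          lam ^ (1 / p) := by
        refine ENNReal.tsum_le_tsum fun k => ?_
        rw [lintegral_indicator measurableSet_closedBall,
          lintegral_const_mul' _ _ ENNReal.ofReal_ne_top]
        refine (mul_le_mul_right (hshell k) _).trans_eq ?_
        rw [hv, ← mul_assoc, ← mul_assoc]
        congr 1
        by_cases ha : 0 ≤ a
        · rw [← ENNReal.ofReal_mul (by have := hr0 k; positivity),
            ← ENNReal.ofReal_mul (by have := hr0 k; positivity),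
            ← ENNReal.ofReal_mul (by have := hr0 k; positivity)]
          congr 1
          have := hr0 k
          field_simp
          ring
        · rw [ENNReal.ofReal_of_nonpos (div_nonpos_of_nonpos_of_nonneg (by linarith) (sq_nonneg _)),
            ENNReal.ofReal_of_nonpos (show 64 * a ≤ 0 by linarith)]
          simp
    _ = ENNReal.ofReal (64 * a) * (∑' k : ℕ, ENNReal.ofReal (((1 / 2 : ℝ) ^ k) ^ (d / q))) *
          lam ^ (1 / p) := by
        rw [ENNReal.tsum_mul_right, ENNReal.tsum_mul_left]
    _ ≤ ENNReal.ofReal (64 * a) * ENNReal.ofReal (2 / (d / q)) * lam ^ (1 / p) := by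
        gcongr
        refine tsum_rpow_neg_le (by positivity) ?_
        rw [div_le_one hq0]; linarith
    _ = _ := by
        rw [← ENNReal.ofReal_mul' (by positivity)]
        congr 2
        field_simp
        ring

/-- Balls of the maximum norm are products of intervals and the gain factor depends on one
coordinate only; Fubini reduces the estimate to the line. -/
theorem axisFactor_ball_fst_le (P : Cube) {d q : ℝ} (hd : 0 ≤ d) (hd2 : d ≤ 1 / 2) (hq : 1 ≤ q)
    {x : Plane} (hx : x ∈ P.toSet) (k : ℕ) :
    ∫⁻ y in closedBall P.center (3 * P.side * 2 ^ k), axisFactor d P.side (x.1 - y.1) ^ q ≤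
      ENNReal.ofReal (4 * ((1 / 2 : ℝ) ^ k) ^ d) *
        volume (closedBall P.center (3 * P.side * 2 ^ k)) ∧
    ∫⁻ y in closedBall P.center (3 * P.side * 2 ^ k), axisFactor d P.side (x.2 - y.2) ^ q ≤
      ENNReal.ofReal (4 * ((1 / 2 : ℝ) ^ k) ^ d) *
        volume (closedBall P.center (3 * P.side * 2 ^ k)) := by
  have hℓ := P.side_pos
  have h1k : (1 : ℝ) ≤ 2 ^ k := one_le_pow₀ (by norm_num)
  set r := 3 * P.side * 2 ^ k with hr
  have hr0 : 0 < r := by positivity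
  have hxc := Cube.dist_center_le hx
  rw [Prod.dist_eq, Real.dist_eq, Real.dist_eq] at hxc
  have hle : P.side / 2 ≤ r := by nlinarith
  have hx1 := ((le_max_left _ _).trans hxc).trans hle
  have hx2 := ((le_max_right _ _).trans hxc).trans hle
  have hfin : ENNReal.ofReal (2 * r) * ENNReal.ofReal (8 * r * (P.side / r) ^ d) ≤
      ENNReal.ofReal (4 * ((1 / 2 : ℝ) ^ k) ^ d) * volume (closedBall P.center r) := by
    rw [volume_closedBall _ hr0.le, ← ENNReal.ofReal_mul (by positivity),
      ← ENNReal.ofReal_mul (by positivity)]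
    refine ENNReal.ofReal_le_ofReal ?_
    have : (P.side / r) ^ d ≤ ((1 / 2 : ℝ) ^ k) ^ d := by
      refine Real.rpow_le_rpow (by positivity) ?_ hd
      rw [div_le_iff₀ hr0, hr, one_div, inv_pow]
      field_simp
      norm_num
    calc 2 * r * (8 * r * (P.side / r) ^ d) = 16 * r ^ 2 * (P.side / r) ^ d := by ring
      _ ≤ 16 * r ^ 2 * ((1 / 2 : ℝ) ^ k) ^ d := by gcongr
      _ = _ := by ring
  have hprod : (volume : Measure Plane).restrict (closedBall P.center r) =
      (volume.restrict (Set.Icc (P.center.1 - r) (P.center.1 + r))).prod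
        (volume.restrict (Set.Icc (P.center.2 - r) (P.center.2 + r))) := by
    rw [Measure.prod_restrict, ← Measure.volume_eq_prod, ← Real.closedBall_eq_Icc,
      ← Real.closedBall_eq_Icc, closedBall_prod_same]
  rw [hprod]
  constructor
  · refine le_trans ?_ hfin
    rw [lintegral_prod _ (by have := measurable_axisFactor d P.side; fun_prop)]
    simp only [lintegral_const, Measure.restrict_apply_univ, Real.volume_Icc]
    rw [lintegral_mul_const' _ _ ENNReal.ofReal_ne_top, mul_comm]
    refine mul_le_mul' (ENNReal.ofReal_le_ofReal (by linarith)) ?_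
    exact lintegral_axisFactor_le hd2 hℓ hr0 hq hx1
  · refine le_trans ?_ hfin
    rw [lintegral_prod _ (by have := measurable_axisFactor d P.side; fun_prop)]
    simp only [lintegral_const, Measure.restrict_apply_univ, Real.volume_Icc]
    rw [mul_comm]
    refine mul_le_mul' (ENNReal.ofReal_le_ofReal (by linarith)) ?_
    exact lintegral_axisFactor_le hd2 hℓ hr0 hq hx2

theorem two_thirds_dist_center_le {P : Cube} {x y : Plane} (hx : x ∈ P.toSet)
    (hy : y ∉ P.triple.toSet) : 2 / 3 * dist y P.center ≤ dist x y := by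
  have h1 := Cube.dist_center_le hx
  have h2 := Cube.le_dist_center_of_notMem_triple hy
  have h3 := dist_triangle_left y P.center x
  linarith

theorem div_dist_sq_le_center {A : ℝ} (hA : 0 ≤ A) {P : Cube} {x y : Plane} (hx : x ∈ P.toSet)
    (hy : y ∉ P.triple.toSet) : A / dist x y ^ 2 ≤ 9 / 4 * A / dist y P.center ^ 2 := by
  have h1 := two_thirds_dist_center_le hx hy
  have h2 := Cube.le_dist_center_of_notMem_triple hy
  have hℓ := P.side_pos
  have h4 : 0 < dist y P.center := by linarith
  rw [div_le_div_iff₀ (pow_pos (by linarith) 2) (by positivity)]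
  have : dist y P.center ^ 2 ≤ 9 / 4 * dist x y ^ 2 := by nlinarith
  nlinarith

/-- Halving the exponent gives away decay, but θ/2 ≤ 1/2 makes the singularity on the axis
integrable with a uniform constant. -/
theorem axis_bound {θ h t ℓ : ℝ} (hθ : 0 < θ) (hh : 0 ≤ h) (hhl : h ≤ ℓ) (ht : h ≤ t / 2)
    (ht0 : 0 < t) : (h / t) ^ θ ≤ min 1 ((2 * ℓ / t) ^ (θ / 2)) := by
  have h1 : h / t ≤ 1 := by rw [div_le_one ht0]; linarith
  have h0 : 0 ≤ h / t := by positivity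
  refine le_min (Real.rpow_le_one h0 h1 hθ.le) ?_
  calc (h / t) ^ θ ≤ (h / t) ^ (θ / 2) := by
        rcases h0.eq_or_lt with h0' | h0'
        · rw [← h0', Real.zero_rpow hθ.ne', Real.zero_rpow (by linarith)]
        · exact Real.rpow_le_rpow_of_exponent_ge h0' h1 (by linarith)
    _ ≤ _ := by
        refine Real.rpow_le_rpow h0 ?_ (by linarith)
        gcongr; linarith

/-- If h ≤ t/2, the regularity applies. Otherwise 2ℓ/t ≥ 1, the minimum is 1, and the size bounds of
the two terms give 2 · 9/4 ≤ 5. -/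
theorem IsRegularKernel.axis_difference_le {θ A : ℝ} {K : Plane → Plane → ℂ}
    (hK : IsRegularKernel θ A K) (hA : 0 ≤ A) (hθ : 0 < θ) {P : Cube} {x x' y : Plane}
    (hx : x ∈ P.toSet) (hx' : x' ∈ P.toSet) (hy : y ∉ P.triple.toSet) {h t : ℝ}
    (hh0 : 0 ≤ h) (hh : h ≤ P.side) (ht : 0 < t)
    (hr : h ≤ t / 2 → ‖K x y - K x' y‖ ≤ A * (h / t) ^ θ / dist x y ^ 2) :
    ‖K x y - K x' y‖ ≤
      5 * A / dist y P.center ^ 2 * min 1 ((2 * P.side / t) ^ (θ / 2)) := by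
  have s1 := div_dist_sq_le_center hA hx hy
  have s2 := div_dist_sq_le_center hA hx' hy
  have hR : 0 < dist y P.center := by
    linarith [Cube.le_dist_center_of_notMem_triple hy, P.side_pos]
  have hmono : 9 / 4 * A / dist y P.center ^ 2 ≤ 5 * A / dist y P.center ^ 2 := by
    gcongr; norm_num
  by_cases hc : h ≤ t / 2
  · refine (hr hc).trans ?_
    have := axis_bound hθ hh0 hh hc ht
    calc A * (h / t) ^ θ / dist x y ^ 2 = A / dist x y ^ 2 * (h / t) ^ θ := by ring
      _ ≤ _ := mul_le_mul (s1.trans hmono) this (by positivity) (by positivity)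
  · have hm : min 1 ((2 * P.side / t) ^ (θ / 2)) = 1 := by
      refine min_eq_left (Real.one_le_rpow ?_ (by linarith))
      rw [one_le_div₀ ht]; linarith
    rw [hm, mul_one]
    calc ‖K x y - K x' y‖ ≤ ‖K x y‖ + ‖K x' y‖ := norm_sub_le _ _
      _ ≤ 9 / 4 * A / dist y P.center ^ 2 + 9 / 4 * A / dist y P.center ^ 2 :=
        add_le_add ((hK.size _ _).trans s1) ((hK.size _ _).trans s2)
      _ = (9 / 2) * A / dist y P.center ^ 2 := by ring
      _ ≤ _ := by gcongr; norm_num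

theorem ae_fst_ne (t : ℝ) : ∀ᵐ y : Plane, t - y.1 ≠ 0 := by
  have h : ∀ᵐ s : ℝ, t - s ≠ 0 := by
    filter_upwards [Measure.ae_ne volume t] with s hs
    exact sub_ne_zero.2 hs.symm
  exact Measure.quasiMeasurePreserving_fst.ae h

theorem ae_snd_ne (t : ℝ) : ∀ᵐ y : Plane, t - y.2 ≠ 0 := by
  have h : ∀ᵐ s : ℝ, t - s ≠ 0 := by
    filter_upwards [Measure.ae_ne volume t] with s hs
    exact sub_ne_zero.2 hs.symm
  exact Measure.quasiMeasurePreserving_snd.ae h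

/-- A Hörmander condition in `L^{p'}`, with a constant that grows linearly in `p'`. -/
theorem IsRegularKernel.hormander {θ A : ℝ} {K : Plane → Plane → ℂ}
    (hK : IsRegularKernel θ A K) (hA : 0 ≤ A) (hθ : 0 < θ) (hθ1 : θ ≤ 1) {P : Cube} {x x' : Plane}
    (hx : x ∈ P.toSet) (hx' : x' ∈ P.toSet) {p : ℝ} (hp : 1 < p) {h : Plane → ℝ≥0∞}
    (hh : AEMeasurable h volume) {lam : ℝ≥0∞}
    (hhl : ∀ r, P.side ≤ r → ∫⁻ y in closedBall P.center r, h y ^ p ≤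
      lam * volume (closedBall P.center r)) :
    ∫⁻ y in P.triple.toSetᶜ, ‖K x y - K x' y‖ₑ * h y ≤
      ENNReal.ofReal (2560 * A / θ * (p / (p - 1))) * lam ^ (1 / p) := by
  -- Regularity is known for one coordinate at a time, so the path from `x` to `x'` passes through
  -- this corner, which stays in `P`.
  set z : Plane := (x'.1, x.2) with hz
  have hp' : 1 ≤ p / (p - 1) := by rw [one_le_div₀ (by linarith)]; linarith
  have hx1 := Cube.mem_toSet.1 hx
  have hx1' := Cube.mem_toSet.1 hx'
  have hzP : z ∈ P.toSet := Cube.mem_toSet.2 ⟨hx1'.1, hx1.2⟩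
  have main : ∀ (u v : Plane) (m : Plane → ℝ), u ∈ P.toSet → v ∈ P.toSet →
      Measurable m →
      (∀ k : ℕ, ∫⁻ y in closedBall P.center (3 * P.side * 2 ^ k),
        axisFactor (θ / 2) P.side (m y) ^ (p / (p - 1)) ≤
          ENNReal.ofReal (4 * ((1 / 2 : ℝ) ^ k) ^ (θ / 2)) *
            volume (closedBall P.center (3 * P.side * 2 ^ k))) →
      (∀ᵐ y, m y ≠ 0) →
      (∀ y, ∃ e, 0 ≤ e ∧ e ≤ P.side ∧ (e ≤ |m y| / 2 →
        ‖K u y - K v y‖ ≤ A * (e / |m y|) ^ θ / dist u y ^ 2)) →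
      ∫⁻ y in P.triple.toSetᶜ, ‖K u y - K v y‖ₑ * h y ≤
        ENNReal.ofReal (1280 * A / θ * (p / (p - 1))) * lam ^ (1 / p) := by
    intro u v m hu hv hm hml hm0 hreg
    refine (lintegral_compl_triple_le P (d := θ / 2) (a := 5 * A) (by linarith) (by linarith) hp
      ((measurable_axisFactor _ _).comp hm) hh hml hhl ?_).trans_eq ?_
    · filter_upwards [hm0] with y hy hyP
      obtain ⟨e, he0, he1, he2⟩ := hreg y
      have hb := hK.axis_difference_le hA hθ hu hv hyP he0 he1 (abs_pos.2 hy) he2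
      rw [← ofReal_norm]
      refine (ENNReal.ofReal_le_ofReal hb).trans_eq ?_
      rw [ENNReal.ofReal_mul (by positivity)]
      rfl
    · congr 2
      field_simp
      ring
  have m1 := main x z (fun y => x.1 - y.1) hx hzP (by fun_prop)
    (fun k => (axisFactor_ball_fst_le P (by linarith) (by linarith) hp' hx k).1) (ae_fst_ne _)
    (fun y => ⟨|x.1 - x'.1|, abs_nonneg _, abs_le.2 ⟨by linarith, by linarith⟩,
      fun he => hK.reg_fst x y x'.1 he⟩)
  have m2 := main z x' (fun y => x.2 - y.2) hzP hx' (by fun_prop)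
    (fun k => (axisFactor_ball_fst_le P (by linarith) (by linarith) hp' hx k).2) (ae_snd_ne _)
    (fun y => ⟨|x.2 - x'.2|, abs_nonneg _, abs_le.2 ⟨by linarith, by linarith⟩,
      fun he => hK.reg_snd z y x'.2 he⟩)
  have hKm : ∀ u v : Plane, Measurable fun y => ‖K u y - K v y‖ₑ := fun u v =>
    ((hK.meas.comp measurable_prodMk_left).sub (hK.meas.comp measurable_prodMk_left)).enorm
  calc ∫⁻ y in P.triple.toSetᶜ, ‖K x y - K x' y‖ₑ * h y
      ≤ ∫⁻ y in P.triple.toSetᶜ, (‖K x y - K z y‖ₑ * h y + ‖K z y - K x' y‖ₑ * h y) := by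
        refine lintegral_mono fun y => ?_
        rw [← add_mul]
        refine mul_le_mul_left ?_ _
        rw [show K x y - K x' y = (K x y - K z y) + (K z y - K x' y) by ring]
        exact enorm_add_le _ _
    _ = _ := lintegral_add_left' (((hKm x z).aemeasurable.mul hh).restrict) _
    _ ≤ _ := add_le_add m1 m2
    _ = _ := by
        have : 0 ≤ p / (p - 1) := by linarith
        rw [← add_mul, ← ENNReal.ofReal_add (by positivity) (by positivity)]
        congr 2
        ring

end

/-! ### The kernel representation off the support. -/

section

/-- A function whose integrals over all small squares vanish is zero. -/
theorem ae_eq_zero_of_integral_closedBall {U : Set Plane} {h : Plane → ℂ}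
    (H : ∀ x ∈ U, ∃ r > 0, IntegrableOn h (closedBall x r) ∧
      ∀ c s, 0 < s → closedBall c s ⊆ closedBall x r → ∫ y in closedBall c s, h y = 0) :
    ∀ᵐ x, x ∈ U → h x = 0 := by
  rw [ae_iff]
  refine measure_null_of_locally_null _ fun x hx => ?_
  rw [Set.mem_ofPred_eq, Classical.not_imp] at hx
  obtain ⟨r, hr, hint, hz⟩ := H x hx.1
  refine ⟨_, inter_mem_nhdsWithin _ (ball_mem_nhds x hr), ?_⟩
  have hg : Integrable ((closedBall x r).indicator h) :=
    hint.integrable_indicator measurableSet_closedBall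
  have hd := IsUnifLocDoublingMeasure.ae_tendsto_average (volume : Measure Plane)
    hg.locallyIntegrable 1
  refine measure_mono_null ?_ (ae_iff.1 hd)
  rintro y ⟨hy, hyr⟩ hlim
  rw [Set.mem_ofPred_eq, Classical.not_imp] at hy
  refine hy.2 ?_
  have hlim := hlim (l := atTop) (fun _ : ℕ => y) (fun n : ℕ => 1 / ((n : ℝ) + 1))
    (tendsto_nhdsWithin_iff.2 ⟨tendsto_one_div_add_atTop_nhds_zero_nat,
      Eventually.of_forall fun n => by simp only [Set.mem_Ioi]; positivity⟩)
    (Eventually.of_forall fun n => mem_closedBall_self (by positivity))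
  rw [Set.indicator_of_mem (ball_subset_closedBall hyr)] at hlim
  refine tendsto_nhds_unique hlim (tendsto_const_nhds.congr' ?_)
  have hpos : 0 < r - dist y x := by linarith [mem_ball.1 hyr]
  filter_upwards [tendsto_one_div_add_atTop_nhds_zero_nat.eventually (gt_mem_nhds hpos)] with n hn
  have hsub : closedBall y (1 / ((n : ℝ) + 1)) ⊆ closedBall x r :=
    closedBall_subset_closedBall' (by linarith)
  rw [setAverage_eq, setIntegral_indicator measurableSet_closedBall,
    Set.inter_eq_left.2 hsub, hz y _ (by positivity) hsub, smul_zero]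

variable {T : Lp ℂ 2 (volume : Measure Plane) →L[ℂ] Lp ℂ 2 (volume : Measure Plane)}
  {K : Plane → Plane → ℂ} {θ A : ℝ}

/-- The indicator of a cube as an element of `L²`. -/
noncomputable def Cube.ind (Q : Cube) : Lp ℂ 2 (volume : Measure Plane) :=
  indicatorConstLp 2 Q.measurableSet_toSet Q.volume_ne_top 1

/-- The pairing of the kernel condition is bilinear while the Hilbert adjoint is sesquilinear; this
is where the conjugation comes from. -/
theorem setIntegral_apply_eq (R : Cube) (f : Lp ℂ 2 (volume : Measure Plane)) :
    ∫ x in R.toSet, T f x =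
      ∫ y, f y * (starRingEnd ℂ) (T.adjoint R.ind y) := by
  rw [← L2.inner_indicatorConstLp_one R.measurableSet_toSet R.volume_ne_top, ← Cube.ind,
    ← ContinuousLinearMap.adjoint_inner_left, L2.inner_def]
  rfl

/-- This is the kernel hypothesis tested on two indicators. All later uses of the kernel go through
it. -/
theorem HasKernel.setIntegral_adjoint (hT : HasKernel T K) {Q R : Cube}
    (hd : Disjoint Q.toSet R.toSet) :
    ∫ y in Q.toSet, (starRingEnd ℂ) (T.adjoint R.ind y) =
      ∫ x in R.toSet, ∫ y in Q.toSet, K x y := by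
  have hQ : (Q.toSet.indicator fun _ => (1 : ℂ)) ∈ cubeStep := Submodule.subset_span ⟨Q, rfl⟩
  have hR : (R.toSet.indicator fun _ => (1 : ℂ)) ∈ cubeStep := Submodule.subset_span ⟨R, rfl⟩
  have h := hT _ _ hQ hR (by
    refine Set.disjoint_iff_inter_eq_empty.1 (hd.mono ?_ ?_) <;>
      exact fun x hx => Set.mem_of_indicator_ne_zero hx)
  have e : (memLp_cubeStep hQ).toLp _ = Q.ind := rfl
  have h1 : ∫ x, T Q.ind x * R.toSet.indicator (fun _ => (1 : ℂ)) x = ∫ x in R.toSet, T Q.ind x := by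
    rw [← integral_indicator R.measurableSet_toSet]
    refine integral_congr_ae (Eventually.of_forall fun x => ?_)
    by_cases hx : x ∈ R.toSet <;> simp [hx]
  rw [e, h1, setIntegral_apply_eq] at h
  have h2 : ∫ y, Q.ind y * (starRingEnd ℂ) (T.adjoint R.ind y) =
      ∫ y in Q.toSet, (starRingEnd ℂ) (T.adjoint R.ind y) := by
    rw [← integral_indicator Q.measurableSet_toSet]
    refine integral_congr_ae ?_
    filter_upwards [indicatorConstLp_coeFn (p := 2) (c := (1 : ℂ)) (hs := Q.measurableSet_toSet)
      (hμs := Q.volume_ne_top)] with y hy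
    rw [Cube.ind, hy]
    by_cases hx : y ∈ Q.toSet <;> simp [hx]
  rw [← h2, h, ← integral_indicator R.measurableSet_toSet]
  refine integral_congr_ae (Eventually.of_forall fun x => ?_)
  by_cases hx : x ∈ R.toSet
  · simp only [hx, Set.indicator_of_mem, mul_one]
    rw [← integral_indicator Q.measurableSet_toSet]
    refine integral_congr_ae (Eventually.of_forall fun y => ?_)
    by_cases hy : y ∈ Q.toSet <;> simp [hy]
  · simp [hx]

theorem IsRegularKernel.norm_le_of_le_dist (hK : IsRegularKernel θ A K) (hA : 0 ≤ A)
    {x y : Plane} {r : ℝ} (hr : 0 < r) (h : r ≤ dist x y) : ‖K x y‖ ≤ A / r ^ 2 :=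
  (hK.size x y).trans (by gcongr)

theorem exists_pos_le_dist {F : Set Plane} (hF : IsClosed F) {x₀ : Plane} (hx : x₀ ∉ F) :
    ∃ r > 0, ∀ x ∈ closedBall x₀ r, ∀ y ∈ F, r ≤ dist x y := by
  obtain ⟨e, he, hs⟩ := Metric.isOpen_iff.1 hF.isOpen_compl x₀ hx
  refine ⟨e / 2, by linarith, fun x hx y hy => ?_⟩
  have h1 : e ≤ dist y x₀ := by
    by_contra! h
    exact hs (mem_ball.2 h) hy
  have := dist_triangle_left y x₀ x
  have := mem_closedBall.1 hx
  linarith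

/-- The kernel is integrable against `f` over separated sets. -/
theorem IsRegularKernel.integrable_prod (hK : IsRegularKernel θ A K) (hA : 0 ≤ A)
    {B : Set Plane} (hB : MeasurableSet B) (hBv : volume B ≠ ∞) {f : Plane → ℂ}
    (hf : Integrable f) {r : ℝ} (hr : 0 < r) (h : ∀ x ∈ B, ∀ y, f y ≠ 0 → r ≤ dist x y) :
    Integrable (fun z : Plane × Plane => K z.1 z.2 * f z.2)
      ((volume.restrict B).prod volume) := by
  have : IsFiniteMeasure (volume.restrict B) := ⟨by
    rwa [Measure.restrict_apply_univ, lt_top_iff_ne_top]⟩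
  have h1 : Integrable (fun z : Plane × Plane => (A / r ^ 2 : ℝ) * ‖f z.2‖)
      ((volume.restrict B).prod volume) := (hf.norm.comp_snd _).const_mul _
  refine h1.mono' ?_ ?_
  · exact hK.meas.aestronglyMeasurable.mul hf.1.comp_snd
  · have : ∀ᵐ z ∂((volume.restrict B).prod (volume : Measure Plane)), z.1 ∈ B :=
      Measure.quasiMeasurePreserving_fst.ae (ae_restrict_mem hB)
    filter_upwards [this] with z hz
    rw [norm_mul]
    by_cases hfz : f z.2 = 0
    · simp [hfz]
    · exact mul_le_mul_of_nonneg_right (hK.norm_le_of_le_dist hA hr (h _ hz _ hfz)) (norm_nonneg _)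

theorem Cube.exists_eq_closedBall_ae (c : Plane) {s : ℝ} (hs : 0 < s) :
    ∃ Q : Cube, Q.toSet =ᵐ[(volume : Measure Plane)] closedBall c s ∧ Q.toSet ⊆ closedBall c s := by
  refine ⟨ofCenter c s hs, ?_, ?_⟩
  · have := toSet_ae_eq (ofCenter c s hs)
    rwa [center_ofCenter, side_ofCenter, mul_div_cancel_left₀ _ two_ne_zero] at this
  · have := toSet_subset_closedBall (ofCenter c s hs)
    rwa [center_ofCenter, side_ofCenter, mul_div_cancel_left₀ _ two_ne_zero] at this

theorem MemLp.integrableOn_closedBall {f : Plane → ℂ} (hf : MemLp f 2 volume) (c : Plane) (r : ℝ) :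
    IntegrableOn f (closedBall c r) := by
  have : IsFiniteMeasure ((volume : Measure Plane).restrict (closedBall c r)) :=
    ⟨by rw [Measure.restrict_apply_univ]; exact measure_closedBall_lt_top⟩
  exact (hf.restrict _).integrable (by norm_num)

/-- Both sides have the same integral over every small square away from `R`, by
`HasKernel.setIntegral_adjoint` and Fubini, so Lebesgue differentiation identifies them. A general
`f` is then reached by duality with indicators, without approximation by step functions. -/
theorem HasKernel.adjoint_ind_ae_eq (hT : HasKernel T K) (hK : IsRegularKernel θ A K) (hA : 0 ≤ A)
    (R : Cube) : ∀ᵐ y, y ∉ closedBall R.center (R.side / 2) →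
      (starRingEnd ℂ) (T.adjoint R.ind y) = ∫ x in R.toSet, K x y := by
  have key : ∀ᵐ y, y ∈ (closedBall R.center (R.side / 2))ᶜ →
      (starRingEnd ℂ) (T.adjoint R.ind y) - ∫ x in R.toSet, K x y = 0 := by
    refine ae_eq_zero_of_integral_closedBall fun y₀ hy₀ => ?_
    obtain ⟨r, hr, hsep⟩ := exists_pos_le_dist isClosed_closedBall hy₀
    have i1 : IntegrableOn (fun y => (starRingEnd ℂ) (T.adjoint R.ind y)) (closedBall y₀ r) :=
      MemLp.integrableOn_closedBall (Lp.memLp (T.adjoint R.ind)).star _ _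
    have i0 : ∀ B ⊆ closedBall y₀ r, MeasurableSet B →
        Integrable (fun z : Plane × Plane => K z.1 z.2)
          ((volume.restrict R.toSet).prod (volume.restrict B)) := by
      intro B hB hBm
      have hv : volume B ≠ ∞ :=
        ((measure_mono hB).trans_lt measure_closedBall_lt_top).ne
      have := hK.integrable_prod hA R.measurableSet_toSet R.volume_ne_top
        (f := B.indicator fun _ => (1 : ℂ)) ((integrable_indicator_iff hBm).2 (integrableOn_const hv)) hr
        (fun x hx y hy => by
          rw [dist_comm]
          exact hsep y (hB (Set.mem_of_indicator_ne_zero hy)) x (R.toSet_subset_closedBall hx))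
      have h2 := this.integrableOn (s := Set.univ ×ˢ B)
      rw [IntegrableOn, ← Measure.prod_restrict, Measure.restrict_univ] at h2
      refine h2.congr ?_
      have hae : ∀ᵐ z ∂((volume.restrict R.toSet).prod ((volume : Measure Plane).restrict B)),
          z.2 ∈ B := Measure.quasiMeasurePreserving_snd.ae (ae_restrict_mem hBm)
      filter_upwards [hae] with z hz
      simp [hz]
    refine ⟨r, hr, i1.sub (i0 _ subset_rfl measurableSet_closedBall).integral_prod_right, ?_⟩
    intro c s hs hcs
    obtain ⟨Q, hQ, hQs⟩ := Cube.exists_eq_closedBall_ae c hs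
    rw [← setIntegral_congr_set hQ, integral_sub (i1.mono_set (hQs.trans hcs))
      (i0 _ (hQs.trans hcs) Q.measurableSet_toSet).integral_prod_right,
      hT.setIntegral_adjoint, integral_integral_swap, sub_self]
    · exact i0 _ (hQs.trans hcs) Q.measurableSet_toSet
    · refine Set.disjoint_left.2 fun z hz hz' => ?_
      have := hsep z (hcs (hQs hz)) z (R.toSet_subset_closedBall hz')
      rw [dist_self] at this
      linarith
  filter_upwards [key] with y hy hyR
  exact sub_eq_zero.1 (hy hyR)

/-- Off the support of `f`, the function `T f` is given by integration against the kernel. -/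
theorem HasKernel.ae_eq_integral (hT : HasKernel T K) (hK : IsRegularKernel θ A K) (hA : 0 ≤ A)
    {f : Plane → ℂ} (h1 : MemLp f 1 volume) (h2 : MemLp f 2 volume) {F : Set Plane}
    (hF : IsClosed F) (hf : ∀ y ∉ F, f y = 0) :
    ∀ᵐ x, x ∉ F → T (h2.toLp f) x = ∫ y, K x y * f y := by
  have key : ∀ᵐ x, x ∈ Fᶜ → T (h2.toLp f) x - ∫ y, K x y * f y = 0 := by
    refine ae_eq_zero_of_integral_closedBall fun x₀ hx₀ => ?_
    obtain ⟨r, hr, hsep⟩ := exists_pos_le_dist hF hx₀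
    have hf1 : Integrable f := memLp_one_iff_integrable.1 h1
    have hne : ∀ y, f y ≠ 0 → y ∈ F := fun y hy => by
      by_contra h
      exact hy (hf y h)
    have i1 : IntegrableOn (fun x => T (h2.toLp f) x) (closedBall x₀ r) :=
      MemLp.integrableOn_closedBall (Lp.memLp _) _ _
    have i0 : ∀ B ⊆ closedBall x₀ r, MeasurableSet B →
        Integrable (fun z : Plane × Plane => K z.1 z.2 * f z.2)
          ((volume.restrict B).prod volume) := fun B hB hBm =>
      hK.integrable_prod hA hBm ((measure_mono hB).trans_lt measure_closedBall_lt_top).ne hf1 hr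
        fun x hx y hy => hsep x (hB hx) y (hne y hy)
    refine ⟨r, hr, i1.sub (i0 _ subset_rfl measurableSet_closedBall).integral_prod_left, ?_⟩
    intro c s hs hcs
    obtain ⟨Q, hQ, hQs⟩ := Cube.exists_eq_closedBall_ae c hs
    have hQr := hQs.trans hcs
    -- The formula for the adjoint is available only off the closed square, so the closure of `Q`
    -- must also avoid the support of `f`.
    have hQc : closedBall Q.center (Q.side / 2) ⊆ closedBall x₀ r := by
      rw [Cube.closedBall_eq_prod, ← closure_Ico (by linarith [Q.side_pos] :
        Q.corner.1 ≠ Q.corner.1 + Q.side), ← closure_Ico (by linarith [Q.side_pos] :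
        Q.corner.2 ≠ Q.corner.2 + Q.side), ← closure_prod_eq]
      exact closure_minimal hQr isClosed_closedBall
    rw [← setIntegral_congr_set hQ, integral_sub (i1.mono_set hQr)
      (i0 _ hQr Q.measurableSet_toSet).integral_prod_left, sub_eq_zero,
      setIntegral_apply_eq, integral_integral_swap (i0 _ hQr Q.measurableSet_toSet)]
    refine integral_congr_ae ?_
    filter_upwards [hT.adjoint_ind_ae_eq hK hA Q, h2.coeFn_toLp] with y hy hfy
    rw [hfy, integral_mul_const, mul_comm]
    by_cases hyF : y ∈ F
    · rw [hy fun hyQ => ?_]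
      have := hsep y (hQc hyQ) y hyF
      rw [dist_self] at this
      linarith
    · rw [hf y hyF, mul_zero, mul_zero]
  filter_upwards [key] with x hx hxF
  exact sub_eq_zero.1 (hx hxF)

end

/-! ### The weak type (1,1) inequality. -/

section

variable {T : Lp ℂ 2 (volume : Measure Plane) →L[ℂ] Lp ℂ 2 (volume : Measure Plane)}
  {K : Plane → Plane → ℂ} {θ A : ℝ}

theorem Cube.closedBall_subset_triple (P : Cube) :
    closedBall P.center (P.side / 2) ⊆ P.triple.toSet := by
  have h := P.triple.ball_subset_toSet
  rw [center_triple, side_triple] at h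
  exact (closedBall_subset_ball (by linarith [P.side_pos])).trans h

theorem memLp_one_of_support_subset_cube {b : Plane → ℂ} (hb : MemLp b 2 volume) {P : Cube}
    (hP : ∀ y ∉ P.toSet, b y = 0) : MemLp b 1 volume :=
  hb.mono_exponent_of_measure_support_ne_top hP P.volume_ne_top (by norm_num)

/-- `T` maps functions of mean zero on a cube to functions that are integrable off the tripled
cube. -/
theorem HasKernel.lintegral_atom_le (hT : HasKernel T K) (hK : IsRegularKernel θ A K)
    (hK' : IsRegularKernel θ A (flip K)) (hA : 0 ≤ A) (hθ : 0 < θ) (hθ1 : θ ≤ 1) {b : Plane → ℂ}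
    (hb : MemLp b 2 volume) {P : Cube} (hP : ∀ y ∉ P.toSet, b y = 0) (hb0 : ∫ y, b y = 0) :
    ∫⁻ x in P.triple.toSetᶜ, ‖T (hb.toLp b) x‖ₑ ≤ ENNReal.ofReal (5120 * A / θ) * ∫⁻ y, ‖b y‖ₑ := by
  have hb1 := memLp_one_of_support_subset_cube hb hP
  have hbi : Integrable b := memLp_one_iff_integrable.1 hb1
  have hc : P.center ∈ P.toSet := P.ball_subset_toSet (mem_ball_self (by linarith [P.side_pos]))
  have hrep := hT.ae_eq_integral hK hA hb1 hb (F := closedBall P.center (P.side / 2))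
    isClosed_closedBall (fun y hy => hP y fun h => hy (P.toSet_subset_closedBall h))
  have hpt : ∀ᵐ x, x ∈ P.triple.toSetᶜ → ‖T (hb.toLp b) x‖ₑ ≤
      ∫⁻ y, ‖K x y - K x P.center‖ₑ * ‖b y‖ₑ := by
    filter_upwards [hrep] with x hx hxP
    rw [hx fun h => hxP (P.closedBall_subset_triple h)]
    have hi : Integrable fun y => K x y * b y := by
      refine (hbi.norm.const_mul (A / P.side ^ 2)).mono'
        ((hK.meas.comp measurable_prodMk_left).aestronglyMeasurable.mul hbi.1) ?_
      refine Eventually.of_forall fun y => ?_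
      rw [norm_mul]
      by_cases hy : y ∈ P.toSet
      · refine mul_le_mul_of_nonneg_right (hK.norm_le_of_le_dist hA P.side_pos ?_) (norm_nonneg _)
        rw [dist_comm]
        exact Cube.side_le_dist hy hxP
      · simp [hP y hy]
    -- The mean zero of `b` allows the value of the kernel at the centre to be subtracted.
    have he : ∫ y, K x y * b y = ∫ y, (K x y - K x P.center) * b y := by
      simp_rw [sub_mul]
      rw [integral_sub hi (hbi.const_mul _), integral_const_mul, hb0, mul_zero, sub_zero]
    rw [he]
    refine (enorm_integral_le_lintegral_enorm _).trans_eq ?_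
    simp_rw [enorm_mul]
  have hm : Measurable (Function.uncurry fun x y => ‖K x y - K x P.center‖ₑ) :=
    (hK.meas.sub (hK.meas.comp (measurable_fst.prodMk measurable_const))).enorm
  calc _ ≤ ∫⁻ x in P.triple.toSetᶜ, ∫⁻ y, ‖K x y - K x P.center‖ₑ * ‖b y‖ₑ :=
        setLIntegral_mono_ae' P.triple.measurableSet_toSet.compl hpt
    _ = ∫⁻ y, ∫⁻ x in P.triple.toSetᶜ, ‖K x y - K x P.center‖ₑ * ‖b y‖ₑ :=
        lintegral_lintegral_swap (hm.aemeasurable.mul hbi.1.enorm.comp_snd)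
    _ ≤ ∫⁻ y, ENNReal.ofReal (5120 * A / θ) * ‖b y‖ₑ := by
        refine lintegral_mono fun y => ?_
        rw [lintegral_mul_const' _ _ enorm_ne_top]
        by_cases hy : y ∈ P.toSet
        · refine mul_le_mul_left ?_ _
          -- After Fubini the first argument of `K` is integrated, so the transposed kernel is
          -- needed. For p = 2 the conjugate exponent is 2 and the constant is 2 · 2560 = 5120.
          have := hK'.hormander hA hθ hθ1 hy hc (p := 2) (by norm_num) (h := fun _ => 1)
            aemeasurable_const (lam := 1) (fun r _ => by simp)
          simp only [flip, mul_one, ENNReal.one_rpow] at this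
          refine this.trans_eq ?_
          congr 1; ring
        · simp [hP y hy]
    _ = _ := lintegral_const_mul' _ _ ENNReal.ofReal_ne_top

theorem enorm_average_le {f : Plane → ℂ} (P : Cube) {c : ℝ≥0∞}
    (h : ∫⁻ x in P.toSet, ‖f x‖ₑ ≤ c * volume P.toSet) : ‖⨍ x in P.toSet, f x‖ₑ ≤ c := by
  rw [setAverage_eq, enorm_smul]
  have h1 : ‖(volume.real P.toSet)⁻¹‖ₑ = (volume P.toSet)⁻¹ := by
    have : 0 < volume.real P.toSet := ENNReal.toReal_pos P.volume_ne_zero P.volume_ne_top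
    rw [Real.enorm_eq_ofReal (by positivity), ENNReal.ofReal_inv_of_pos this,
      ofReal_measureReal P.volume_ne_top]
  rw [h1]
  calc _ ≤ (volume P.toSet)⁻¹ * (c * volume P.toSet) := by
        gcongr
        exact (enorm_integral_le_lintegral_enorm _).trans h
    _ = c := by
        rw [mul_comm c, ← mul_assoc, ENNReal.inv_mul_cancel P.volume_ne_zero P.volume_ne_top, one_mul]

theorem lintegral_enorm_sub_average_le {f : Plane → ℂ} (P : Cube) :
    ∫⁻ x, ‖P.toSet.indicator (fun x => f x - ⨍ y in P.toSet, f y) x‖ₑ ≤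
      2 * ∫⁻ x in P.toSet, ‖f x‖ₑ := by
  have h1 : ‖⨍ x in P.toSet, f x‖ₑ ≤ (∫⁻ x in P.toSet, ‖f x‖ₑ) / volume P.toSet :=
    enorm_average_le P (by rw [ENNReal.div_mul_cancel P.volume_ne_zero P.volume_ne_top])
  simp_rw [enorm_indicator_eq_indicator_enorm]
  rw [lintegral_indicator P.measurableSet_toSet]
  calc _ ≤ ∫⁻ x in P.toSet, (‖f x‖ₑ + ‖⨍ y in P.toSet, f y‖ₑ) :=
        lintegral_mono fun x => enorm_sub_le
    _ = (∫⁻ x in P.toSet, ‖f x‖ₑ) + ‖⨍ y in P.toSet, f y‖ₑ * volume P.toSet := by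
        rw [lintegral_add_right _ measurable_const, setLIntegral_const]
    _ ≤ (∫⁻ x in P.toSet, ‖f x‖ₑ) + (∫⁻ x in P.toSet, ‖f x‖ₑ) := by
        gcongr
        exact (mul_le_mul_left h1 _).trans_eq
          (ENNReal.div_mul_cancel P.volume_ne_zero P.volume_ne_top)
    _ = _ := by ring

theorem measure_lt_norm_le_of_lintegral_sq {u : Plane → ℂ} (hu : AEStronglyMeasurable u volume)
    {t : ℝ} (ht : 0 < t) :
    volume {x | t < ‖u x‖} ≤ (∫⁻ x, ‖u x‖ₑ ^ 2) / ENNReal.ofReal t ^ 2 := by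
  have h0 : ENNReal.ofReal t ^ 2 ≠ 0 := pow_ne_zero _ (ENNReal.ofReal_pos.2 ht).ne'
  refine (measure_mono fun x hx => ?_).trans
    (meas_ge_le_lintegral_div (hu.enorm.pow_const 2) h0 (by simp))
  have : ENNReal.ofReal t ≤ ‖u x‖ₑ := by
    rw [← ofReal_norm]; exact ENNReal.ofReal_le_ofReal (le_of_lt hx)
  exact pow_le_pow_left' this 2

theorem lintegral_sq_apply_le {N : ℝ} (hN : ‖T‖ ≤ N) (g : Lp ℂ 2 (volume : Measure Plane)) :
    ∫⁻ x, ‖T g x‖ₑ ^ 2 ≤ ENNReal.ofReal (N ^ 2) * ∫⁻ x, ‖g x‖ₑ ^ 2 := by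
  have key : ∀ u : Lp ℂ 2 (volume : Measure Plane), ∫⁻ x, ‖u x‖ₑ ^ 2 = ‖u‖ₑ ^ 2 := by
    intro u
    rw [Lp.enorm_def, eLpNorm_eq_lintegral_rpow_enorm_toReal two_ne_zero ENNReal.ofNat_ne_top,
      ← ENNReal.rpow_natCast, ← ENNReal.rpow_mul]
    simp
  rw [key, key]
  have h0 : 0 ≤ N := (norm_nonneg _).trans hN
  have h1 : ‖T g‖ₑ ≤ ENNReal.ofReal N * ‖g‖ₑ := by
    rw [← ofReal_norm, ← ofReal_norm, ← ENNReal.ofReal_mul h0]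
    exact ENNReal.ofReal_le_ofReal (T.le_of_opNorm_le hN g)
  calc _ ≤ (ENNReal.ofReal N * ‖g‖ₑ) ^ 2 := pow_le_pow_left' h1 2
    _ = _ := by rw [mul_pow, ENNReal.ofReal_pow h0]

/-- The weak-type constant. -/
noncomputable def weakConst (θ A N : ℝ) : ℝ := 24 * N ^ 2 + 9 + 20480 * A / θ

theorem HasKernel.weak_type_bad_part (hT : HasKernel T K) (hK : IsRegularKernel θ A K)
    (hK' : IsRegularKernel θ A (flip K)) (hA : 0 ≤ A) (hθ : 0 < θ) (hθ1 : θ ≤ 1)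
    {f : Plane → ℂ} (h2 : MemLp f 2 volume) {ι : Type*} (s : Finset ι) (Q : ι → Cube)
    (hd : (s : Set ι).PairwiseDisjoint fun i => (Q i).toSet) {t : ℝ} (ht : 0 < t)
    (hQ : ∀ i ∈ s, ENNReal.ofReal t * volume (Q i).toSet ≤ ∫⁻ x in (Q i).toSet, ‖f x‖ₑ)
    {b : ι → Plane → ℂ} (hb : ∀ i, MemLp (b i) 2 volume)
    (hbdef : ∀ i, b i = (Q i).toSet.indicator fun x => f x - ⨍ y in (Q i).toSet, f y) :
    volume {x | t / 2 < ‖(∑ i ∈ s, T ((hb i).toLp (b i))) x‖} ≤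
      ENNReal.ofReal (9 + 20480 * A / θ) * (∫⁻ x, ‖f x‖ₑ) / ENNReal.ofReal t := by
  have hfi : ∀ i, IntegrableOn f (Q i).toSet := fun i => by
    have : IsFiniteMeasure ((volume : Measure Plane).restrict (Q i).toSet) :=
      ⟨by rw [Measure.restrict_apply_univ]; exact (Q i).volume_ne_top.lt_top⟩
    exact (h2.restrict _).integrable (by norm_num)
  have hb0 : ∀ i, ∫ y, b i y = 0 := by
    intro i
    rw [hbdef, integral_indicator (Q i).measurableSet_toSet, integral_sub (hfi i)
      (integrableOn_const (Q i).volume_ne_top), setIntegral_const, setAverage_eq, smul_smul,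
      mul_inv_cancel₀ (show volume.real (Q i).toSet ≠ 0 from
        (ENNReal.toReal_pos (Q i).volume_ne_zero (Q i).volume_ne_top).ne'), one_smul, sub_self]
  have hbs : ∀ i, ∀ y ∉ (Q i).toSet, b i y = 0 := fun i y hy => by
    rw [hbdef, Set.indicator_of_notMem hy]
  set I := ∫⁻ x, ‖f x‖ₑ with hI
  have hsum : ∑ i ∈ s, ∫⁻ x in (Q i).toSet, ‖f x‖ₑ ≤ I := by
    rw [← lintegral_biUnion_finset hd fun i _ => (Q i).measurableSet_toSet]
    exact setLIntegral_le_lintegral _ _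
  have ht0 : ENNReal.ofReal t ≠ 0 := (ENNReal.ofReal_pos.2 ht).ne'
  set U : Set Plane := ⋃ i ∈ s, (Q i).triple.toSet with hU
  have hUm : MeasurableSet U := Finset.measurableSet_biUnion _ fun i _ =>
    (Q i).triple.measurableSet_toSet
  -- Tripling multiplies areas by 9, and each selected cube has |f|-average at least t.
  have hUv : volume U ≤ 9 * I / ENNReal.ofReal t := by
    rw [ENNReal.le_div_iff_mul_le (Or.inl ht0) (Or.inl ENNReal.ofReal_ne_top)]
    calc _ ≤ (∑ i ∈ s, volume (Q i).triple.toSet) * ENNReal.ofReal t := by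
          gcongr; exact measure_biUnion_finset_le _ _
      _ = ∑ i ∈ s, 9 * (ENNReal.ofReal t * volume (Q i).toSet) := by
          rw [Finset.sum_mul]
          refine Finset.sum_congr rfl fun i _ => ?_
          rw [Cube.volume_triple]; ring
      _ ≤ ∑ i ∈ s, 9 * ∫⁻ x in (Q i).toSet, ‖f x‖ₑ := Finset.sum_le_sum fun i hi => by
          gcongr; exact hQ i hi
      _ ≤ 9 * I := by rw [← Finset.mul_sum]; gcongr
  have hcoe : ∀ᵐ x, ‖(∑ i ∈ s, T ((hb i).toLp (b i))) x‖ₑ ≤ ∑ i ∈ s, ‖T ((hb i).toLp (b i)) x‖ₑ := by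
    have : ⇑(∑ i ∈ s, T ((hb i).toLp (b i))) =ᵐ[volume] ∑ i ∈ s, ⇑(T ((hb i).toLp (b i))) :=
      Lp.coeFn_finsetSum _ _
    filter_upwards [this] with x hx
    rw [hx, Finset.sum_apply]
    exact enorm_sum_le _ _
  have hint : ∫⁻ x in Uᶜ, ‖(∑ i ∈ s, T ((hb i).toLp (b i))) x‖ₑ ≤
      ENNReal.ofReal (10240 * A / θ) * I := by
    calc _ ≤ ∫⁻ x in Uᶜ, ∑ i ∈ s, ‖T ((hb i).toLp (b i)) x‖ₑ :=
          lintegral_mono_ae (ae_restrict_of_ae hcoe)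
      _ = ∑ i ∈ s, ∫⁻ x in Uᶜ, ‖T ((hb i).toLp (b i)) x‖ₑ :=
          lintegral_finsetSum' _ fun i _ => (Lp.aestronglyMeasurable _).enorm.restrict
      _ ≤ ∑ i ∈ s, ENNReal.ofReal (5120 * A / θ) * (2 * ∫⁻ x in (Q i).toSet, ‖f x‖ₑ) := by
          refine Finset.sum_le_sum fun i hi => ?_
          refine (lintegral_mono_set (Set.compl_subset_compl.2
            (Set.subset_biUnion_of_mem (u := fun i => (Q i).triple.toSet) hi))).trans ?_
          refine (hT.lintegral_atom_le hK hK' hA hθ hθ1 (hb i) (hbs i) (hb0 i)).trans ?_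
          gcongr
          rw [hbdef]
          exact lintegral_enorm_sub_average_le _
      _ = ENNReal.ofReal (5120 * A / θ) * 2 * ∑ i ∈ s, ∫⁻ x in (Q i).toSet, ‖f x‖ₑ := by
          rw [Finset.mul_sum]
          exact Finset.sum_congr rfl fun i _ => by ring
      _ ≤ ENNReal.ofReal (5120 * A / θ) * 2 * I := by gcongr
      _ = _ := by
          rw [← ENNReal.ofReal_ofNat 2, ← ENNReal.ofReal_mul (by positivity)]
          congr 2; ring
  have hsub : {x | t / 2 < ‖(∑ i ∈ s, T ((hb i).toLp (b i))) x‖} ⊆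
      U ∪ {x | x ∈ Uᶜ ∧ ENNReal.ofReal (t / 2) ≤ ‖(∑ i ∈ s, T ((hb i).toLp (b i))) x‖ₑ} := by
    intro x hx
    by_cases hxU : x ∈ U
    · exact Or.inl hxU
    · refine Or.inr ⟨hxU, ?_⟩
      rw [← ofReal_norm]
      exact ENNReal.ofReal_le_ofReal (le_of_lt hx)
  have hmk : volume {x | x ∈ Uᶜ ∧
      ENNReal.ofReal (t / 2) ≤ ‖(∑ i ∈ s, T ((hb i).toLp (b i))) x‖ₑ} ≤
      ENNReal.ofReal (20480 * A / θ) * I / ENNReal.ofReal t := by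
    have := meas_ge_le_lintegral_div (μ := volume.restrict Uᶜ)
      (f := fun x => ‖(∑ i ∈ s, T ((hb i).toLp (b i))) x‖ₑ)
      (Lp.aestronglyMeasurable _).enorm.restrict
      (ε := ENNReal.ofReal (t / 2)) (ENNReal.ofReal_pos.2 (by linarith)).ne' ENNReal.ofReal_ne_top
    rw [Measure.restrict_apply' hUm.compl] at this
    refine (measure_mono ?_).trans (this.trans ?_)
    · rintro x ⟨hx1, hx2⟩
      exact ⟨hx2, hx1⟩
    refine (ENNReal.div_le_div_right hint _).trans_eq ?_
    rw [ENNReal.ofReal_div_of_pos two_pos, div_eq_mul_inv, div_eq_mul_inv, div_eq_mul_inv,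
      ENNReal.mul_inv (Or.inr (by simp)) (Or.inr (by simp)), inv_inv,
      show 20480 * A / θ = 10240 * A / θ * 2 by ring, ENNReal.ofReal_mul (by positivity) (q := 2)]
    simp only [div_eq_mul_inv]
    ring
  calc _ ≤ volume U + _ := (measure_mono hsub).trans (measure_union_le _ _)
    _ ≤ 9 * I / ENNReal.ofReal t + ENNReal.ofReal (20480 * A / θ) * I / ENNReal.ofReal t :=
        add_le_add hUv hmk
    _ = _ := by
        rw [ENNReal.ofReal_add (by norm_num) (by positivity), ENNReal.ofReal_ofNat, add_mul,
          ENNReal.add_div]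

open Classical in
theorem HasKernel.weak_type (hT : HasKernel T K) (hK : IsRegularKernel θ A K)
    (hK' : IsRegularKernel θ A (flip K)) (hA : 0 ≤ A) (hθ : 0 < θ) (hθ1 : θ ≤ 1)
    {N : ℝ} (hN : ‖T‖ ≤ N) {f : Plane → ℂ} (h1 : MemLp f 1 volume) (h2 : MemLp f 2 volume)
    {t : ℝ} (ht : 0 < t) :
    volume {x | t < ‖T (h2.toLp f) x‖} ≤
      ENNReal.ofReal (weakConst θ A N) * (∫⁻ x, ‖f x‖ₑ) / ENNReal.ofReal t := by
  set I := ∫⁻ x, ‖f x‖ₑ with hI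
  set lam := ENNReal.ofReal t with hlam
  have ht0 : lam ≠ 0 := (ENNReal.ofReal_pos.2 ht).ne'
  have htt : lam ≠ ∞ := ENNReal.ofReal_ne_top
  have hIt : I ≠ ∞ := by
    have := h1.2
    rw [eLpNorm_one_eq_lintegral_enorm] at this
    exact this.ne
  have hfm : AEMeasurable f volume := h1.1.aemeasurable
  rcases eq_or_ne I 0 with hI0 | hI0
  · have hf0 : h2.toLp f = 0 := by
      rw [hI, lintegral_eq_zero_iff' hfm.enorm] at hI0
      refine (MemLp.toLp_congr h2 MemLp.zero ?_).trans (MemLp.toLp_zero _)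
      filter_upwards [hI0] with x hx
      simpa using hx
    rw [hf0, map_zero]
    have : volume {x | t < ‖(0 : Lp ℂ 2 (volume : Measure Plane)) x‖} = 0 := by
      have h0 := Lp.coeFn_zero (E := ℂ) (p := 2) (μ := (volume : Measure Plane))
      refine measure_mono_null (fun x hx => ?_) (ae_iff.1 h0)
      intro hx0
      simp only [Set.mem_ofPred_eq, hx0, Pi.zero_apply, norm_zero] at hx
      linarith
    rw [this]; exact zero_le
  -- The grid unit L = I/λ + 1 satisfies L² ≥ I/λ, so no top cube of the grid is selected.
  have hLex : I ≤ lam * ENNReal.ofReal (((I / lam).toReal + 1) ^ 2) := by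
    have h0 : 0 ≤ (I / lam).toReal := ENNReal.toReal_nonneg
    rw [mul_comm, ← ENNReal.div_le_iff_le_mul (Or.inl ht0) (Or.inl htt),
      ← ENNReal.ofReal_toReal (ENNReal.div_ne_top hIt ht0)]
    refine ENNReal.ofReal_le_ofReal ?_
    rw [ENNReal.toReal_ofReal h0]
    nlinarith
  obtain ⟨𝒟, hcount, hdisj, hlow, hup, hout, -⟩ := exists_stopping_cubes (0, 0) _
    (by have : 0 ≤ (I / lam).toReal := ENNReal.toReal_nonneg
        linarith) (fun x => ‖f x‖ₑ) hfm.enorm hIt hLex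
  have := hcount.to_subtype
  have h2f : ∫⁻ x, ‖f x‖ₑ ^ 2 ≠ ∞ := by
    have := h2.2
    rw [eLpNorm_lt_top_iff_lintegral_rpow_enorm_lt_top two_ne_zero ENNReal.ofNat_ne_top] at this
    simpa using this.ne
  have hdisj' : Pairwise (Function.onFun Disjoint fun P : 𝒟 => (P : Cube).toSet) :=
    fun P P' hne => hdisj P.2 P'.2 fun h => hne (Subtype.ext h)
  have hts : ∑' P : 𝒟, ∫⁻ x in (P : Cube).toSet, ‖f x‖ₑ ^ 2 ≠ ∞ := by
    rw [← lintegral_iUnion (fun P : 𝒟 => (P : Cube).measurableSet_toSet) hdisj']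
    exact ((setLIntegral_le_lintegral _ _).trans_lt h2f.lt_top).ne
  -- Only finitely many bad parts are removed, so that linearity of `T` on L² suffices. The cubes
  -- left in the good part carry L² mass less than `lam * I`.
  obtain ⟨s, hs⟩ := ((ENNReal.tendsto_tsum_compl_atTop_zero hts).eventually
    (gt_mem_nhds (pos_iff_ne_zero.2 (mul_ne_zero ht0 hI0)))).exists
  set b : 𝒟 → Plane → ℂ := fun P => (P : Cube).toSet.indicator
    fun x => f x - ⨍ y in (P : Cube).toSet, f y with hbdef
  have hb : ∀ P, MemLp (b P) 2 volume := fun P => by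
    rw [memLp_indicator_iff_restrict (P : Cube).measurableSet_toSet]
    have : IsFiniteMeasure ((volume : Measure Plane).restrict (P : Cube).toSet) :=
      ⟨by rw [Measure.restrict_apply_univ]; exact (P : Cube).volume_ne_top.lt_top⟩
    exact (h2.restrict _).sub (memLp_const _)
  set g : Plane → ℂ := f - ∑ P ∈ s, b P with hg
  have hgm : MemLp g 2 volume := h2.sub (memLp_finsetSum' s fun P _ => hb P)
  have hbad := hT.weak_type_bad_part hK hK' hA hθ hθ1 h2 s (fun P : 𝒟 => (P : Cube))
    (fun P _ P' _ hne => hdisj' hne) ht (fun P _ => hlow P P.2) hb (fun P => rfl)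
  set V : Set Plane := ⋃ P ∈ 𝒟, P.toSet with hV
  have hVm : MeasurableSet V := MeasurableSet.biUnion hcount fun P _ => P.measurableSet_toSet
  have hgV : ∀ x ∉ V, g x = f x := by
    intro x hx
    have : ∀ P : 𝒟, b P x = 0 := fun P =>
      Set.indicator_of_notMem (fun h => hx (Set.mem_iUnion₂.2 ⟨P, P.2, h⟩)) _
    simp [hg, Finset.sum_apply, this]
  have hgP : ∀ P : 𝒟, ∀ x ∈ (P : Cube).toSet, g x = if P ∈ s then ⨍ y in (P : Cube).toSet, f y
      else f x := by
    intro P x hx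
    have hz : ∀ P' : 𝒟, P' ≠ P → b P' x = 0 := fun P' hne =>
      Set.indicator_of_notMem (fun h => Set.disjoint_left.1 (hdisj' hne) h hx) _
    split_ifs with hP
    · rw [hg, Pi.sub_apply, Finset.sum_apply, Finset.sum_eq_single_of_mem P hP fun P' _ h => hz P' h]
      simp [hbdef, hx]
    · rw [hg, Pi.sub_apply, Finset.sum_apply, Finset.sum_eq_zero, sub_zero]
      exact fun P' hP' => hz P' fun h => hP (h ▸ hP')
  -- The bound is 4λI from the averages on the cubes in `s`, λI from the remaining cubes and λI from
  -- the complement, where |f| ≤ λ.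
  have hg2 : ∫⁻ x, ‖g x‖ₑ ^ 2 ≤ 6 * (lam * I) := by
    rw [← lintegral_add_compl _ hVm]
    have hVc : ∫⁻ x in Vᶜ, ‖g x‖ₑ ^ 2 ≤ lam * I := by
      calc _ ≤ ∫⁻ x in Vᶜ, lam * ‖f x‖ₑ := by
            refine setLIntegral_mono_ae' hVm.compl ?_
            filter_upwards [hout] with x hx hxV
            rw [hgV x hxV, sq]
            exact mul_le_mul_left (hx hxV) _
        _ ≤ ∫⁻ x, lam * ‖f x‖ₑ := setLIntegral_le_lintegral _ _
        _ = _ := lintegral_const_mul' _ _ htt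
    have hVs : ∫⁻ x in V, ‖g x‖ₑ ^ 2 ≤ 4 * (lam * I) + lam * I := by
      have e : V = ⋃ P : 𝒟, (P : Cube).toSet := Set.biUnion_eq_iUnion _ _
      rw [e, lintegral_iUnion (fun P : 𝒟 => (P : Cube).measurableSet_toSet) hdisj',
        ← ENNReal.sum_add_tsum_compl s]
      refine add_le_add ?_ ?_
      · calc _ ≤ ∑ P ∈ s, 4 * lam * ∫⁻ x in (P : Cube).toSet, ‖f x‖ₑ := by
              refine Finset.sum_le_sum fun P hP => ?_
              rw [setLIntegral_congr_fun (P : Cube).measurableSet_toSet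
                (g := fun _ => ‖⨍ y in (P : Cube).toSet, f y‖ₑ ^ 2) (fun x hx => by
                  simp only [hgP P x hx, if_pos hP]), setLIntegral_const, sq, mul_assoc]
              refine mul_le_mul' (enorm_average_le _ (hup P P.2)) ?_
              have := enorm_average_le (f := f) (P : Cube)
                (c := (∫⁻ x in (P : Cube).toSet, ‖f x‖ₑ) / volume (P : Cube).toSet)
                (by rw [ENNReal.div_mul_cancel (Cube.volume_ne_zero _) (Cube.volume_ne_top _)])
              exact (mul_le_mul_left this _).trans_eq
                (ENNReal.div_mul_cancel (Cube.volume_ne_zero _) (Cube.volume_ne_top _))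
          _ ≤ 4 * lam * I := by
              rw [← Finset.mul_sum]
              gcongr
              rw [← lintegral_biUnion_finset (fun P _ P' _ hne => hdisj' hne)
                fun P _ => (P : Cube).measurableSet_toSet]
              exact setLIntegral_le_lintegral _ _
          _ = _ := mul_assoc _ _ _
      · refine le_trans ?_ hs.le
        refine ENNReal.tsum_le_tsum fun P => ?_
        rw [setLIntegral_congr_fun (P : Cube).measurableSet_toSet
          (g := fun x => ‖f x‖ₑ ^ 2) (fun x hx => by
            simp only [hgP P x hx, if_neg (fun h : (P : 𝒟) ∈ s => P.2 (Finset.mem_coe.2 h))])]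
    calc _ ≤ (4 * (lam * I) + lam * I) + lam * I := add_le_add hVs hVc
      _ = _ := by ring
  -- Chebyshev at height t/2 gives N² · 6λI · 4/λ² = 24 N² I/λ.
  have hgood : volume {x | t / 2 < ‖T (hgm.toLp g) x‖} ≤ ENNReal.ofReal (24 * N ^ 2) * I / lam := by
    refine (measure_lt_norm_le_of_lintegral_sq (Lp.aestronglyMeasurable _) (half_pos ht)).trans ?_
    have hTg := lintegral_sq_apply_le hN (hgm.toLp g)
    have : ∫⁻ x, ‖hgm.toLp g x‖ₑ ^ 2 = ∫⁻ x, ‖g x‖ₑ ^ 2 := by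
      refine lintegral_congr_ae ?_
      filter_upwards [hgm.coeFn_toLp] with x hx
      rw [hx]
    rw [this] at hTg
    have h3 : ENNReal.ofReal (t / 2) ^ 2 = lam * lam / 4 := by
      rw [← ENNReal.ofReal_pow (by positivity), hlam, ← ENNReal.ofReal_mul ht.le,
        ← ENNReal.ofReal_ofNat 4, ← ENNReal.ofReal_div_of_pos (by norm_num)]
      congr 1; ring
    rw [h3]
    refine (ENNReal.div_le_div_right (hTg.trans (mul_le_mul_right hg2 _)) _).trans_eq ?_
    rw [show 24 * N ^ 2 = N ^ 2 * 6 * 4 by ring, ENNReal.ofReal_mul (by positivity),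
      ENNReal.ofReal_mul (by positivity), ENNReal.ofReal_ofNat, ENNReal.ofReal_ofNat,
      div_eq_mul_inv, div_eq_mul_inv, div_eq_mul_inv,
      ENNReal.mul_inv (Or.inr (by simp)) (Or.inr (by simp)), inv_inv,
      ENNReal.mul_inv (Or.inl ht0) (Or.inl htt)]
    calc _ = ENNReal.ofReal (N ^ 2) * 6 * 4 * I * lam⁻¹ * (lam * lam⁻¹) := by ring
      _ = _ := by rw [ENNReal.mul_inv_cancel ht0 htt, mul_one]
  have hdec : T (h2.toLp f) = T (hgm.toLp g) + ∑ P ∈ s, T ((hb P).toLp (b P)) := by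
    rw [← map_sum, ← map_add]
    congr 1
    refine Lp.ext ?_
    have e1 : ⇑(∑ P ∈ s, (hb P).toLp (b P)) =ᵐ[volume] ∑ P ∈ s, ⇑((hb P).toLp (b P)) :=
      Lp.coeFn_finsetSum _ _
    have e2 : ∀ᵐ x, ∀ P ∈ s, (hb P).toLp (b P) x = b P x :=
      (ae_ball_iff s.countable_toSet).2 fun P _ => (hb P).coeFn_toLp
    filter_upwards [h2.coeFn_toLp, Lp.coeFn_add (hgm.toLp g) (∑ P ∈ s, (hb P).toLp (b P)),
      hgm.coeFn_toLp, e1, e2] with x a1 a2 a3 a4 a5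
    rw [a1, a2, Pi.add_apply, a3, a4, Finset.sum_apply, Finset.sum_congr rfl a5]
    simp [hg, Finset.sum_apply]
  have hsub : ∀ᵐ x, x ∈ {x | t < ‖T (h2.toLp f) x‖} → x ∈ {x | t / 2 < ‖T (hgm.toLp g) x‖} ∪
      {x | t / 2 < ‖(∑ P ∈ s, T ((hb P).toLp (b P))) x‖} := by
    rw [hdec]
    filter_upwards [Lp.coeFn_add (T (hgm.toLp g)) (∑ P ∈ s, T ((hb P).toLp (b P)))] with x hx hxt
    simp only [Set.mem_ofPred_eq, Set.mem_union, hx, Pi.add_apply] at hxt ⊢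
    by_contra! hcon
    linarith [norm_add_le (T (hgm.toLp g) x) ((∑ P ∈ s, T ((hb P).toLp (b P))) x)]
  calc _ ≤ _ := measure_mono_ae hsub
    _ ≤ _ := measure_union_le _ _
    _ ≤ ENNReal.ofReal (24 * N ^ 2) * I / lam +
          ENNReal.ofReal (9 + 20480 * A / θ) * I / lam := add_le_add hgood hbad
    _ = _ := by
        rw [← ENNReal.add_div, ← add_mul, ← ENNReal.ofReal_add (by positivity) (by positivity),
          weakConst, add_assoc]

end

/-! ### The extension to L¹. -/

section

/-- The truncation of a function at height `n`. -/
noncomputable def trunc (n : ℕ) (f : Plane → ℂ) (y : Plane) : ℂ := if ‖f y‖ ≤ n then f y else 0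

theorem norm_trunc_le (n : ℕ) (f : Plane → ℂ) (y : Plane) : ‖trunc n f y‖ ≤ ‖f y‖ := by
  unfold trunc; split_ifs <;> simp

theorem norm_trunc_le_natCast (n : ℕ) (f : Plane → ℂ) (y : Plane) : ‖trunc n f y‖ ≤ n := by
  unfold trunc
  split_ifs with h
  · exact h
  · simp

theorem trunc_eventually_eq (f : Plane → ℂ) (y : Plane) : ∀ᶠ n in atTop, trunc n f y = f y := by
  obtain ⟨m, hm⟩ := exists_nat_ge ‖f y‖
  filter_upwards [eventually_ge_atTop m] with n hn
  exact if_pos (hm.trans (by exact_mod_cast hn))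

theorem aestronglyMeasurable_trunc (n : ℕ) {f : Plane → ℂ} (hf : AEStronglyMeasurable f volume) :
    AEStronglyMeasurable (trunc n f) volume := by
  have : Measurable fun z : ℂ => if ‖z‖ ≤ n then z else 0 :=
    Measurable.ite (measurableSet_le measurable_norm measurable_const) measurable_id measurable_const
  exact (this.comp_aemeasurable hf.aemeasurable).aestronglyMeasurable

theorem memLp_one_trunc (n : ℕ) {f : Plane → ℂ} (hf : MemLp f 1 volume) :
    MemLp (trunc n f) 1 volume :=
  hf.mono (aestronglyMeasurable_trunc n hf.1) (Eventually.of_forall (norm_trunc_le n f))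

theorem memLp_two_trunc (n : ℕ) {f : Plane → ℂ} (hf : MemLp f 1 volume) :
    MemLp (trunc n f) 2 volume := by
  have hm := aestronglyMeasurable_trunc n hf.1
  rw [memLp_two_iff_integrable_sq_norm hm]
  refine ((memLp_one_iff_integrable.1 hf).norm.const_mul (n : ℝ)).mono' (hm.norm.pow 2) ?_
  refine Eventually.of_forall fun y => ?_
  rw [Real.norm_of_nonneg (sq_nonneg _), sq]
  exact mul_le_mul (norm_trunc_le_natCast n f y) (norm_trunc_le n f y) (norm_nonneg _)
    (Nat.cast_nonneg _)

theorem tendsto_lintegral_trunc_sub {f : Plane → ℂ} (hf : MemLp f 1 volume) :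
    Tendsto (fun n => ∫⁻ y, ‖trunc n f y - f y‖ₑ) atTop (𝓝 0) := by
  have h := tendsto_lintegral_of_dominated_convergence' (μ := (volume : Measure Plane))
    (F := fun n y => ‖trunc n f y - f y‖ₑ) (f := fun _ => 0) (fun y => 2 * ‖f y‖ₑ)
    (fun n => ((aestronglyMeasurable_trunc n hf.1).sub hf.1).enorm)
    (fun n => Eventually.of_forall fun y => by
      refine enorm_sub_le.trans ?_
      simp only [two_mul]
      gcongr
      exact enorm_le_iff_norm_le.2 (norm_trunc_le n f y))
    (by
      rw [lintegral_const_mul' _ _ (by simp)]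
      have := hf.2
      rw [eLpNorm_one_eq_lintegral_enorm] at this
      exact ENNReal.mul_ne_top (by simp) this.ne)
    (Eventually.of_forall fun y => tendsto_const_nhds.congr' (by
      filter_upwards [trunc_eventually_eq f y] with n hn
      rw [hn, sub_self, enorm_zero]))
  simpa using h

/-- Fatou's lemma for sets: up to a null set, `S` lies in the lower limit of the `s n`. -/
theorem measure_le_of_tendsto {S : Set Plane} {s : ℕ → Set Plane} {c : ℕ → ℝ≥0∞} {l : ℝ≥0∞}
    (h : ∀ᵐ x, x ∈ S → ∀ᶠ n in atTop, x ∈ s n) (hs : ∀ n, volume (s n) ≤ c n)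
    (hc : Tendsto c atTop (𝓝 l)) : volume S ≤ l := by
  have h1 : volume S ≤ volume (⋃ n, ⋂ k ≥ n, s k) := by
    refine measure_mono_ae ?_
    filter_upwards [h] with x hx hxS
    obtain ⟨n, hn⟩ := eventually_atTop.1 (hx hxS)
    exact Set.mem_iUnion.2 ⟨n, Set.mem_iInter₂.2 hn⟩
  refine h1.trans ?_
  rw [Monotone.measure_iUnion]
  · refine iSup_le fun n => ge_of_tendsto hc ?_
    filter_upwards [eventually_ge_atTop n] with k hk
    exact (measure_mono (Set.biInter_subset_of_mem hk)).trans (hs k)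
  · intro m n hmn
    exact Set.biInter_subset_biInter_left fun k hk => le_trans hmn hk

variable {T : Lp ℂ 2 (volume : Measure Plane) →L[ℂ] Lp ℂ 2 (volume : Measure Plane)}
  {B : ℝ≥0∞}

/-- The weak-type `(1,1)` inequality with constant `B` on `L¹ ∩ L²`. -/
def IsWeakType (T : Lp ℂ 2 (volume : Measure Plane) →L[ℂ] Lp ℂ 2 (volume : Measure Plane))
    (B : ℝ≥0∞) : Prop :=
  ∀ (f : Plane → ℂ) (_ : MemLp f 1 volume) (h2 : MemLp f 2 volume) (t : ℝ), 0 < t →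
    volume {x | t < ‖T (h2.toLp f) x‖} ≤ B * (∫⁻ x, ‖f x‖ₑ) / ENNReal.ofReal t

/-- `g` is an almost everywhere limit of `T uₙ` for some `uₙ ∈ L¹ ∩ L²` converging to `f`
in `L¹`. -/
def IsExtensionValue (T : Lp ℂ 2 (volume : Measure Plane) →L[ℂ] Lp ℂ 2 (volume : Measure Plane))
    (f g : Plane → ℂ) : Prop :=
  MemLp f 1 volume ∧
    ∃ (u : ℕ → Plane → ℂ) (_ : ∀ n, MemLp (u n) 1 volume) (h2 : ∀ n, MemLp (u n) 2 volume),
      Tendsto (fun n => ∫⁻ y, ‖u n y - f y‖ₑ) atTop (𝓝 0) ∧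
        ∀ᵐ x, Tendsto (fun n => T ((h2 n).toLp (u n)) x) atTop (𝓝 (g x))

theorem lintegral_enorm_le_sub_add {u f : Plane → ℂ} (hu : AEStronglyMeasurable u volume)
    (hf : AEStronglyMeasurable f volume) :
    ∫⁻ y, ‖u y‖ₑ ≤ (∫⁻ y, ‖u y - f y‖ₑ) + ∫⁻ y, ‖f y‖ₑ := by
  have := lintegral_add_left' (μ := (volume : Measure Plane)) (hu.sub hf).enorm fun y => ‖f y‖ₑ
  simp only [Pi.sub_apply] at this
  rw [← this]
  refine lintegral_mono fun y => ?_
  calc ‖u y‖ₑ = ‖(u y - f y) + f y‖ₑ := by rw [sub_add_cancel]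
    _ ≤ _ := enorm_add_le _ _

theorem IsWeakType.limit (hW : IsWeakType T B) (hB : B ≠ ∞) {u : ℕ → Plane → ℂ}
    (h1 : ∀ n, MemLp (u n) 1 volume) (h2 : ∀ n, MemLp (u n) 2 volume) {c : ℕ → ℝ≥0∞} {l : ℝ≥0∞}
    (hc : ∀ n, ∫⁻ y, ‖u n y‖ₑ ≤ c n) (hl : Tendsto c atTop (𝓝 l)) {g : Plane → ℂ}
    (hg : ∀ᵐ x, Tendsto (fun n => T ((h2 n).toLp (u n)) x) atTop (𝓝 (g x))) {t : ℝ} (ht : 0 < t) :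
    volume {x | t < ‖g x‖} ≤ B * l / ENNReal.ofReal t := by
  have ht0 : ENNReal.ofReal t ≠ 0 := (ENNReal.ofReal_pos.2 ht).ne'
  refine measure_le_of_tendsto (s := fun n => {x | t < ‖T ((h2 n).toLp (u n)) x‖})
    (c := fun n => B * c n / ENNReal.ofReal t) ?_ (fun n => ?_) ?_
  · filter_upwards [hg] with x hx hxt
    exact hx.norm.eventually (lt_mem_nhds hxt)
  · refine (hW _ (h1 n) (h2 n) t ht).trans ?_
    gcongr
    exact hc n
  · exact ENNReal.Tendsto.div_const (ENNReal.Tendsto.const_mul hl (Or.inr hB)) (Or.inr ht0)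

theorem IsWeakType.weak_type_of_isExtensionValue (hW : IsWeakType T B) (hB : B ≠ ∞)
    {f g : Plane → ℂ} (hfg : IsExtensionValue T f g) {t : ℝ} (ht : 0 < t) :
    volume {x | t < ‖g x‖} ≤ B * (∫⁻ x, ‖f x‖ₑ) / ENNReal.ofReal t := by
  obtain ⟨hf, u, h1, h2, hu, hg⟩ := hfg
  refine hW.limit hB h1 h2 (c := fun n => (∫⁻ y, ‖u n y - f y‖ₑ) + ∫⁻ y, ‖f y‖ₑ)
    (fun n => lintegral_enorm_le_sub_add (h1 n).1 hf.1) ?_ hg ht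
  simpa using hu.add_const (∫⁻ y, ‖f y‖ₑ)

theorem ae_eq_zero_of_measure_lt_norm {g : Plane → ℂ}
    (h : ∀ t : ℝ, 0 < t → volume {x | t < ‖g x‖} = 0) : ∀ᵐ x, g x = 0 := by
  have : ∀ᵐ x, ∀ n : ℕ, ¬ (1 / ((n : ℝ) + 1) < ‖g x‖) := by
    rw [ae_all_iff]
    intro n
    rw [ae_iff]
    simpa using h (1 / ((n : ℝ) + 1)) (by positivity)
  filter_upwards [this] with x hx
  by_contra hne
  obtain ⟨n, hn⟩ := exists_nat_one_div_lt (norm_pos_iff.2 hne)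
  exact hx n hn

theorem toLp_combination {p : ℝ≥0∞} [Fact (1 ≤ p)] {u v : Plane → ℂ} (hu : MemLp u p volume)
    (hv : MemLp v p volume) (c : ℂ) :
    ((hu.const_smul c).add hv).toLp (c • u + v) = c • hu.toLp u + hv.toLp v := rfl

theorem apply_combination {u v : Plane → ℂ} (hu : MemLp u 2 volume) (hv : MemLp v 2 volume) (c : ℂ) :
    ∀ᵐ x, T (((hu.const_smul c).add hv).toLp (c • u + v)) x =
      c * T (hu.toLp u) x + T (hv.toLp v) x := by
  rw [toLp_combination hu hv, map_add, map_smul]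
  filter_upwards [Lp.coeFn_add (c • T (hu.toLp u)) (T (hv.toLp v)),
    Lp.coeFn_smul c (T (hu.toLp u))] with x h1 h2
  rw [h1, Pi.add_apply, h2, Pi.smul_apply, smul_eq_mul]

theorem lintegral_enorm_combination_le {u v : Plane → ℂ} (hu : AEStronglyMeasurable u volume)
    (c : ℂ) : ∫⁻ y, ‖c * u y + v y‖ₑ ≤ ‖c‖ₑ * (∫⁻ y, ‖u y‖ₑ) + ∫⁻ y, ‖v y‖ₑ := by
  rw [← lintegral_const_mul' _ _ enorm_ne_top, ← lintegral_add_left' (hu.enorm.const_mul _)]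
  refine lintegral_mono fun y => ?_
  rw [← enorm_mul]
  exact enorm_add_le _ _

theorem IsExtensionValue.combination {f g f' g' : Plane → ℂ} (h : IsExtensionValue T f g)
    (h' : IsExtensionValue T f' g') (c : ℂ) : IsExtensionValue T (c • f + f') (c • g + g') := by
  obtain ⟨hf, u, h1, h2, hu, hg⟩ := h
  obtain ⟨hf', u', h1', h2', hu', hg'⟩ := h'
  refine ⟨(hf.const_smul c).add hf', fun n => c • u n + u' n,
    fun n => ((h1 n).const_smul c).add (h1' n), fun n => ((h2 n).const_smul c).add (h2' n), ?_, ?_⟩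
  · have hlim : Tendsto (fun n => ‖c‖ₑ * (∫⁻ y, ‖u n y - f y‖ₑ) + ∫⁻ y, ‖u' n y - f' y‖ₑ) atTop
        (𝓝 (‖c‖ₑ * 0 + 0)) := (ENNReal.Tendsto.const_mul hu (Or.inr enorm_ne_top)).add hu'
    rw [mul_zero, add_zero] at hlim
    refine tendsto_of_tendsto_of_tendsto_of_le_of_le tendsto_const_nhds hlim
      (fun _ => zero_le) fun n => ?_
    refine le_trans (le_of_eq ?_) (lintegral_enorm_combination_le (u := fun y => u n y - f y)
      (v := fun y => u' n y - f' y) ((h1 n).1.sub hf.1) c)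
    refine lintegral_congr fun y => ?_
    congr 1
    simp only [Pi.add_apply, Pi.smul_apply, smul_eq_mul]
    ring
  · filter_upwards [hg, hg', ae_all_iff.2 fun n => apply_combination (T := T) (h2 n) (h2' n) c]
      with x hx hx' hn
    simp only [Pi.add_apply, Pi.smul_apply, smul_eq_mul]
    exact ((hx.const_mul c).add hx').congr fun n => (hn n).symm

theorem IsExtensionValue.congr_left {f g f' : Plane → ℂ} (h : IsExtensionValue T f g)
    (hf : f =ᵐ[volume] f') : IsExtensionValue T f' g := by
  obtain ⟨hm, u, h1, h2, hu, hg⟩ := h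
  refine ⟨hm.ae_eq hf, u, h1, h2, hu.congr fun n => lintegral_congr_ae ?_, hg⟩
  filter_upwards [hf] with y hy
  rw [hy]

theorem IsExtensionValue.congr_right {f g g' : Plane → ℂ} (h : IsExtensionValue T f g)
    (hg' : g =ᵐ[volume] g') : IsExtensionValue T f g' := by
  obtain ⟨hm, u, h1, h2, hu, hg⟩ := h
  refine ⟨hm, u, h1, h2, hu, ?_⟩
  filter_upwards [hg, hg'] with x hx hx'
  rwa [← hx']

/-- The difference of two values is an extension value of 0, and the weak-type inequality for 0
makes it vanish. Linearity, agreement with `T` and independence of the approximating sequence all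
follow from this. -/
theorem IsWeakType.unique (hW : IsWeakType T B) (hB : B ≠ ∞) {f g g' : Plane → ℂ}
    (h : IsExtensionValue T f g) (h' : IsExtensionValue T f g') : g =ᵐ[volume] g' := by
  have h0 := h.combination h' (-1)
  have : ∀ᵐ x, ((-1 : ℂ) • g + g') x = 0 := by
    refine ae_eq_zero_of_measure_lt_norm fun t ht => ?_
    have := hW.weak_type_of_isExtensionValue hB h0 ht
    simpa using this
  filter_upwards [this] with x hx
  simp only [Pi.add_apply, Pi.smul_apply, smul_eq_mul, neg_one_mul] at hx
  linear_combination -hx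

theorem isExtensionValue_self {f : Plane → ℂ} (h1 : MemLp f 1 volume) (h2 : MemLp f 2 volume) :
    IsExtensionValue T f (T (h2.toLp f)) :=
  ⟨h1, fun _ => f, fun _ => h1, fun _ => h2, by simp, Eventually.of_forall fun _ => tendsto_const_nhds⟩

theorem cauchySeq_of_eventually_dist_le {a : ℕ → ℂ}
    (h : ∀ᶠ n in atTop, ‖a (n + 1) - a n‖ ≤ (1 / 2 : ℝ) ^ n) : ∃ l, Tendsto a atTop (𝓝 l) := by
  obtain ⟨m, hm⟩ := eventually_atTop.1 h
  have : CauchySeq fun n => a (n + m) := by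
    refine cauchySeq_of_le_geometric (1 / 2) ((1 / 2) ^ m) (by norm_num) fun n => ?_
    rw [dist_comm, dist_eq_norm, ← pow_add, show n + 1 + m = n + m + 1 by ring, add_comm m n]
    exact hm _ (Nat.le_add_left _ _)
  obtain ⟨l, hl⟩ := cauchySeq_tendsto_of_complete this
  exact ⟨l, (tendsto_add_atTop_iff_nat m).1 hl⟩

/-- Along a subsequence, `T uₙ` converges almost everywhere if `uₙ` converges in `L¹`. -/
theorem IsWeakType.exists_subseq (hW : IsWeakType T B) (hB : B ≠ ∞) {f : Plane → ℂ}
    (hf : MemLp f 1 volume) {u : ℕ → Plane → ℂ}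
    (h1 : ∀ n, MemLp (u n) 1 volume) (h2 : ∀ n, MemLp (u n) 2 volume)
    (hu : Tendsto (fun n => ∫⁻ y, ‖u n y - f y‖ₑ) atTop (𝓝 0)) :
    ∃ (φ : ℕ → ℕ) (g : Plane → ℂ), StrictMono φ ∧ StronglyMeasurable g ∧
      (∀ᵐ x, Tendsto (fun n => T ((h2 (φ n)).toLp (u (φ n))) x) atTop (𝓝 (g x))) ∧
      IsExtensionValue T f g := by
  -- An L¹ error 4^{-n} against the threshold 2^{-n} leaves exceptional sets of measure O(2^{-n}),
  -- which are summable, so Borel–Cantelli applies.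
  obtain ⟨φ, hφ, hφu⟩ := extraction_forall_of_eventually
    (P := fun n k => ∫⁻ y, ‖u k y - f y‖ₑ ≤ ENNReal.ofReal ((1 / 4 : ℝ) ^ n)) fun n =>
      (hu.eventually (gt_mem_nhds (ENNReal.ofReal_pos.2 (by positivity)))).mono fun k hk => hk.le
  have hd : ∀ n, volume {x | (1 / 2 : ℝ) ^ n <
      ‖T ((h2 (φ (n + 1))).toLp (u (φ (n + 1)))) x - T ((h2 (φ n)).toLp (u (φ n))) x‖} ≤
      2 * B * ENNReal.ofReal ((1 / 2 : ℝ) ^ n) := by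
    intro n
    have hw := hW _ (((h1 (φ n)).const_smul (-1 : ℂ)).add (h1 (φ (n + 1))))
      (((h2 (φ n)).const_smul (-1 : ℂ)).add (h2 (φ (n + 1)))) ((1 / 2 : ℝ) ^ n) (by positivity)
    have hb : ∫⁻ y, ‖((-1 : ℂ) • u (φ n) + u (φ (n + 1))) y‖ₑ ≤
        ENNReal.ofReal (2 * (1 / 4 : ℝ) ^ n) := by
      have := lintegral_enorm_combination_le (u := fun y => u (φ n) y - f y)
        (v := fun y => u (φ (n + 1)) y - f y) ((h1 (φ n)).1.sub hf.1) (-1)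
      refine le_trans (le_of_eq (lintegral_congr fun y => ?_)) (this.trans ?_)
      · congr 1
        simp only [Pi.add_apply, Pi.smul_apply, smul_eq_mul]
        ring
      · rw [two_mul, ENNReal.ofReal_add (by positivity) (by positivity), enorm_neg, enorm_one, one_mul]
        refine add_le_add (hφu n) ((hφu (n + 1)).trans (ENNReal.ofReal_le_ofReal ?_))
        exact pow_le_pow_of_le_one (by norm_num) (by norm_num) (Nat.le_succ n)
    refine (measure_mono_ae ?_).trans (hw.trans ?_)
    · filter_upwards [apply_combination (T := T) (h2 (φ n)) (h2 (φ (n + 1))) (-1)] with x hx hxt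
      change _ < _ at hxt
      change _ < _
      rw [hx, neg_one_mul, neg_add_eq_sub]
      exact hxt
    · rw [ENNReal.div_le_iff_le_mul (Or.inl (ENNReal.ofReal_pos.2 (by positivity)).ne')
        (Or.inl ENNReal.ofReal_ne_top)]
      calc _ ≤ B * ENNReal.ofReal (2 * (1 / 4 : ℝ) ^ n) := by gcongr
        _ = _ := by
          rw [show (1 / 4 : ℝ) = 1 / 2 * (1 / 2) by norm_num, mul_pow,
            ENNReal.ofReal_mul (by norm_num), ENNReal.ofReal_mul (by positivity),
            ENNReal.ofReal_ofNat]
          ring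
  have hBC := ae_eventually_notMem (μ := (volume : Measure Plane)) (s := fun n : ℕ =>
    {x | (1 / 2 : ℝ) ^ n <
      ‖T ((h2 (φ (n + 1))).toLp (u (φ (n + 1)))) x - T ((h2 (φ n)).toLp (u (φ n))) x‖}) (by
    refine ((ENNReal.tsum_le_tsum hd).trans_lt ?_).ne
    rw [ENNReal.tsum_mul_left]
    refine ENNReal.mul_lt_top (ENNReal.mul_lt_top (by simp) hB.lt_top) ?_
    have := tsum_rpow_neg_le one_pos le_rfl
    simp only [Real.rpow_one] at this
    exact this.trans_lt ENNReal.ofReal_lt_top)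
  obtain ⟨g, hgm, hg⟩ := exists_stronglyMeasurable_limit_of_tendsto_ae
    (μ := (volume : Measure Plane)) (f := fun n => T ((h2 (φ n)).toLp (u (φ n))))
    (fun n => Lp.aestronglyMeasurable _) (by
      filter_upwards [hBC] with x hx
      exact cauchySeq_of_eventually_dist_le (hx.mono fun n hn => not_lt.1 hn))
  exact ⟨φ, g, hφ, hgm, hg, hf, fun n => u (φ n), fun n => h1 _, fun n => h2 _,
    hu.comp hφ.tendsto_atTop, hg⟩

theorem IsWeakType.exists_value (hW : IsWeakType T B) (hB : B ≠ ∞) {f : Plane → ℂ}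
    (hf : MemLp f 1 volume) : ∃ g, StronglyMeasurable g ∧ IsExtensionValue T f g := by
  obtain ⟨-, g, -, hgm, -, hg⟩ := hW.exists_subseq hB hf (fun n => memLp_one_trunc n hf)
    (fun n => memLp_two_trunc n hf) (tendsto_lintegral_trunc_sub hf)
  exact ⟨g, hgm, hg⟩

/-- The extension of `T` to `L¹`. -/
theorem IsWeakType.exists_extension (hW : IsWeakType T B) (hB : B ≠ ∞) :
    ∃ T₁ : Lp ℂ 1 (volume : Measure Plane) →ₗ[ℂ] (Plane →ₘ[(volume : Measure Plane)] ℂ),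
      ∀ (f : Plane → ℂ) (hf : MemLp f 1 volume), IsExtensionValue T f (T₁ (hf.toLp f)) := by
  choose G hGm hG using fun F : Lp ℂ 1 (volume : Measure Plane) => hW.exists_value hB (Lp.memLp F)
  have hadd : ∀ (c : ℂ) (F F' : Lp ℂ 1 (volume : Measure Plane)),
      G (c • F + F') =ᵐ[volume] c • G F + G F' := by
    intro c F F'
    refine hW.unique hB (hG _) (((hG F).combination (hG F') c).congr_left ?_)
    filter_upwards [Lp.coeFn_add (c • F) F', Lp.coeFn_smul c F] with x h1 h2
    rw [h1, Pi.add_apply, Pi.add_apply, h2]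
  have h0 : G 0 =ᵐ[volume] 0 := by
    have := hadd 1 0 0
    rw [one_smul, add_zero] at this
    filter_upwards [this] with x hx
    simpa using hx
  refine ⟨{ toFun := fun F => AEEqFun.mk (G F) (hGm F).aestronglyMeasurable
            map_add' := ?_
            map_smul' := ?_ }, ?_⟩
  · intro F F'
    rw [AEEqFun.mk_add_mk, AEEqFun.mk_eq_mk]
    have := hadd 1 F F'
    rwa [one_smul, one_smul] at this
  · intro c F
    rw [RingHom.id_apply]
    refine Eq.trans (AEEqFun.mk_eq_mk.2 ?_)
      (AEEqFun.smul_mk c (G F) (hGm F).aestronglyMeasurable).symm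
    have := hadd c F 0
    rw [add_zero] at this
    filter_upwards [this, h0] with x hx hx0
    rw [hx, Pi.add_apply, hx0, Pi.zero_apply, add_zero]
  · intro f hf
    refine ((hG (hf.toLp f)).congr_left hf.coeFn_toLp).congr_right ?_
    exact (AEEqFun.coeFn_mk _ _).symm

/-- The kernel representation for the extension to `L¹`. -/
theorem IsWeakType.ae_eq_integral (hW : IsWeakType T B) (hB : B ≠ ∞) {K : Plane → Plane → ℂ}
    {θ A : ℝ} (hT : HasKernel T K) (hK : IsRegularKernel θ A K) (hA : 0 ≤ A)
    {f g : Plane → ℂ} (hf : MemLp f 1 volume) (hfg : IsExtensionValue T f g) {F : Set Plane}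
    (hF : IsClosed F) (hfF : ∀ y ∉ F, f y = 0) :
    ∀ᵐ x, x ∉ F → g x = ∫ y, K x y * f y := by
  -- By uniqueness the value may be computed along truncations of `f`. They lie in L² and vanish
  -- where `f` does, so the L² representation and dominated convergence apply.
  obtain ⟨φ, g', hφ, -, hlim, hg'⟩ := hW.exists_subseq hB hf (fun n => memLp_one_trunc n hf)
    (fun n => memLp_two_trunc n hf) (tendsto_lintegral_trunc_sub hf)
  have hrep : ∀ n, ∀ᵐ x, x ∉ F → T ((memLp_two_trunc n hf).toLp _) x = ∫ y, K x y * trunc n f y :=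
    fun n => hT.ae_eq_integral hK hA (memLp_one_trunc n hf) (memLp_two_trunc n hf) hF fun y hy => by
      simp [trunc, hfF y hy]
  filter_upwards [hlim, hW.unique hB hfg hg', ae_all_iff.2 hrep] with x hx hgx hxn hxF
  rw [hgx]
  refine tendsto_nhds_unique hx ?_
  simp_rw [fun n => hxn n hxF]
  obtain ⟨r, hr, hsep⟩ := exists_pos_le_dist hF hxF
  have hmain : Tendsto (fun n => ∫ y, K x y * trunc n f y) atTop (𝓝 (∫ y, K x y * f y)) := by
    refine tendsto_integral_of_dominated_convergence (fun y => A / r ^ 2 * ‖f y‖) (fun n => ?_)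
      ((memLp_one_iff_integrable.1 hf).norm.const_mul _) (fun n => ?_) ?_
    · exact (hK.meas.comp measurable_prodMk_left).aestronglyMeasurable.mul
        (aestronglyMeasurable_trunc n hf.1)
    · refine Eventually.of_forall fun y => ?_
      rw [norm_mul]
      by_cases hy : y ∈ F
      · exact mul_le_mul (hK.norm_le_of_le_dist hA hr (hsep x (mem_closedBall_self hr.le) y hy))
          (norm_trunc_le n f y) (norm_nonneg _) (by positivity)
      · simp [trunc, hfF y hy]
    · refine Eventually.of_forall fun y => tendsto_const_nhds.congr' ?_
      filter_upwards [trunc_eventually_eq f y] with n hn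
      rw [hn]
  exact hmain.comp hφ.tendsto_atTop

end

/-! ### One step of the stopping construction. -/

section

theorem setLIntegral_le_of_rpow {f : Plane → ℂ} (hf : AEStronglyMeasurable f volume) {p : ℝ}
    (hp : 1 < p) {S : Set Plane} {c : ℝ≥0∞} (h : ∫⁻ x in S, ‖f x‖ₑ ^ p ≤ c ^ p * volume S) :
    ∫⁻ x in S, ‖f x‖ₑ ≤ c * volume S := by
  have hq : p.HolderConjugate (p / (p - 1)) := Real.HolderConjugate.conjExponent hp
  set q := p / (p - 1)
  have hp0 := hq.pos
  have hq0 := hq.symm.pos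
  have h1 := ENNReal.lintegral_mul_le_Lp_mul_Lq (volume.restrict S) hq hf.enorm.restrict
    (aemeasurable_const (b := (1 : ℝ≥0∞)))
  simp only [Pi.mul_apply, mul_one, ENNReal.one_rpow, lintegral_const, Measure.restrict_apply_univ,
    one_mul] at h1
  calc _ ≤ _ := h1
    _ ≤ (c ^ p * volume S) ^ (1 / p) * volume S ^ (1 / q) := by gcongr
    _ = c * (volume S ^ (1 / p) * volume S ^ (1 / q)) := by
        rw [ENNReal.mul_rpow_of_nonneg _ _ (by positivity), ← ENNReal.rpow_mul,
          mul_one_div_cancel hp0.ne', ENNReal.rpow_one, mul_assoc]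
    _ = c * volume S := by
        rw [← ENNReal.rpow_add_of_nonneg _ _ (by positivity) (by positivity)]
        have : 1 / p + 1 / q = 1 := by simpa [one_div] using hq.inv_add_inv_eq_one
        rw [this, ENNReal.rpow_one]

theorem pAverage_rpow_mul {f : Plane → ℂ} {p : ℝ} (hp : 1 < p) (S : Cube) :
    pAverage f p S ^ p * volume S.toSet = ∫⁻ x in S.toSet, ‖f x‖ₑ ^ p := by
  rw [pAverage, ← ENNReal.rpow_mul, one_div_mul_cancel (by linarith), ENNReal.rpow_one, mul_comm,
    ← mul_assoc, ENNReal.mul_inv_cancel S.volume_ne_zero S.volume_ne_top, one_mul]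

theorem setLIntegral_le_pAverage {f : Plane → ℂ} (hf : AEStronglyMeasurable f volume) {p : ℝ}
    (hp : 1 < p) (S : Cube) : ∫⁻ x in S.toSet, ‖f x‖ₑ ≤ pAverage f p S * volume S.toSet :=
  setLIntegral_le_of_rpow hf hp (pAverage_rpow_mul hp S).ge

theorem pAverage_ne_top {f : Plane → ℂ} {p : ℝ} (hp : 1 < p)
    (hf : MemLp f (ENNReal.ofReal p) volume) (S : Cube) : pAverage f p S ≠ ∞ := by
  have h0 : ENNReal.ofReal p ≠ 0 := (ENNReal.ofReal_pos.2 (by linarith)).ne'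
  have h := hf.2
  rw [eLpNorm_lt_top_iff_lintegral_rpow_enorm_lt_top h0 ENNReal.ofReal_ne_top,
    ENNReal.toReal_ofReal (by linarith)] at h
  refine ENNReal.rpow_ne_top_of_nonneg (by have : 0 < p := by linarith
                                           positivity) (ENNReal.mul_ne_top
    (ENNReal.inv_ne_top.2 S.volume_ne_zero) ?_)
  exact ((setLIntegral_le_lintegral _ _).trans_lt h).ne

/-- What the sparse domination uses of the extension of `T` to `L¹`. -/
structure IsCZExtension (K : Plane → Plane → ℂ) (B : ℝ)
    (T₁ : Lp ℂ 1 (volume : Measure Plane) →ₗ[ℂ] (Plane →ₘ[(volume : Measure Plane)] ℂ)) : Prop where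
  weak : ∀ (f : Plane → ℂ) (hf : MemLp f 1 volume) (t : ℝ), 0 < t →
    volume {x | t < ‖T₁ (hf.toLp f) x‖} ≤
      ENNReal.ofReal B * (∫⁻ x, ‖f x‖ₑ) / ENNReal.ofReal t
  rep : ∀ (f : Plane → ℂ) (hf : MemLp f 1 volume) (F : Set Plane), IsClosed F →
    (∀ y ∉ F, f y = 0) → ∀ᵐ x, x ∉ F → T₁ (hf.toLp f) x = ∫ y, K x y * f y

theorem IsRegularKernel.enorm_integral_sub_le {θ A : ℝ} {K : Plane → Plane → ℂ}
    (hK : IsRegularKernel θ A K) (hA : 0 ≤ A) (hθ : 0 < θ) (hθ1 : θ ≤ 1) {P : Cube} {x x' : Plane}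
    (hx : x ∈ P.toSet) (hx' : x' ∈ P.toSet) {p : ℝ} (hp : 1 < p) {u : Plane → ℂ}
    (hu : MemLp u 1 volume) (hu0 : ∀ y ∈ P.triple.toSet, u y = 0) {lam : ℝ≥0∞}
    (hl : ∀ r, P.side ≤ r → ∫⁻ y in closedBall P.center r, ‖u y‖ₑ ^ p ≤
      lam * volume (closedBall P.center r)) :
    ‖(∫ y, K x y * u y) - ∫ y, K x' y * u y‖ₑ ≤
      ENNReal.ofReal (2560 * A / θ * (p / (p - 1))) * lam ^ (1 / p) := by
  have hui := memLp_one_iff_integrable.1 hu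
  have hi : ∀ z ∈ P.toSet, Integrable fun y => K z y * u y := by
    intro z hz
    refine (hui.norm.const_mul (A / P.side ^ 2)).mono'
      ((hK.meas.comp measurable_prodMk_left).aestronglyMeasurable.mul hui.1) ?_
    refine Eventually.of_forall fun y => ?_
    rw [norm_mul]
    by_cases hy : y ∈ P.triple.toSet
    · simp [hu0 y hy]
    · exact mul_le_mul_of_nonneg_right
        (hK.norm_le_of_le_dist hA P.side_pos (Cube.side_le_dist hz hy)) (norm_nonneg _)
  rw [← integral_sub (hi x hx) (hi x' hx')]
  simp_rw [← sub_mul]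
  refine (enorm_integral_le_lintegral_enorm _).trans ?_
  refine le_trans (le_of_eq ?_) (hK.hormander hA hθ hθ1 hx hx' hp hu.1.enorm hl)
  rw [← lintegral_indicator P.triple.measurableSet_toSet.compl]
  refine lintegral_congr fun y => ?_
  by_cases hy : y ∈ P.triple.toSet
  · simp [hu0 y hy, hy]
  · rw [Set.indicator_of_mem (show y ∈ P.triple.toSetᶜ from hy), enorm_mul]

variable {T₁ : Lp ℂ 1 (volume : Measure Plane) →ₗ[ℂ] (Plane →ₘ[(volume : Measure Plane)] ℂ)}
  {K : Plane → Plane → ℂ} {θ A B : ℝ}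

/-- `T₁` applied to the restriction of `f` to the tripled cube. -/
noncomputable def localPart
    (T₁ : Lp ℂ 1 (volume : Measure Plane) →ₗ[ℂ] (Plane →ₘ[(volume : Measure Plane)] ℂ))
    {f : Plane → ℂ} (hf : MemLp f 1 volume) (Q : Cube) : Plane →ₘ[(volume : Measure Plane)] ℂ :=
  T₁ ((hf.indicator Q.triple.measurableSet_toSet).toLp (Q.triple.toSet.indicator f))

/-- By linearity the difference is `T₁` applied to `f` on 3Q∖3P. This function vanishes on an open
ball containing `P`, so the kernel represents it there. -/
theorem localPart_sub_ae_eq (hT : IsCZExtension K B T₁) {f : Plane → ℂ} (hf : MemLp f 1 volume)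
    {P Q : Cube} (hPQ : P.toSet ⊆ Q.toSet) :
    ∀ᵐ x, x ∈ P.toSet → localPart T₁ hf Q x - localPart T₁ hf P x =
      ∫ y, K x y * (Q.triple.toSet \ P.triple.toSet).indicator f y := by
  have h3 := Cube.triple_subset_triple hPQ (Cube.side_le_of_subset hPQ)
  have hm := hf.indicator (Q.triple.measurableSet_toSet.diff P.triple.measurableSet_toSet)
  have hsub : (hf.indicator Q.triple.measurableSet_toSet).toLp (Q.triple.toSet.indicator f) -
      (hf.indicator P.triple.measurableSet_toSet).toLp (P.triple.toSet.indicator f) =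
      hm.toLp _ := by
    rw [← MemLp.toLp_sub]
    refine MemLp.toLp_congr _ _ (Eventually.of_forall fun y => ?_)
    by_cases hP : y ∈ P.triple.toSet
    · simp [hP, h3 hP]
    · by_cases hQ : y ∈ Q.triple.toSet <;> simp [hP, hQ]
  have hrep := hT.rep _ hm (ball P.center (3 * P.side / 2))ᶜ isOpen_ball.isClosed_compl (by
    intro y hy
    rw [Set.notMem_compl_iff] at hy
    have := P.triple.ball_subset_toSet
    rw [Cube.center_triple, Cube.side_triple] at this
    exact Set.indicator_of_notMem (fun h => h.2 (this hy)) _)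
  rw [← hsub, map_sub] at hrep
  filter_upwards [hrep, AEEqFun.coeFn_sub (localPart T₁ hf Q) (localPart T₁ hf P)] with x hx hx' hxP
  rw [← Pi.sub_apply, ← hx']
  refine hx ?_
  rw [Set.notMem_compl_iff, mem_ball]
  linarith [Cube.dist_center_le hxP, P.side_pos]

/-- The constant in the sparse domination. -/
noncomputable def sparseConst (θ A B : ℝ) : ℝ := 518976 * B + 36864000 * A / θ

/-- One step of the stopping construction. -/
theorem IsCZExtension.exists_children (hT : IsCZExtension K B T₁) (hB : 0 < B)
    (hK : IsRegularKernel θ A K) (hA : 0 ≤ A) (hθ : 0 < θ) (hθ1 : θ ≤ 1)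
    {f : Plane → ℂ} (hf : MemLp f 1 volume) {p : ℝ} (hp : 1 < p)
    (hfp : MemLp f (ENNReal.ofReal p) volume) (Q : Cube) :
    ∃ 𝒟 : Set Cube, 𝒟.Countable ∧ 𝒟.PairwiseDisjoint Cube.toSet ∧ (∀ P ∈ 𝒟, P.toSet ⊆ Q.toSet) ∧
      2 * volume (⋃ P ∈ 𝒟, P.toSet) ≤ volume Q.toSet ∧
      ∀ᵐ x, x ∈ Q.toSet →
        (x ∉ ⋃ P ∈ 𝒟, P.toSet → ‖localPart T₁ hf Q x‖ₑ ≤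
          ENNReal.ofReal (sparseConst θ A B * (p / (p - 1))) * pAverage f p Q.triple) ∧
        (∀ P ∈ 𝒟, x ∈ P.toSet → ‖localPart T₁ hf Q x‖ₑ ≤
          ENNReal.ofReal (sparseConst θ A B * (p / (p - 1))) * pAverage f p Q.triple +
            ‖localPart T₁ hf P x‖ₑ) := by
  have hp' : 1 ≤ p / (p - 1) := by rw [one_le_div₀ (by linarith)]; linarith
  have hp0 : 0 < p := by linarith
  set a := pAverage f p Q.triple with ha
  set v := volume Q.toSet with hv
  have hat : a ≠ ∞ := pAverage_ne_top hp hfp _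
  have hv0 : v ≠ 0 := Q.volume_ne_zero
  have hvt : v ≠ ∞ := Q.volume_ne_top
  have hIQ : ∫⁻ x, ‖Q.triple.toSet.indicator f x‖ₑ ≤ 9 * a * v := by
    simp_rw [enorm_indicator_eq_indicator_enorm]
    rw [lintegral_indicator Q.triple.measurableSet_toSet]
    refine (setLIntegral_le_pAverage hf.1 hp Q.triple).trans_eq ?_
    rw [Cube.volume_triple]; ring
  -- If the average is 0, then `f` vanishes almost everywhere on 3Q and no children are needed.
  rcases eq_or_ne a 0 with ha0 | ha0
  · refine ⟨∅, Set.countable_empty, Set.pairwiseDisjoint_empty, by simp, by simp, ?_⟩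
    have hz : ∀ᵐ x, localPart T₁ hf Q x = 0 := by
      refine ae_eq_zero_of_measure_lt_norm fun t ht => ?_
      have := hT.weak _ (hf.indicator Q.triple.measurableSet_toSet) t ht
      rw [ha0, mul_zero, zero_mul, nonpos_iff_eq_zero] at hIQ
      rw [hIQ, mul_zero, ENNReal.zero_div, nonpos_iff_eq_zero] at this
      exact this
    filter_upwards [hz] with x hx _
    simp [hx]
  have har : 0 < a.toReal := ENNReal.toReal_pos ha0 hat
  have hae : ENNReal.ofReal a.toReal = a := ENNReal.ofReal_toReal hat
  have hB0 : ENNReal.ofReal B ≠ 0 := (ENNReal.ofReal_pos.2 hB).ne'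
  -- Here `m` is a bound for ∫_{3S}|f| in units of a|S|, and 1/`c` is the proportion of |S| that the
  -- exceptional set may occupy.
  have hweak : ∀ (S : Cube) (c m : ℝ), 0 < c → 0 < m →
      ∫⁻ x, ‖S.triple.toSet.indicator f x‖ₑ ≤ ENNReal.ofReal m * a * volume S.toSet →
      ENNReal.ofReal c * volume {x | c * m * B * a.toReal < ‖localPart T₁ hf S x‖} ≤
        volume S.toSet := by
    intro S c m hc hm hS
    have := hT.weak _ (hf.indicator S.triple.measurableSet_toSet) (c * m * B * a.toReal)
      (by positivity)
    have hcm : ENNReal.ofReal c * ENNReal.ofReal m * ENNReal.ofReal B * a =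
        ENNReal.ofReal (c * m * B * a.toReal) := by
      rw [ENNReal.ofReal_mul (by positivity), ENNReal.ofReal_mul (by positivity),
        ENNReal.ofReal_mul (by positivity), hae]
    rw [ENNReal.le_div_iff_mul_le (Or.inl (ENNReal.ofReal_pos.2 (by positivity)).ne')
      (Or.inl ENNReal.ofReal_ne_top), ← hcm] at this
    have h2 := this.trans (mul_le_mul_right hS _)
    have hne : ENNReal.ofReal m * ENNReal.ofReal B * a ≠ 0 :=
      mul_ne_zero (mul_ne_zero (ENNReal.ofReal_pos.2 hm).ne' hB0) ha0
    have hnt : ENNReal.ofReal m * ENNReal.ofReal B * a ≠ ∞ :=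
      ENNReal.mul_ne_top (ENNReal.mul_ne_top ENNReal.ofReal_ne_top ENNReal.ofReal_ne_top) hat
    refine (ENNReal.mul_le_mul_iff_right hne hnt).1 ?_
    refine le_trans (le_of_eq ?_) (h2.trans (le_of_eq ?_))
    · rw [localPart]; ring
    · ring
  set t₁ := 64 * 9 * B * a.toReal with ht₁
  set E₁ : Set Plane := {x | t₁ < ‖localPart T₁ hf Q x‖} with hE₁
  have hE₁v : 64 * volume E₁ ≤ v := by
    have := hweak Q 64 9 (by norm_num) (by norm_num) (by simpa using hIQ)
    simpa using this
  set w : Plane → ℝ≥0∞ := fun y => ‖Q.triple.toSet.indicator f y‖ₑ ^ p with hw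
  have hwint : ∫⁻ y, w y = 9 * a ^ p * v := by
    have : w = Q.triple.toSet.indicator fun y => ‖f y‖ₑ ^ p := by
      ext y
      by_cases hy : y ∈ Q.triple.toSet
      · simp [hw, hy]
      · simp [hw, hy, hp0]
    rw [this, lintegral_indicator Q.triple.measurableSet_toSet, ← pAverage_rpow_mul hp,
      Cube.volume_triple]
    ring
  have hap0 : a ^ p ≠ 0 := (ENNReal.rpow_pos (pos_iff_ne_zero.2 ha0) hat).ne'
  have hapt : a ^ p ≠ ∞ := ENNReal.rpow_ne_top_of_nonneg hp0.le hat
  -- The height is chosen with 14400 = 64 · 25 · 9: the maximal theorem costs 25, |3Q| = 9|Q| costs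
  -- 9, and |O| ≤ |Q|/64 remains.
  obtain ⟨O, hOm, hOv, hO⟩ := exists_maximal_set w
    (by rw [hwint]; exact ENNReal.mul_ne_top (ENNReal.mul_ne_top (by simp) hapt) hvt)
    (lam := 14400 * a ^ p) (mul_ne_zero (by simp) hap0) (ENNReal.mul_ne_top (by simp) hapt)
  have hOv' : 64 * volume O ≤ v := by
    have hne : 225 * a ^ p ≠ 0 := mul_ne_zero (by simp) hap0
    refine (ENNReal.mul_le_mul_iff_right hne (ENNReal.mul_ne_top (by simp) hapt)).1 ?_
    rw [hwint] at hOv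
    refine le_trans (le_of_eq ?_) (hOv.trans (le_of_eq ?_))
    · rw [show (14400 : ℝ≥0∞) = 225 * 64 by norm_num]; ring
    · rw [show (225 : ℝ≥0∞) = 25 * 9 by norm_num]; ring
  set E : Set Plane := Q.toSet ∩ (E₁ ∪ O) with hE
  have hE₁m : MeasurableSet E₁ :=
    measurableSet_lt measurable_const (AEEqFun.stronglyMeasurable _).norm.measurable
  have hEm : MeasurableSet E := Q.measurableSet_toSet.inter (hE₁m.union hOm)
  have hEv : 32 * volume E ≤ v := by
    refine (ENNReal.mul_le_mul_iff_right (a := 2) (by simp) (by simp)).1 ?_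
    calc 2 * (32 * volume E) ≤ 2 * (32 * (volume E₁ + volume O)) := by
          gcongr
          exact (measure_mono Set.inter_subset_right).trans (measure_union_le _ _)
      _ = 64 * volume E₁ + 64 * volume O := by
          rw [show (64 : ℝ≥0∞) = 2 * 32 by norm_num]; ring
      _ ≤ v + v := add_le_add hE₁v hOv'
      _ = 2 * v := (two_mul v).symm
  have hEint : ∫⁻ x, E.indicator 1 x = volume E := by
    rw [lintegral_indicator_one hEm]
  have hEt : volume E ≠ ∞ := ((measure_mono Set.inter_subset_left).trans_lt hvt.lt_top).ne
  -- At height 1/8 each stopping cube has between 1/8 and 4/8 of its measure in `E`. The lower bound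
  -- makes the cubes small in total, since 8|E| ≤ |Q|/4; the upper bound leaves good points in every
  -- cube.
  obtain ⟨𝒟, hcount, hdisj, hlow, hup, hout, hgrid⟩ := exists_stopping_cubes Q.corner Q.side Q.side_pos
    (E.indicator 1) ((measurable_const.indicator hEm).aemeasurable) (by rw [hEint]; exact hEt)
    (lam := 8⁻¹) (by
      rw [hEint, ← Cube.volume_toSet, mul_comm, ← div_eq_mul_inv,
        ENNReal.le_div_iff_mul_le (by simp) (by simp), mul_comm]
      refine le_trans ?_ hEv
      gcongr
      norm_num)
  have hPE : ∀ P : Cube, ∫⁻ x in P.toSet, E.indicator 1 x = volume (E ∩ P.toSet) := by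
    intro P
    rw [lintegral_indicator_one hEm, Measure.restrict_apply hEm]
  -- A selected cube meets `E`, which lies in `Q`; hence its top cube in the grid is `Q` itself.
  have hPQ : ∀ P ∈ 𝒟, P.toSet ⊆ Q.toSet := by
    intro P hP
    have h0 : volume (E ∩ P.toSet) ≠ 0 := by
      intro h0
      have := hlow P hP
      rw [hPE, h0, nonpos_iff_eq_zero] at this
      exact mul_ne_zero (by simp) P.volume_ne_zero this
    obtain ⟨z, hzE, hzP⟩ := nonempty_of_measure_ne_zero h0
    obtain ⟨x, hx⟩ := hgrid P hP
    have hz := hx hzP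
    rwa [← gridCube_eq hz, gridCube_zero Q hzE.1] at hx
  have hsum : 2 * volume (⋃ P ∈ 𝒟, P.toSet) ≤ v := by
    have hc := hcount.to_subtype
    refine (ENNReal.mul_le_mul_iff_right (a := 8⁻¹) (by simp) (by simp)).1 ?_
    calc 8⁻¹ * (2 * volume (⋃ P ∈ 𝒟, P.toSet)) = 2 * (8⁻¹ * volume (⋃ P ∈ 𝒟, P.toSet)) := by ring
      _ ≤ 2 * (8⁻¹ * ∑' P : 𝒟, volume (P : Cube).toSet) := by
          gcongr; exact measure_biUnion_le _ hcount _
      _ ≤ 2 * ∑' P : 𝒟, volume (E ∩ (P : Cube).toSet) := by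
          rw [← ENNReal.tsum_mul_left]
          gcongr with P
          exact (hlow P P.2).trans_eq (hPE _)
      _ ≤ 2 * volume E := by
          gcongr
          rw [← measure_iUnion (fun P P' hne => (hdisj P.2 P'.2 fun h => hne (Subtype.ext h)).mono
            Set.inter_subset_right Set.inter_subset_right)
            fun P : 𝒟 => hEm.inter (P : Cube).measurableSet_toSet]
          exact measure_mono (Set.iUnion_subset fun P => Set.inter_subset_left)
      _ ≤ 8⁻¹ * v := by
          refine le_trans ?_ (mul_le_mul_right hEv _)
          rw [← mul_assoc, show (32 : ℝ≥0∞) = 8 * 4 by norm_num, ← mul_assoc,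
            ENNReal.inv_mul_cancel (by simp) (by simp), one_mul]
          gcongr
          norm_num
  have hCB : t₁ ≤ sparseConst θ A B * (p / (p - 1)) * a.toReal := by
    have : 64 * 9 * B ≤ sparseConst θ A B * (p / (p - 1)) := by
      have h1 : 64 * 9 * B ≤ sparseConst θ A B := by
        rw [sparseConst]
        have : 0 ≤ 36864000 * A / θ := by positivity
        linarith
      exact h1.trans (le_mul_of_one_le_right (by linarith) hp')
    exact mul_le_mul_of_nonneg_right this har.le
  have hCnn : 0 ≤ sparseConst θ A B * (p / (p - 1)) := by
    have : 0 ≤ sparseConst θ A B := by rw [sparseConst]; positivity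
    positivity
  have hCa : ENNReal.ofReal (sparseConst θ A B * (p / (p - 1))) * a =
      ENNReal.ofReal (sparseConst θ A B * (p / (p - 1)) * a.toReal) := by
    rw [ENNReal.ofReal_mul hCnn, hae]
  refine ⟨𝒟, hcount, hdisj, hPQ, hsum, ?_⟩
  have hstep : ∀ P ∈ 𝒟, ∀ᵐ x, x ∈ P.toSet → ‖localPart T₁ hf Q x‖ₑ ≤
      ENNReal.ofReal (sparseConst θ A B * (p / (p - 1))) * a + ‖localPart T₁ hf P x‖ₑ := by
    intro P hP
    have hP3 := Cube.triple_subset_triple (hPQ P hP) (Cube.side_le_of_subset (hPQ P hP))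
    have hPv := P.volume_pos
    have hhalf : 2 * volume (E ∩ P.toSet) ≤ volume P.toSet := by
      have := hup P hP
      rw [hPE] at this
      refine (mul_le_mul_right this 2).trans_eq ?_
      rw [← mul_assoc, ← mul_assoc, show (2 : ℝ≥0∞) * 4 = 8 by norm_num,
        ENNReal.mul_inv_cancel (by simp) (by simp), one_mul]
    -- One point of `P` outside `O` controls the average of |f 1_{3Q}|^p over every square that
    -- contains it, in particular over all those centred at the centre of `P` with radius at least
    -- half its side.
    obtain ⟨x₀, hx₀P, hx₀E⟩ : ∃ x₀ ∈ P.toSet, x₀ ∉ E := by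
      by_contra! hcon
      rw [Set.inter_eq_right.2 hcon, two_mul] at hhalf
      exact absurd hhalf (not_le.2 (ENNReal.lt_add_right P.volume_ne_top P.volume_ne_zero))
    have hx₀O : x₀ ∉ O := fun h => hx₀E ⟨hPQ P hP hx₀P, Or.inr h⟩
    have hball : ∀ r, P.side / 2 ≤ r → ∫⁻ y in closedBall P.center r, w y ≤
        14400 * a ^ p * volume (closedBall P.center r) := fun r hr =>
      hO x₀ hx₀O P.center r (by linarith [P.side_pos])
        (mem_closedBall.2 ((Cube.dist_center_le hx₀P).trans hr))
    -- Moving the constant inside the power keeps the final bound uniform in p after the p-th root.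
    have hκ : (14400 : ℝ≥0∞) * a ^ p ≤ (14400 * a) ^ p := by
      rw [ENNReal.mul_rpow_of_nonneg _ _ hp0.le]
      gcongr
      calc (14400 : ℝ≥0∞) = 14400 ^ (1 : ℝ) := (ENNReal.rpow_one _).symm
        _ ≤ _ := ENNReal.rpow_le_rpow_of_exponent_le (by norm_num) hp.le
    have hI3P : ∫⁻ x, ‖P.triple.toSet.indicator f x‖ₑ ≤
        ENNReal.ofReal (9 * 14400) * a * volume P.toSet := by
      simp_rw [enorm_indicator_eq_indicator_enorm]
      rw [lintegral_indicator P.triple.measurableSet_toSet]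
      refine (setLIntegral_le_of_rpow hf.1 hp (c := 14400 * a) ?_).trans_eq ?_
      · refine le_trans ?_ (mul_le_mul_left hκ _)
        have hb := hball (3 * P.side / 2) (by linarith [P.side_pos])
        have hae3 := P.triple.toSet_ae_eq
        rw [Cube.center_triple, Cube.side_triple] at hae3
        rw [← measure_congr hae3, ← setLIntegral_congr hae3] at hb
        refine le_trans (le_of_eq ?_) hb
        refine setLIntegral_congr_fun P.triple.measurableSet_toSet fun y hy => ?_
        simp only [hw, Set.indicator_of_mem (hP3 hy)]
      · rw [Cube.volume_triple, ENNReal.ofReal_mul (by norm_num), ENNReal.ofReal_ofNat,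
          ENNReal.ofReal_ofNat]
        ring
    set t₂ := 4 * (9 * 14400) * B * a.toReal with ht₂
    set E₂ : Set Plane := {x | t₂ < ‖localPart T₁ hf P x‖} with hE₂
    have hE₂v : 4 * volume E₂ ≤ volume P.toSet := by
      have := hweak P 4 (9 * 14400) (by norm_num) (by norm_num) hI3P
      simpa using this
    have hsubae := localPart_sub_ae_eq hT hf (hPQ P hP)
    -- At most 1/2 of `P` lies in `E` and at most 1/4 of it in `E₂`, so almost 1/4 or more of `P` is
    -- available for a reference point at which both local parts are O(a).
    obtain ⟨x', hx'P, hx'E, hx'E₂, hx'rep⟩ : ∃ x' ∈ P.toSet, x' ∉ E ∧ x' ∉ E₂ ∧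
        localPart T₁ hf Q x' - localPart T₁ hf P x' =
          ∫ y, K x' y * (Q.triple.toSet \ P.triple.toSet).indicator f y := by
      by_contra! hcon
      have hle : volume P.toSet ≤ volume (E ∩ P.toSet) + volume E₂ := by
        refine (measure_mono_ae ?_).trans (measure_union_le _ _)
        filter_upwards [hsubae] with x hx hxP
        by_contra hnot
        have hnot' : x ∉ (E ∩ P.toSet) ∪ E₂ := hnot
        rw [Set.mem_union, not_or] at hnot'
        exact hcon x hxP (fun h => hnot'.1 ⟨h, hxP⟩) hnot'.2 (hx hxP)
      have : 4 * volume P.toSet ≤ 3 * volume P.toSet := by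
        calc 4 * volume P.toSet ≤ 4 * (volume (E ∩ P.toSet) + volume E₂) := by gcongr
          _ = 2 * (2 * volume (E ∩ P.toSet)) + 4 * volume E₂ := by
              rw [show (4 : ℝ≥0∞) = 2 * 2 by norm_num]; ring
          _ ≤ 2 * volume P.toSet + volume P.toSet := by gcongr
          _ = _ := by rw [show (3 : ℝ≥0∞) = 2 + 1 by norm_num]; ring
      rw [mul_comm, mul_comm 3, ENNReal.mul_le_mul_iff_right P.volume_ne_zero P.volume_ne_top] at this
      exact absurd this (by norm_num)
    filter_upwards [hsubae] with x hxrep hxP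
    set u := (Q.triple.toSet \ P.triple.toSet).indicator f with hu
    have hosc := hK.enorm_integral_sub_le hA hθ hθ1 hxP hx'P hp (u := u)
      (hf.indicator (Q.triple.measurableSet_toSet.diff P.triple.measurableSet_toSet))
      (fun y hy => Set.indicator_of_notMem (fun h => h.2 hy) _) (lam := (14400 * a) ^ p) (by
        intro r hr
        refine le_trans ?_ ((hball r (by linarith [P.side_pos])).trans (mul_le_mul_left hκ _))
        refine lintegral_mono fun y => ENNReal.rpow_le_rpow ?_ hp0.le
        rw [hu, enorm_indicator_eq_indicator_enorm, enorm_indicator_eq_indicator_enorm]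
        exact Set.indicator_le_indicator_of_subset Set.sdiff_subset (fun _ => zero_le) y)
    rw [← hxrep hxP, ← hx'rep, ← ENNReal.rpow_mul, mul_one_div_cancel hp0.ne', ENNReal.rpow_one] at hosc
    have hosc' : ‖(localPart T₁ hf Q x - localPart T₁ hf P x) -
        (localPart T₁ hf Q x' - localPart T₁ hf P x')‖ ≤
        2560 * A / θ * (p / (p - 1)) * (14400 * a.toReal) := by
      rw [← hae, ← ENNReal.ofReal_ofNat 14400, ← ENNReal.ofReal_mul (by norm_num),
        ← ENNReal.ofReal_mul (by positivity), ← ofReal_norm,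
        ENNReal.ofReal_le_ofReal_iff (by positivity)] at hosc
      exact hosc
    have hx'1 : ‖localPart T₁ hf Q x'‖ ≤ t₁ := by
      by_contra! h
      exact hx'E ⟨hPQ P hP hx'P, Or.inl h⟩
    have hx'2 : ‖localPart T₁ hf P x'‖ ≤ t₂ := by
      by_contra! h
      exact hx'E₂ h
    rw [hCa, ← ofReal_norm, ← ofReal_norm, ← ENNReal.ofReal_add (by positivity) (norm_nonneg _)]
    refine ENNReal.ofReal_le_ofReal ?_
    -- The four terms are the oscillation, bounded by the Hörmander condition, the two values at the
    -- reference point, bounded by `t₁` and `t₂`, and the local part of `P`, which is left to the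
    -- recursion.
    have hnorm : ‖localPart T₁ hf Q x‖ ≤
        ‖(localPart T₁ hf Q x - localPart T₁ hf P x) -
          (localPart T₁ hf Q x' - localPart T₁ hf P x')‖ + ‖localPart T₁ hf Q x'‖ +
          ‖localPart T₁ hf P x'‖ + ‖localPart T₁ hf P x‖ := by
      have e : localPart T₁ hf Q x = ((localPart T₁ hf Q x - localPart T₁ hf P x) -
          (localPart T₁ hf Q x' - localPart T₁ hf P x')) + localPart T₁ hf Q x' -
          localPart T₁ hf P x' + localPart T₁ hf P x := by ring
      calc _ = ‖_‖ := congrArg _ e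
        _ ≤ _ := (norm_add_le _ _).trans (add_le_add ((norm_sub_le _ _).trans
          (add_le_add (norm_add_le _ _) le_rfl)) le_rfl)
    have hfin : 2560 * A / θ * (p / (p - 1)) * (14400 * a.toReal) + t₁ + t₂ ≤
        sparseConst θ A B * (p / (p - 1)) * a.toReal := by
      have h1 : t₁ + t₂ = 518976 * B * a.toReal := by rw [ht₁, ht₂]; ring
      have h2 : 518976 * B * a.toReal ≤ 518976 * B * (p / (p - 1)) * a.toReal := by
        refine (le_mul_of_one_le_right (by positivity) hp').trans_eq ?_
        ring
      rw [add_assoc, h1, sparseConst]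
      refine (add_le_add le_rfl h2).trans_eq ?_
      ring
    linarith
  have hall := (ae_ball_iff hcount).2 hstep
  filter_upwards [hall, hout] with x hx hxout hxQ
  refine ⟨fun hxU => ?_, hx⟩
  -- Off the stopping cubes the indicator of `E` is at most 1/8, hence 0.
  have hxE : x ∉ E := by
    intro h
    have := hxout hxU
    rw [Set.indicator_of_mem h, Pi.one_apply] at this
    norm_num at this
  have hxn : ‖localPart T₁ hf Q x‖ ≤ t₁ := by
    by_contra! h
    exact hxE ⟨hxQ, Or.inl h⟩
  rw [hCa, ← ofReal_norm]
  exact ENNReal.ofReal_le_ofReal (hxn.trans hCB)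

end

/-! ### The tree of stopping cubes and the sparse domination. -/

section

section Tree

variable {ch : Cube → Set Cube}

/-- All cubes obtained from `Q` by repeatedly passing to children. -/
def descendants (ch : Cube → Set Cube) (Q : Cube) : Set Cube :=
  {S | Relation.ReflTransGen (fun P S => S ∈ ch P) Q S}

theorem self_mem_descendants (Q : Cube) : Q ∈ descendants ch Q := Relation.ReflTransGen.refl

theorem descendants_subset_of_mem {P Q : Cube} (h : P ∈ ch Q) :
    descendants ch P ⊆ descendants ch Q := fun _ hS => Relation.ReflTransGen.head h hS

theorem mem_descendants_iff {Q S : Cube} :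
    S ∈ descendants ch Q ↔ S = Q ∨ ∃ P ∈ ch Q, S ∈ descendants ch P := by
  constructor
  · intro h
    rcases Relation.ReflTransGen.cases_head h with h | ⟨P, hP, hS⟩
    · exact Or.inl h.symm
    · exact Or.inr ⟨P, hP, hS⟩
  · rintro (rfl | ⟨P, hP, hS⟩)
    · exact self_mem_descendants _
    · exact descendants_subset_of_mem hP hS

theorem toSet_subset_of_mem_descendants (hsub : ∀ Q, ∀ P ∈ ch Q, P.toSet ⊆ Q.toSet) {Q S : Cube}
    (h : S ∈ descendants ch Q) : S.toSet ⊆ Q.toSet := by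
  induction h with
  | refl => exact subset_rfl
  | tail _ h ih => exact (hsub _ _ h).trans ih

theorem countable_descendants (hc : ∀ Q, (ch Q).Countable) (Q : Cube) :
    (descendants ch Q).Countable := by
  let gen : ℕ → Set Cube := fun n => Nat.rec {Q} (fun _ s => ⋃ P ∈ s, ch P) n
  have hgen : ∀ n, (gen n).Countable := by
    intro n
    induction n with
    | zero => exact Set.countable_singleton Q
    | succ n ih => exact ih.biUnion fun P _ => hc P
  refine (Set.countable_iUnion hgen).mono fun S hS => ?_
  induction hS with
  | refl => exact Set.mem_iUnion.2 ⟨0, rfl⟩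
  | tail _ h ih =>
    obtain ⟨n, hn⟩ := Set.mem_iUnion.1 ih
    exact Set.mem_iUnion.2 ⟨n + 1, Set.mem_iUnion₂.2 ⟨_, hn, h⟩⟩

/-- Following the two branches down from the root, either one of the cubes is reached on the way to
the other, or the branches separate into disjoint children. -/
theorem disjoint_or_mem_descendants (hsub : ∀ Q, ∀ P ∈ ch Q, P.toSet ⊆ Q.toSet)
    (hdisj : ∀ Q, (ch Q).PairwiseDisjoint Cube.toSet) {Q S S' : Cube}
    (hS : S ∈ descendants ch Q) (hS' : S' ∈ descendants ch Q) :
    Disjoint S.toSet S'.toSet ∨ S' ∈ descendants ch S ∨ S ∈ descendants ch S' := by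
  induction hS using Relation.ReflTransGen.head_induction_on with
  | refl => exact Or.inr (Or.inl hS')
  | @head R P hP hPS ih =>
    rcases mem_descendants_iff.1 hS' with rfl | ⟨P', hP', hPS'⟩
    · exact Or.inr (Or.inr (Relation.ReflTransGen.head hP hPS))
    · by_cases hPP : P = P'
      · exact ih (hPP ▸ hPS')
      · exact Or.inl ((hdisj R hP hP' hPP).mono (toSet_subset_of_mem_descendants hsub hPS)
          (toSet_subset_of_mem_descendants hsub hPS'))

/-- The tree has no cycles, since a cycle would place `Q` inside a union of at most half its
measure. -/
theorem ne_of_mem_children (hsub : ∀ Q, ∀ P ∈ ch Q, P.toSet ⊆ Q.toSet)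
    (hhalf : ∀ Q, 2 * volume (⋃ P ∈ ch Q, P.toSet) ≤ volume Q.toSet) {P Q : Cube} (hP : P ∈ ch Q) :
    Q ∉ descendants ch P := by
  intro h
  have h1 : volume Q.toSet ≤ volume (⋃ P ∈ ch Q, P.toSet) :=
    measure_mono ((toSet_subset_of_mem_descendants hsub h).trans
      (Set.subset_biUnion_of_mem (u := Cube.toSet) hP))
  have h2 := (mul_le_mul_right h1 2).trans (hhalf Q)
  rw [two_mul] at h2
  exact absurd h2 (not_le.2 (ENNReal.lt_add_right Q.volume_ne_top Q.volume_ne_zero))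

theorem pairwiseDisjoint_sdiff_children (hsub : ∀ Q, ∀ P ∈ ch Q, P.toSet ⊆ Q.toSet)
    (hdisj : ∀ Q, (ch Q).PairwiseDisjoint Cube.toSet) (Q : Cube) :
    (descendants ch Q).PairwiseDisjoint fun S => S.toSet \ ⋃ P ∈ ch S, P.toSet := by
  have key : ∀ S S' : Cube, S ≠ S' → S' ∈ descendants ch S →
      Disjoint (S.toSet \ ⋃ P ∈ ch S, P.toSet) (S'.toSet \ ⋃ P ∈ ch S', P.toSet) := by
    intro S S' hne h
    rcases mem_descendants_iff.1 h with rfl | ⟨P, hP, hPS⟩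
    · exact absurd rfl hne
    · refine Set.disjoint_left.2 fun z hz hz' => hz.2 ?_
      exact Set.mem_iUnion₂.2 ⟨P, hP, toSet_subset_of_mem_descendants hsub hPS hz'.1⟩
  intro S hS S' hS' hne
  rcases disjoint_or_mem_descendants hsub hdisj hS hS' with h | h | h
  · exact h.mono Set.sdiff_subset Set.sdiff_subset
  · exact key S S' hne h
  · exact (key S' S hne.symm h).symm

theorem volume_le_two_mul_sdiff (hc : ∀ Q, (ch Q).Countable)
    (hhalf : ∀ Q, 2 * volume (⋃ P ∈ ch Q, P.toSet) ≤ volume Q.toSet) (S : Cube) :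
    volume S.toSet ≤ 2 * volume (S.toSet \ ⋃ P ∈ ch S, P.toSet) := by
  have hm : MeasurableSet (⋃ P ∈ ch S, P.toSet) :=
    MeasurableSet.biUnion (hc S) fun P _ => P.measurableSet_toSet
  have h1 : volume S.toSet ≤ volume (S.toSet \ ⋃ P ∈ ch S, P.toSet) +
      volume (⋃ P ∈ ch S, P.toSet) := by
    refine (measure_mono fun x hx => ?_).trans (measure_union_le _ _)
    by_cases h : x ∈ ⋃ P ∈ ch S, P.toSet
    · exact Or.inr h
    · exact Or.inl ⟨hx, h⟩
  refine (ENNReal.add_le_add_iff_right S.volume_ne_top).1 ?_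
  calc volume S.toSet + volume S.toSet ≤ 2 * (volume (S.toSet \ ⋃ P ∈ ch S, P.toSet) +
        volume (⋃ P ∈ ch S, P.toSet)) := by rw [← two_mul]; gcongr
    _ = 2 * volume (S.toSet \ ⋃ P ∈ ch S, P.toSet) + 2 * volume (⋃ P ∈ ch S, P.toSet) := mul_add _ _ _
    _ ≤ _ := by gcongr; exact hhalf S

/-- Iterating a local estimate over the tree of stopping cubes. -/
theorem ae_le_tsum_descendants (hc : ∀ Q, (ch Q).Countable)
    (hsub : ∀ Q, ∀ P ∈ ch Q, P.toSet ⊆ Q.toSet)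
    (hdisj : ∀ Q, (ch Q).PairwiseDisjoint Cube.toSet)
    (hhalf : ∀ Q, 2 * volume (⋃ P ∈ ch Q, P.toSet) ≤ volume Q.toSet)
    {F : Cube → Plane → ℝ≥0∞} {a : Cube → ℝ≥0∞}
    (h : ∀ Q, ∀ᵐ x, x ∈ Q.toSet → (x ∉ ⋃ P ∈ ch Q, P.toSet → F Q x ≤ a Q) ∧
      ∀ P ∈ ch Q, x ∈ P.toSet → F Q x ≤ a Q + F P x) (Q : Cube) :
    ∀ᵐ x, x ∈ Q.toSet →
      F Q x ≤ ∑' S : descendants ch Q, (S : Cube).toSet.indicator (fun _ => a S) x := by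
  have hcount := countable_descendants hc Q
  have := hcount.to_subtype
  -- Each cube has at most twice the measure of what its children leave over. These remainders are
  -- disjoint subsets of `Q`, so the measures add up to at most 2|Q|.
  have hfin : ∑' S : descendants ch Q, volume (S : Cube).toSet ≠ ∞ := by
    have h1 : ∑' S : descendants ch Q, volume (S : Cube).toSet ≤ 2 * volume Q.toSet := by
      calc _ ≤ ∑' S : descendants ch Q,
            2 * volume ((S : Cube).toSet \ ⋃ P ∈ ch S, P.toSet) :=
            ENNReal.tsum_le_tsum fun S => volume_le_two_mul_sdiff hc hhalf S
        _ = 2 * volume (⋃ S : descendants ch Q, (S : Cube).toSet \ ⋃ P ∈ ch S, P.toSet) := by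
            rw [ENNReal.tsum_mul_left, measure_iUnion]
            · exact fun S S' hne => pairwiseDisjoint_sdiff_children hsub hdisj Q S.2 S'.2
                fun h => hne (Subtype.ext h)
            · exact fun S => (S : Cube).measurableSet_toSet.diff
                (MeasurableSet.biUnion (hc S) fun P _ => P.measurableSet_toSet)
        _ ≤ _ := by
            gcongr
            exact Set.iUnion_subset fun S => Set.sdiff_subset.trans
              (toSet_subset_of_mem_descendants hsub S.2)
    exact (h1.trans_lt (ENNReal.mul_lt_top (by simp) Q.volume_ne_top.lt_top)).ne
  -- By Borel–Cantelli almost every point lies in finitely many cubes of the tree, so the recursion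
  -- stops there and no remainder has to be estimated.
  filter_upwards [ae_finite_setOfPred_mem hfin, (ae_ball_iff hcount).2 fun S _ => h S] with x hxf hxh hxQ
  have hxf' : {S | S ∈ descendants ch Q ∧ x ∈ S.toSet}.Finite := by
    refine (hxf.image Subtype.val).subset ?_
    rintro S ⟨hS, hxS⟩
    exact ⟨⟨S, hS⟩, hxS, rfl⟩
  -- Induction on the number of cubes below `R` that contain `x`: passing to the child that contains
  -- `x` discards at least `R`. The case 0 is void because `R` itself contains `x`.
  have main : ∀ n : ℕ, ∀ R ∈ descendants ch Q, x ∈ R.toSet →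
      {S | S ∈ descendants ch R ∧ x ∈ S.toSet}.ncard ≤ n →
      F R x ≤ ∑' S : descendants ch R, (S : Cube).toSet.indicator (fun _ => a S) x := by
    intro n
    induction n with
    | zero =>
      intro R hR hxR hn
      have hfinR : {S | S ∈ descendants ch R ∧ x ∈ S.toSet}.Finite :=
        hxf'.subset fun S hS => ⟨hR.trans hS.1, hS.2⟩
      rw [Nat.le_zero, Set.ncard_eq_zero hfinR] at hn
      exact absurd (show R ∈ (∅ : Set Cube) from hn ▸ ⟨self_mem_descendants R, hxR⟩)
        (Set.notMem_empty R)
    | succ n ih =>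
      intro R hR hxR hn
      have hfinR : {S | S ∈ descendants ch R ∧ x ∈ S.toSet}.Finite :=
        hxf'.subset fun S hS => ⟨hR.trans hS.1, hS.2⟩
      obtain ⟨h1, h2⟩ := hxh R hR hxR
      by_cases hxU : x ∈ ⋃ P ∈ ch R, P.toSet
      · obtain ⟨P, hP, hxP⟩ := Set.mem_iUnion₂.1 hxU
        have hRP := ne_of_mem_children hsub hhalf hP
        have hlt : {S | S ∈ descendants ch P ∧ x ∈ S.toSet}.ncard <
            {S | S ∈ descendants ch R ∧ x ∈ S.toSet}.ncard := by
          refine Set.ncard_lt_ncard ⟨fun S hS => ⟨descendants_subset_of_mem hP hS.1, hS.2⟩,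
            fun hle => hRP (hle ⟨self_mem_descendants R, hxR⟩).1⟩ hfinR
        have hPs := ih P (hR.tail hP) hxP (by omega)
        have hss : {R} ∪ descendants ch P ⊆ descendants ch R :=
          Set.union_subset (Set.singleton_subset_iff.2 (self_mem_descendants R))
            (descendants_subset_of_mem hP)
        calc F R x ≤ a R + F P x := h2 P hP hxP
          _ ≤ a R + ∑' S : descendants ch P, (S : Cube).toSet.indicator (fun _ => a S) x := by
              gcongr
          _ = ∑' S : ({R} ∪ descendants ch P : Set Cube),
                (S : Cube).toSet.indicator (fun _ => a S) x := by
              rw [ENNReal.summable.tsum_union_disjoint (Set.disjoint_singleton_left.2 hRP)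
                ENNReal.summable (f := fun S : Cube => S.toSet.indicator (fun _ => a S) x),
                tsum_singleton R (fun S : Cube => S.toSet.indicator (fun _ => a S) x),
                Set.indicator_of_mem hxR]
          _ ≤ _ := ENNReal.tsum_mono_subtype
              (fun S : Cube => S.toSet.indicator (fun _ => a S) x) hss
      · refine (h1 hxU).trans ?_
        refine le_trans (le_of_eq ?_) (ENNReal.le_tsum (⟨R, self_mem_descendants R⟩ : descendants ch R))
        simp only [Set.indicator_of_mem hxR]
  exact main _ Q (self_mem_descendants Q) hxQ le_rfl

end Tree

/-- The concentric cube with a third of the side. -/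
noncomputable def Cube.third (Q : Cube) : Cube :=
  ⟨(Q.corner.1 + Q.side / 3, Q.corner.2 + Q.side / 3), Q.side / 3, by linarith [Q.side_pos]⟩

theorem Cube.third_triple (Q : Cube) : Q.triple.third = Q := by
  obtain ⟨⟨a, b⟩, s, hs⟩ := Q
  simp only [third, triple, mk.injEq, Prod.mk.injEq]
  refine ⟨⟨?_, ?_⟩, ?_⟩ <;> ring

/-- Iterated tripling of a cube. -/
def Cube.tripleIter (Q : Cube) : ℕ → Cube
  | 0 => Q
  | n + 1 => (Q.tripleIter n).triple

theorem Cube.side_tripleIter (Q : Cube) (n : ℕ) : (Q.tripleIter n).side = 3 ^ n * Q.side := by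
  induction n with
  | zero => simp [tripleIter]
  | succ n ih => rw [tripleIter, side_triple, ih, pow_succ]; ring

theorem Cube.center_tripleIter (Q : Cube) (n : ℕ) : (Q.tripleIter n).center = Q.center := by
  induction n with
  | zero => rfl
  | succ n ih => rw [tripleIter, center_triple, ih]

theorem Cube.tripleIter_mono (Q : Cube) {m n : ℕ} (h : m ≤ n) :
    (Q.tripleIter m).toSet ⊆ (Q.tripleIter n).toSet :=
  monotone_nat_of_le_succ (f := fun n => (Q.tripleIter n).toSet)
    (fun n => (Q.tripleIter n).subset_triple) h

theorem Cube.exists_mem_tripleIter (Q : Cube) (x : Plane) : ∃ n, x ∈ (Q.tripleIter n).toSet := by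
  have hQ := Q.side_pos
  obtain ⟨n, hn⟩ := pow_unbounded_of_one_lt (2 * dist x Q.center / Q.side) (by norm_num : (1 : ℝ) < 3)
  rw [div_lt_iff₀ hQ] at hn
  refine ⟨n, (Q.tripleIter n).ball_subset_toSet ?_⟩
  rw [center_tripleIter, side_tripleIter, mem_ball]
  linarith

variable {T₁ : Lp ℂ 1 (volume : Measure Plane) →ₗ[ℂ] (Plane →ₘ[(volume : Measure Plane)] ℂ)}
  {K : Plane → Plane → ℂ} {θ A B : ℝ}

theorem localPart_eq {f : Plane → ℂ} (hf : MemLp f 1 volume) {Q : Cube}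
    (hQ : ∀ y ∉ Q.triple.toSet, f y = 0) : localPart T₁ hf Q = T₁ (hf.toLp f) := by
  have : Q.triple.toSet.indicator f = f :=
    Set.indicator_eq_self.2 fun y hy => by_contra fun h => hy (hQ y h)
  unfold localPart
  congr 1
  exact MemLp.toLp_congr _ _ (Eventually.of_forall fun y => congrFun this y)

/-- Far from the support of `f`, the size of the kernel controls `T f`. -/
theorem IsCZExtension.ae_far_le (hT : IsCZExtension K B T₁) (hK : IsRegularKernel θ A K)
    (hA : 0 ≤ A) {f : Plane → ℂ} (hf : MemLp f 1 volume) {p : ℝ} (hp : 1 < p) {Q : Cube}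
    (hQ : ∀ y ∉ Q.toSet, f y = 0) :
    ∀ᵐ x, x ∉ Q.triple.toSet → x ∈ Q.triple.triple.toSet →
      ‖T₁ (hf.toLp f) x‖ₑ ≤ ENNReal.ofReal (81 * A) * pAverage f p Q.triple.triple := by
  have hrep := hT.rep f hf (closedBall Q.center (Q.side / 2)) isClosed_closedBall
    fun y hy => hQ y fun h => hy (Q.toSet_subset_closedBall h)
  filter_upwards [hrep] with x hx hxn hxm
  rw [hx fun h => hxn (Q.closedBall_subset_triple h)]
  have hs := Q.side_pos
  calc _ ≤ ∫⁻ y, ‖K x y * f y‖ₑ := enorm_integral_le_lintegral_enorm _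
    _ ≤ ∫⁻ y, ENNReal.ofReal (A / Q.side ^ 2) * ‖f y‖ₑ := by
        refine lintegral_mono fun y => ?_
        simp only [enorm_mul]
        by_cases hy : y ∈ Q.toSet
        · refine mul_le_mul_left ?_ _
          rw [← ofReal_norm]
          refine ENNReal.ofReal_le_ofReal (hK.norm_le_of_le_dist hA hs ?_)
          rw [dist_comm]
          exact Cube.side_le_dist hy hxn
        · simp [hQ y hy]
    _ = ENNReal.ofReal (A / Q.side ^ 2) * ∫⁻ y in Q.triple.triple.toSet, ‖f y‖ₑ := by
        rw [lintegral_const_mul' _ _ ENNReal.ofReal_ne_top,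
          ← lintegral_indicator Q.triple.triple.measurableSet_toSet]
        congr 1
        refine lintegral_congr fun y => ?_
        by_cases hy : y ∈ Q.triple.triple.toSet
        · simp [hy]
        · simp [hy, hQ y fun h => hy (Q.triple.subset_triple (Q.subset_triple h))]
    _ ≤ ENNReal.ofReal (A / Q.side ^ 2) *
          (pAverage f p Q.triple.triple * volume Q.triple.triple.toSet) := by
        gcongr
        exact setLIntegral_le_pAverage hf.1 hp _
    _ = _ := by
        rw [Cube.volume_toSet, Cube.side_triple, Cube.side_triple, mul_comm (pAverage _ _ _),
          ← mul_assoc, ← ENNReal.ofReal_mul (by positivity)]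
        congr 2
        field_simp
        norm_num

theorem exists_cube_of_hasCompactSupport {f : Plane → ℂ} (hf : HasCompactSupport f) :
    ∃ Q : Cube, ∀ y ∉ Q.toSet, f y = 0 := by
  obtain ⟨r, hr⟩ := hf.isCompact.isBounded.subset_ball (0 : Plane)
  refine ⟨Cube.ofCenter 0 (max r 1) (by positivity), fun y hy => image_eq_zero_of_notMem_tsupport
    fun h => hy (Cube.ball_subset_toSet _ ?_)⟩
  rw [Cube.center_ofCenter, Cube.side_ofCenter, mul_div_cancel_left₀ _ two_ne_zero]
  exact ball_subset_ball (le_max_left _ _) (hr h)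

theorem IsCZExtension.sparse_domination (hT : IsCZExtension K B T₁) (hB : 0 < B)
    (hK : IsRegularKernel θ A K) (hA : 0 ≤ A) (hθ : 0 < θ) (hθ1 : θ ≤ 1) {p : ℝ} (hp : 1 < p) :
    PointwiseSparseDomination T₁ p hp.le ((sparseConst θ A B + 81 * A) * (p / (p - 1))) (1 / 18) := by
  intro f hfp hfc
  set hf := memLp_one_of_hasCompactSupport hp.le hfp hfc
  set C := ENNReal.ofReal ((sparseConst θ A B + 81 * A) * (p / (p - 1))) with hC
  have hp' : 1 ≤ p / (p - 1) := by rw [one_le_div₀ (by linarith)]; linarith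
  have hsc : 0 ≤ sparseConst θ A B := by rw [sparseConst]; positivity
  have hC1 : ENNReal.ofReal (sparseConst θ A B * (p / (p - 1))) ≤ C := by
    refine ENNReal.ofReal_le_ofReal ?_
    gcongr
    linarith
  have hC2 : ENNReal.ofReal (81 * A) ≤ C := by
    refine ENNReal.ofReal_le_ofReal ?_
    nlinarith
  choose ch hc hdisj hsub hhalf hlocal using
    fun Q => hT.exists_children hB hK hA hθ hθ1 hf hp hfp Q
  obtain ⟨Q₀, hQ₀⟩ := exists_cube_of_hasCompactSupport hfc
  -- With root 3Q₀, the complement of the root is at distance at least the side of Q₀ from the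
  -- support, so the size bound applies there.
  set Q := Q₀.triple with hQ
  set D := descendants ch Q with hD
  -- The family starts at 27Q₀, because 9Q₀ is the triple of the root and already belongs to the
  -- tripled tree.
  set far : Set Cube := Set.range fun n => Q₀.tripleIter (n + 3) with hfar
  have hDside : ∀ S ∈ D, S.triple.side ≤ 9 * Q₀.side := by
    intro S hS
    have := Cube.side_le_of_subset (toSet_subset_of_mem_descendants hsub hS)
    rw [hQ, Cube.side_triple] at this
    rw [Cube.side_triple]
    linarith
  have hfside : ∀ n, 9 * Q₀.side < (Q₀.tripleIter (n + 3)).side := by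
    intro n
    rw [Cube.side_tripleIter, pow_add]
    have h1 : (1 : ℝ) ≤ 3 ^ n := one_le_pow₀ (by norm_num)
    nlinarith [Q₀.side_pos]
  classical
  -- The side length separates the two families. A tripled tree cube 3S gets what the children of S
  -- leave over, at least |S|/2 = |3S|/18. A far cube gets the annulus outside its concentric third,
  -- which is 8/9 of it.
  set E : Cube → Set Plane := fun R => if R.side ≤ 9 * Q₀.side then
    R.third.toSet \ ⋃ P ∈ ch R.third, P.toSet else R.toSet \ R.third.toSet with hE
  have hE1 : ∀ S ∈ D, E S.triple = S.toSet \ ⋃ P ∈ ch S, P.toSet := fun S hS => by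
    simp only [hE, if_pos (hDside S hS), Cube.third_triple]
  have hE2 : ∀ n, E (Q₀.tripleIter (n + 3)) =
      (Q₀.tripleIter (n + 3)).toSet \ (Q₀.tripleIter (n + 2)).toSet := fun n => by
    simp only [hE, if_neg (not_le.2 (hfside n))]
    rw [Cube.tripleIter, Cube.third_triple]
  have hDfar : ∀ S ∈ D, ∀ n, Disjoint (E S.triple) (E (Q₀.tripleIter (n + 3))) := by
    intro S hS n
    rw [hE1 S hS, hE2]
    refine Set.disjoint_left.2 fun z hz hz' => hz'.2 ?_
    exact Q₀.tripleIter_mono (show 1 ≤ n + 2 by omega)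
      (toSet_subset_of_mem_descendants hsub hS hz.1)
  have hfarlt : ∀ m n, m < n →
      Disjoint (E (Q₀.tripleIter (m + 3))) (E (Q₀.tripleIter (n + 3))) := by
    intro m n hmn
    rw [hE2, hE2]
    exact Set.disjoint_left.2 fun z hz hz' =>
      hz'.2 (Q₀.tripleIter_mono (show m + 3 ≤ n + 2 by omega) hz.1)
  refine ⟨Cube.triple '' D ∪ far, ⟨E, ?_, ?_⟩, ?_⟩
  · rintro _ (⟨S, hS, rfl⟩ | ⟨n, rfl⟩)
    · rw [hE1 S hS]
      refine ⟨S.measurableSet_toSet.diff (MeasurableSet.biUnion (hc S) fun P _ =>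
        P.measurableSet_toSet), Set.sdiff_subset.trans S.subset_triple, ?_⟩
      rw [Cube.volume_triple]
      calc _ ≤ ENNReal.ofReal (1 / 18) * (9 * (2 * volume (S.toSet \ ⋃ P ∈ ch S, P.toSet))) := by
            gcongr
            exact volume_le_two_mul_sdiff hc hhalf S
        _ = ENNReal.ofReal (1 / 18) * ENNReal.ofReal 18 *
              volume (S.toSet \ ⋃ P ∈ ch S, P.toSet) := by
            rw [ENNReal.ofReal_ofNat, show (18 : ℝ≥0∞) = 9 * 2 by norm_num]; ring
        _ = _ := by rw [← ENNReal.ofReal_mul (by norm_num)]; norm_num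
    · change MeasurableSet (E (Q₀.tripleIter (n + 3))) ∧ E (Q₀.tripleIter (n + 3)) ⊆ _ ∧
        _ ≤ volume (E (Q₀.tripleIter (n + 3)))
      rw [hE2]
      refine ⟨(Cube.measurableSet_toSet _).diff (Cube.measurableSet_toSet _), Set.sdiff_subset, ?_⟩
      have hsubn := Q₀.tripleIter_mono (show n + 2 ≤ n + 3 by omega)
      rw [measure_sdiff hsubn (Cube.measurableSet_toSet _).nullMeasurableSet
        (Cube.volume_ne_top _), Cube.volume_toSet, Cube.volume_toSet, ← ENNReal.ofReal_mul
        (by norm_num), ← ENNReal.ofReal_sub _ (sq_nonneg _)]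
      refine ENNReal.ofReal_le_ofReal ?_
      rw [Cube.side_tripleIter, Cube.side_tripleIter, pow_succ 3 (n + 2)]
      nlinarith [sq_nonneg (3 ^ (n + 2) * Q₀.side)]
  · rintro _ (⟨S, hS, rfl⟩ | ⟨m, rfl⟩) _ (⟨S', hS', rfl⟩ | ⟨n, rfl⟩) hne
    · simp only [Function.onFun]
      rw [hE1 S hS, hE1 S' hS']
      exact pairwiseDisjoint_sdiff_children hsub hdisj Q hS hS' fun h => hne (by rw [h])
    · exact hDfar S hS n
    · exact (hDfar S' hS' m).symm
    · rcases lt_trichotomy m n with h | h | h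
      · exact hfarlt m n h
      · exact absurd (by rw [h]) hne
      · exact (hfarlt n m h).symm
  · have hnear := ae_le_tsum_descendants hc hsub hdisj hhalf
      (F := fun Q x => ‖localPart T₁ hf Q x‖ₑ)
      (a := fun Q => ENNReal.ofReal (sparseConst θ A B * (p / (p - 1))) * pAverage f p Q.triple)
      hlocal Q
    have hfarae : ∀ᵐ x, ∀ n, x ∉ (Q₀.tripleIter (n + 1)).toSet → x ∈ (Q₀.tripleIter (n + 2)).toSet →
        ‖T₁ (hf.toLp f) x‖ₑ ≤ ENNReal.ofReal (81 * A) * pAverage f p (Q₀.tripleIter (n + 2)) :=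
      ae_all_iff.2 fun n => hT.ae_far_le hK hA hf hp (Q := Q₀.tripleIter n) fun y hy =>
        hQ₀ y fun h => hy (Q₀.tripleIter_mono (Nat.zero_le n) h)
    have hQsupp : ∀ y ∉ Q.triple.toSet, f y = 0 := fun y hy =>
      hQ₀ y fun h => hy (Q.subset_triple (Q₀.subset_triple h))
    rw [localPart_eq hf hQsupp] at hnear
    filter_upwards [hnear, hfarae] with x hx1 hx2
    by_cases hxQ : x ∈ Q.toSet
    · calc _ ≤ _ := hx1 hxQ
        _ ≤ ∑' S : D, C * (S : Cube).triple.toSet.indicator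
              (fun _ => pAverage f p (S : Cube).triple) x := by
            refine ENNReal.tsum_le_tsum fun S => ?_
            by_cases hxS : x ∈ (S : Cube).toSet
            · rw [Set.indicator_of_mem hxS, Set.indicator_of_mem (Cube.subset_triple _ hxS)]
              gcongr
            · rw [Set.indicator_of_notMem hxS]; exact zero_le
        _ = C * ∑' R : (Cube.triple '' D : Set Cube),
              (R : Cube).toSet.indicator (fun _ => pAverage f p R) x := by
            rw [ENNReal.tsum_mul_left, tsum_image
              (fun R : Cube => R.toSet.indicator (fun _ => pAverage f p R) x)
              Cube.triple_injective.injOn]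
        _ ≤ _ := by
            gcongr
            exact ENNReal.tsum_mono_subtype
              (fun R : Cube => R.toSet.indicator (fun _ => pAverage f p R) x) Set.subset_union_left
    · have hex := Q₀.exists_mem_tripleIter x
      -- The smallest iterate that contains `x` has index at least 2, since `x` lies outside the
      -- root, which is the iterate of index 1.
      obtain ⟨n, hn1, hn2⟩ : ∃ n, x ∉ (Q₀.tripleIter (n + 1)).toSet ∧
          x ∈ (Q₀.tripleIter (n + 2)).toSet := by
        have hpos : 2 ≤ Nat.find hex := by
          by_contra! hlt
          exact hxQ (Q₀.tripleIter_mono (show Nat.find hex ≤ 1 by omega) (Nat.find_spec hex))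
        obtain ⟨n, hn⟩ := Nat.exists_eq_add_of_le hpos
        refine ⟨n, Nat.find_min hex (by omega), ?_⟩
        rw [add_comm n 2, ← hn]
        exact Nat.find_spec hex
      have hmem : Q₀.tripleIter (n + 2) ∈ Cube.triple '' D ∪ far := by
        obtain _ | n := n
        · exact Or.inl ⟨Q, self_mem_descendants Q, rfl⟩
        · exact Or.inr ⟨n, rfl⟩
      calc _ ≤ _ := hx2 n hn1 hn2
        _ ≤ C * pAverage f p (Q₀.tripleIter (n + 2)) := by gcongr
        _ ≤ _ := by
            gcongr
            refine le_trans (le_of_eq ?_) (ENNReal.le_tsum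
              (⟨_, hmem⟩ : (Cube.triple '' D ∪ far : Set Cube)))
            simp only [Set.indicator_of_mem hn2]

end

/-! ### From CZX kernels to regular kernels. -/

section

/-- The exponent θ₂ = 1 enters here: 1/(ab) · (a/b + b/a)⁻¹ = 1/(a² + b²). -/
theorem one_div_mul_decay {x y : Plane} (h1 : x.1 ≠ y.1) (h2 : x.2 ≠ y.2) :
    (1 / |x.1 - y.1|) * (1 / |x.2 - y.2|) * decay 1 x y =
      1 / (|x.1 - y.1| ^ 2 + |x.2 - y.2| ^ 2) := by
  have ha : 0 < |x.1 - y.1| := abs_pos.2 (sub_ne_zero.2 h1)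
  have hb : 0 < |x.2 - y.2| := abs_pos.2 (sub_ne_zero.2 h2)
  rw [decay, Real.rpow_neg_one]
  field_simp

theorem dist_sq_le (x y : Plane) : dist x y ^ 2 ≤ |x.1 - y.1| ^ 2 + |x.2 - y.2| ^ 2 := by
  rw [Prod.dist_eq, Real.dist_eq, Real.dist_eq]
  rcases max_choice |x.1 - y.1| |x.2 - y.2| with h | h <;> rw [h]
  · linarith [sq_nonneg |x.2 - y.2|]
  · linarith [sq_nonneg |x.1 - y.1|]

theorem mul_inv_sum_sq_le {A s : ℝ} (hs : 0 ≤ s) {x y : Plane} (h1 : x.1 ≠ y.1) :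
    A * s * (1 / (|x.1 - y.1| ^ 2 + |x.2 - y.2| ^ 2)) ≤ |A| * s / dist x y ^ 2 := by
  have hd : 0 < dist x y := dist_pos.2 fun h => h1 (by rw [h])
  rw [mul_one_div]
  gcongr
  · exact le_abs_self A
  · exact dist_sq_le x y

theorem rpow_div_rpow_one_add {a : ℝ} (ha : 0 < a) {h : ℝ} (hh : 0 ≤ h) (θ : ℝ) :
    h ^ θ / a ^ (1 + θ) = (h / a) ^ θ * (1 / a) := by
  rw [Real.rpow_add ha, Real.rpow_one, Real.div_rpow hh ha.le]
  field_simp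

/-- The kernel, set to zero where it is not defined. -/
noncomputable def offCross (K : Plane → Plane → ℂ) (x y : Plane) : ℂ :=
  open Classical in if x.1 ≠ y.1 ∧ x.2 ≠ y.2 then K x y else 0

theorem ne_of_abs_sub_le_half {a b w : ℝ} (h : a ≠ b) (hw : |a - w| ≤ |a - b| / 2) : w ≠ b := by
  rintro rfl
  have := abs_pos.2 (sub_ne_zero.2 h)
  linarith

/-- On the cross the only admissible perturbation is trivial, so the regularity of `offCross` holds
without exceptions. -/
theorem eq_of_abs_sub_le_half {a b w : ℝ} (h : a = b) (hw : |a - w| ≤ |a - b| / 2) : w = a := by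
  rw [h, sub_self, abs_zero, zero_div] at hw
  rw [h]
  linarith [abs_nonpos_iff.1 hw]

section Bounds

variable {θ A : ℝ} {K : Plane → Plane → ℂ}

theorem IsCZXKernel.flip (hK : IsCZXKernel θ 1 A K) : IsCZXKernel θ 1 A (flip K) := by
  have hd : ∀ x y : Plane, decay 1 x y = decay 1 y x := fun x y => by
    rw [decay, decay, abs_sub_comm x.1, abs_sub_comm x.2]
  constructor
  · intro x y h1 h2
    have := hK.size y x h1.symm h2.symm
    rwa [hd, abs_sub_comm y.1 x.1, abs_sub_comm y.2 x.2] at this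
  · intro x y w h1 h2 hw
    have := hK.holder_y1 y x w h1.symm h2.symm (by rwa [abs_sub_comm y.1 x.1])
    rwa [hd, abs_sub_comm y.1 x.1, abs_sub_comm y.2 x.2] at this
  · intro x y w h1 h2 hw
    have := hK.holder_y2 y x w h1.symm h2.symm (by rwa [abs_sub_comm y.2 x.2])
    rwa [hd, abs_sub_comm y.1 x.1, abs_sub_comm y.2 x.2] at this
  · intro x y w h1 h2 hw
    have := hK.holder_x1 y x w h1.symm h2.symm (by rwa [abs_sub_comm y.1 x.1])
    rwa [hd, abs_sub_comm y.1 x.1, abs_sub_comm y.2 x.2] at this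
  · intro x y w h1 h2 hw
    have := hK.holder_x2 y x w h1.symm h2.symm (by rwa [abs_sub_comm y.2 x.2])
    rwa [hd, abs_sub_comm y.1 x.1, abs_sub_comm y.2 x.2] at this

theorem flip_offCross (K : Plane → Plane → ℂ) : flip (offCross K) = offCross (flip K) := by
  ext x y
  simp only [flip, offCross, ne_comm (a := y.1), ne_comm (a := y.2)]

theorem IsCZXKernel.norm_offCross_le (hK : IsCZXKernel θ 1 A K) (x y : Plane) :
    ‖offCross K x y‖ ≤ |A| / dist x y ^ 2 := by
  unfold offCross
  split_ifs with h
  · have := mul_inv_sum_sq_le (A := A) zero_le_one h.1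
    rw [mul_one, mul_one, ← one_div_mul_decay h.1 h.2] at this
    refine (hK.size x y h.1 h.2).trans (le_trans (le_of_eq ?_) this)
    ring
  · rw [norm_zero]; positivity

theorem IsCZXKernel.offCross_reg_fst (hK : IsCZXKernel θ 1 A K) (x y : Plane) (w : ℝ)
    (hw : |x.1 - w| ≤ |x.1 - y.1| / 2) :
    ‖offCross K x y - offCross K (w, x.2) y‖ ≤
      |A| * (|x.1 - w| / |x.1 - y.1|) ^ θ / dist x y ^ 2 := by
  by_cases h1 : x.1 = y.1
  · rw [eq_of_abs_sub_le_half h1 hw, sub_self, norm_zero]; positivity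
  by_cases h2 : x.2 = y.2
  · simp only [offCross, h2, ne_eq, not_true_eq_false, and_false, if_false, sub_zero, norm_zero]
    positivity
  have hw1 := ne_of_abs_sub_le_half h1 hw
  rw [offCross, offCross, if_pos ⟨h1, h2⟩, if_pos ⟨hw1, h2⟩]
  have ha : 0 < |x.1 - y.1| := abs_pos.2 (sub_ne_zero.2 h1)
  have := mul_inv_sum_sq_le (A := A) (s := (|x.1 - w| / |x.1 - y.1|) ^ θ) (by positivity) h1
  rw [← one_div_mul_decay h1 h2] at this
  refine (hK.holder_x1 x y w h1 h2 hw).trans (le_trans (le_of_eq ?_) this)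
  rw [rpow_div_rpow_one_add ha (abs_nonneg _)]
  ring

theorem IsCZXKernel.offCross_reg_snd (hK : IsCZXKernel θ 1 A K) (x y : Plane) (w : ℝ)
    (hw : |x.2 - w| ≤ |x.2 - y.2| / 2) :
    ‖offCross K x y - offCross K (x.1, w) y‖ ≤
      |A| * (|x.2 - w| / |x.2 - y.2|) ^ θ / dist x y ^ 2 := by
  by_cases h2 : x.2 = y.2
  · rw [eq_of_abs_sub_le_half h2 hw, sub_self, norm_zero]; positivity
  by_cases h1 : x.1 = y.1
  · simp only [offCross, h1, ne_eq, not_true_eq_false, false_and, if_false, sub_zero, norm_zero]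
    positivity
  have hw1 := ne_of_abs_sub_le_half h2 hw
  rw [offCross, offCross, if_pos ⟨h1, h2⟩, if_pos ⟨h1, hw1⟩]
  have ha : 0 < |x.2 - y.2| := abs_pos.2 (sub_ne_zero.2 h2)
  have := mul_inv_sum_sq_le (A := A) (s := (|x.2 - w| / |x.2 - y.2|) ^ θ) (by positivity) h1
  rw [← one_div_mul_decay h1 h2] at this
  refine (hK.holder_x2 x y w h1 h2 hw).trans (le_trans (le_of_eq ?_) this)
  rw [rpow_div_rpow_one_add ha (abs_nonneg _)]
  ring

theorem IsCZXKernel.norm_offCross_sub_le (hK : IsCZXKernel θ 1 A K) (hθ : 0 < θ) {m d : ℝ}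
    (hm : 0 < m) (hdm : d ≤ m / 2) {x x' y : Plane} (hx : |x.1 - x'.1| ≤ d) (hx' : |x.2 - x'.2| ≤ d)
    (h1 : m ≤ |x.1 - y.1|) (h2 : m ≤ |x.2 - y.2|) :
    ‖offCross K x y - offCross K x' y‖ ≤ 2 * (|A| * (d / m) ^ θ / m ^ 2) := by
  have hd : ∀ z : Plane, m ≤ |z.2 - y.2| → m ≤ dist z y := fun z hz =>
    hz.trans (by rw [Prod.dist_eq]; exact le_max_right _ _)
  have r1 := hK.offCross_reg_fst x y x'.1 (by linarith)
  have r2 := hK.offCross_reg_snd (x'.1, x.2) y x'.2 (by simp only; linarith)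
  have b1 : |A| * (|x.1 - x'.1| / |x.1 - y.1|) ^ θ / dist x y ^ 2 ≤ |A| * (d / m) ^ θ / m ^ 2 := by
    have := hd x h2
    have := (abs_nonneg _).trans hx
    gcongr
  have b2 : |A| * (|x.2 - x'.2| / |x.2 - y.2|) ^ θ / dist ((x'.1, x.2) : Plane) y ^ 2 ≤
      |A| * (d / m) ^ θ / m ^ 2 := by
    have := hd (x'.1, x.2) h2
    have := (abs_nonneg _).trans hx
    gcongr
  calc _ = ‖(offCross K x y - offCross K (x'.1, x.2) y) +
        (offCross K (x'.1, x.2) y - offCross K x' y)‖ := by rw [sub_add_sub_cancel]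
    _ ≤ _ := norm_add_le _ _
    _ ≤ _ := add_le_add (r1.trans b1) (r2.trans b2)
    _ = _ := by ring

/-- No measurability of the kernel is assumed. The Hölder estimates in all four variables make it
continuous on the open set off the cross, and it is 0 elsewhere. -/
theorem IsCZXKernel.measurable_offCross (hK : IsCZXKernel θ 1 A K) (hθ : 0 < θ) :
    Measurable (Function.uncurry (offCross K)) := by
  set U : Set (Plane × Plane) := {z | z.1.1 ≠ z.2.1 ∧ z.1.2 ≠ z.2.2} with hU
  have hUo : IsOpen U := by
    refine IsOpen.inter ?_ ?_
    · exact isOpen_ne_fun (by fun_prop) (by fun_prop)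
    · exact isOpen_ne_fun (by fun_prop) (by fun_prop)
  have hcont : ContinuousOn (Function.uncurry (offCross K)) U := by
    rintro ⟨x, y⟩ ⟨h1, h2⟩
    refine ContinuousAt.continuousWithinAt ?_
    change x.1 ≠ y.1 at h1
    change x.2 ≠ y.2 at h2
    -- The margin 2m leaves both gaps at least m after `x` has moved by at most m/2, so that `y` can
    -- be moved next.
    obtain ⟨m, hm, hm1, hm2⟩ : ∃ m : ℝ, 0 < m ∧ 2 * m ≤ |x.1 - y.1| ∧ 2 * m ≤ |x.2 - y.2| := by
      refine ⟨min |x.1 - y.1| |x.2 - y.2| / 2, ?_, ?_, ?_⟩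
      · have := lt_min (abs_pos.2 (sub_ne_zero.2 h1)) (abs_pos.2 (sub_ne_zero.2 h2))
        linarith
      · linarith [min_le_left |x.1 - y.1| |x.2 - y.2|]
      · linarith [min_le_right |x.1 - y.1| |x.2 - y.2|]
    rw [ContinuousAt, tendsto_iff_norm_sub_tendsto_zero]
    have hlim : Tendsto (fun z : Plane × Plane => 4 * (|A| * (dist (x, y) z / m) ^ θ / m ^ 2))
        (𝓝 (x, y)) (𝓝 0) := by
      have h0 : Tendsto (fun z : Plane × Plane => dist (x, y) z / m) (𝓝 (x, y)) (𝓝 0) := by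
        have hc : Continuous fun z : Plane × Plane => dist (x, y) z / m := by fun_prop
        simpa using hc.tendsto (x, y)
      have := h0.rpow_const (p := θ) (Or.inr hθ.le)
      rw [Real.zero_rpow hθ.ne'] at this
      simpa using ((this.const_mul |A|).div_const (m ^ 2)).const_mul 4
    refine squeeze_zero' (Eventually.of_forall fun _ => norm_nonneg _) ?_ hlim
    filter_upwards [ball_mem_nhds (x, y) (half_pos hm)] with ⟨x', y'⟩ hz
    set d := dist (x, y) (x', y') with hd
    have hdm : d ≤ m / 2 := by rw [hd, dist_comm]; exact (mem_ball.1 hz).le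
    have e1 : dist x x' ≤ d := by rw [hd, Prod.dist_eq]; exact le_max_left _ _
    have e2 : dist y y' ≤ d := by rw [hd, Prod.dist_eq]; exact le_max_right _ _
    rw [Prod.dist_eq, Real.dist_eq, Real.dist_eq] at e1 e2
    obtain ⟨e11, e12⟩ := max_le_iff.1 e1
    obtain ⟨e21, e22⟩ := max_le_iff.1 e2
    have t1 : |x.1 - y.1| ≤ |x.1 - x'.1| + |x'.1 - y.1| := abs_sub_le _ _ _
    have t2 : |x.2 - y.2| ≤ |x.2 - x'.2| + |x'.2 - y.2| := abs_sub_le _ _ _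
    have k1 := hK.norm_offCross_sub_le hθ hm hdm e11 e12 (y := y) (by linarith) (by linarith)
    have k2 := hK.flip.norm_offCross_sub_le hθ hm hdm e21 e22 (y := x')
      (by rw [abs_sub_comm]; linarith) (by rw [abs_sub_comm]; linarith)
    rw [← flip_offCross] at k2
    rw [norm_sub_rev]
    change ‖offCross K x y - offCross K x' y'‖ ≤ _
    calc _ = ‖(offCross K x y - offCross K x' y) + (offCross K x' y - offCross K x' y')‖ := by
          rw [sub_add_sub_cancel]
      _ ≤ _ := norm_add_le _ _
      _ ≤ _ := add_le_add k1 k2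
      _ = _ := by ring
  classical
  have hp := hcont.measurable_piecewise (g := fun _ => (0 : ℂ)) continuousOn_const hUo.measurableSet
  convert hp using 1
  ext ⟨x, y⟩
  by_cases hz : ((x, y) : Plane × Plane) ∈ U
  · rw [Set.piecewise_eq_of_mem _ _ _ hz]
  · rw [Set.piecewise_eq_of_notMem _ _ _ hz]
    exact if_neg hz

theorem IsCZXKernel.isRegularKernel (hK : IsCZXKernel θ 1 A K) (hθ : 0 < θ) :
    IsRegularKernel θ |A| (offCross K) :=
  ⟨hK.measurable_offCross hθ, hK.norm_offCross_le, hK.offCross_reg_fst, hK.offCross_reg_snd⟩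

end Bounds

/-- For fixed `x` the cross is a null set of `y`, so changing the kernel there does not affect the
integrals. -/
theorem HasKernel.offCross
    {T : Lp ℂ 2 (volume : Measure Plane) →L[ℂ] Lp ℂ 2 (volume : Measure Plane)}
    {K : Plane → Plane → ℂ} (hT : HasKernel T K) : HasKernel T (offCross K) := by
  intro f g hf hg hfg
  rw [hT f g hf hg hfg]
  refine integral_congr_ae (Eventually.of_forall fun x => integral_congr_ae ?_)
  filter_upwards [ae_fst_ne x.1, ae_snd_ne x.2] with y h1 h2
  simp only [CZX.offCross]
  rw [if_pos ⟨sub_ne_zero.1 h1, sub_ne_zero.1 h2⟩]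

end

/-! ### Assembly of the theorem. -/

section
theorem weakConst_pos {θ A : ℝ} (hθ : 0 < θ) (hA : 0 ≤ A) (N : ℝ) : 0 < weakConst θ A N := by
  unfold weakConst; positivity

variable {T : Lp ℂ 2 (volume : Measure Plane) →L[ℂ] Lp ℂ 2 (volume : Measure Plane)}
  {T₁ : Lp ℂ 1 (volume : Measure Plane) →ₗ[ℂ] (Plane →ₘ[(volume : Measure Plane)] ℂ)} {B : ℝ}

theorem IsWeakType.isWeakExtension (hW : IsWeakType T (ENNReal.ofReal B)) (hB : 0 ≤ B)
    (hT₁ : ∀ (f : Plane → ℂ) (hf : MemLp f 1 volume), IsExtensionValue T f (T₁ (hf.toLp f))) :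
    IsWeakExtension T T₁ where
  weak_type := by
    refine ⟨B, fun f t ht => ?_⟩
    have h := hT₁ f (Lp.memLp f)
    rw [Lp.toLp_coeFn] at h
    refine (hW.weak_type_of_isExtensionValue ENNReal.ofReal_ne_top h ht).trans_eq ?_
    rw [ENNReal.ofReal_div_of_pos ht, ENNReal.ofReal_mul hB, ofReal_norm, Lp.enorm_def,
      eLpNorm_one_eq_lintegral_enorm]
  agrees f h₁ h₂ := hW.unique ENNReal.ofReal_ne_top (hT₁ f h₁) (isExtensionValue_self h₁ h₂)

end

end CZX

theorem mainTheorem6 :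
    ∃ ε : ℝ, 0 < ε ∧
      ∀ θ₁ : ℝ, 0 < θ₁ → θ₁ ≤ 1 → ∀ A N : ℝ, ∃ C : ℝ, 0 < C ∧
        ∀ (K : CZX.Plane → CZX.Plane → ℂ)
          (T : Lp ℂ 2 (volume : Measure CZX.Plane) →L[ℂ] Lp ℂ 2 (volume : Measure CZX.Plane)),
          CZX.IsCZXKernel θ₁ 1 A K → CZX.HasKernel T K → ‖T‖ ≤ N →
          ∃ T₁ : Lp ℂ 1 (volume : Measure CZX.Plane) →ₗ[ℂ]
              (CZX.Plane →ₘ[(volume : Measure CZX.Plane)] ℂ),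
            CZX.IsWeakExtension T T₁ ∧
            ∀ (p : ℝ) (hp : 1 < p),
              CZX.PointwiseSparseDomination T₁ p hp.le (C * (p / (p - 1))) ε := by
  refine ⟨1 / 18, by norm_num, fun θ hθ hθ1 A N => ?_⟩
  -- `A` is an arbitrary real number; replacing it by |A| only weakens the kernel estimates and
  -- makes the constants nonnegative.
  have hA : 0 ≤ |A| := abs_nonneg A
  have hB := CZX.weakConst_pos hθ hA N
  have hC : 0 < CZX.sparseConst θ |A| (CZX.weakConst θ |A| N) + 81 * |A| := by
    unfold CZX.sparseConst; positivity
  refine ⟨_, hC, fun K T hK hT hN => ?_⟩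
  have hR := hK.isRegularKernel hθ
  have hR' : CZX.IsRegularKernel θ |A| (flip (CZX.offCross K)) := by
    rw [CZX.flip_offCross]
    exact hK.flip.isRegularKernel hθ
  have hT' := hT.offCross
  have hW : CZX.IsWeakType T (ENNReal.ofReal (CZX.weakConst θ |A| N)) :=
    fun f h1 h2 t ht => hT'.weak_type hR hR' hA hθ hθ1 hN h1 h2 ht
  obtain ⟨T₁, hT₁⟩ := hW.exists_extension ENNReal.ofReal_ne_top
  have hE : CZX.IsCZExtension (CZX.offCross K) (CZX.weakConst θ |A| N) T₁ :=
    ⟨fun f hf t ht => hW.weak_type_of_isExtensionValue ENNReal.ofReal_ne_top (hT₁ f hf) ht,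
      fun f hf F hF hfF => hW.ae_eq_integral ENNReal.ofReal_ne_top hT' hR hA hf (hT₁ f hf) hF hfF⟩
  exact ⟨T₁, hW.isWeakExtension hB.le hT₁, fun p hp => hE.sparse_domination hB hR hA hθ hθ1 hp⟩
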